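/- Consider the single-machine scheduling problem $1|\sum w_jC_j|er$. An instance consists of $n$ jobs, job $j$ having an integer processing time $p_j\ge 1$ and an integer weight $w_j\ge 0$, a set $J^r$ of jobs that require an external resource, and a budget $K\in\mathbb{N}$. Put $P=\sum_j p_j$ and $W=\sum_j w_j$, and assume $W\ge 1$. A sequence is an ordering $\sigma$ of the jobs, which are processed in this order without idle time from time $0$ on; $C_j^\sigma$ is the completion time of job $j$. The length of the renting period of $\sigma$ is $er(\sigma)=\max_{j\in J^r}C_j^\sigma-\min_{j\in J^r}(C_j^\sigma-p_j)$ (and $er(\sigma)=0$ if $J^r=\emptyset$). The task is to find a sequence $\sigma$ that minimizes $er(\sigma)$ among all sequences with $\sum_j w_jC_j^\sigma\le K$, or to report that there is no such sequence. Theorem. The problem $1|\sum w_jC_j|er$ can be solved in $O(nP\min\{W,P\})$ time. Precisely: there are a single word RAM program (unit cost for each access to a register or memory cell, constant, addition, truncated subtraction, multiplication, comparison, assignment and branch) and constants $c,d\in\mathbb{N}$ such that on every instance the program halts after at most $c\,nP\min\{W,P\}$ steps with a correct answer (the jobs in the order of an optimal sequence, or the report that no sequence respects the budget), and every number that it computes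 is at most $(n+P+W+K+2)^d$, that is, it fits into a word of $O(\log(n+P+W+K+2))$ bits. -/

import Mathlib

/-! Word RAM programs: finitely many registers, a random access memory of words, structured control
flow, and unit cost for each elementary operation. -/

namespace WordRAM

/-- A machine state: the registers and the memory cells, each holding a natural number. -/
structure State where
  reg : ℕ → ℕ
  mem : ℕ → ℕ

/-- Write `v` into register `x`. -/
def State.setReg (s : State) (x v : ℕ) : State :=
  { s with reg := Function.update s.reg x v }

/-- Write `v` into the memory cell with address `a`. -/
def State.setMem (s : State) (a v : ℕ) : State :=
  { s with mem := Function.update s.mem a v }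

/-- Arithmetic expressions. -/
inductive Exp where
  | const (k : ℕ)
  | var (x : ℕ)
  | read (a : Exp)
  | add (e f : Exp)
  | sub (e f : Exp)
  | mul (e f : Exp)
  | lt (e f : Exp)

/-- The value of an expression. `read a` is the content of the memory cell with address `a`
(indirect addressing), `sub` is truncated at `0`, and `lt` is `1` for true and `0` for false. -/
def Exp.eval (s : State) : Exp → ℕ
  | const k => k
  | var x => s.reg x
  | read a => s.mem (a.eval s)
  | add e f => e.eval s + f.eval s
  | sub e f => e.eval s - f.eval s
  | mul e f => e.eval s * f.eval s
  | lt e f => if e.eval s < f.eval s then 1 else 0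

/-- The number of elementary operations that evaluate an expression: one for each constant,
register access, memory access, arithmetic operation and comparison in it. -/
def Exp.cost : Exp → ℕ
  | const _ => 1
  | var _ => 1
  | read a => a.cost + 1
  | add e f => e.cost + f.cost + 1
  | sub e f => e.cost + f.cost + 1
  | mul e f => e.cost + f.cost + 1
  | lt e f => e.cost + f.cost + 1

/-- All values (and addresses) that occur in the evaluation of an expression are at most `B`, that
is, no word overflows. -/
def Exp.Fits (B : ℕ) (s : State) : Exp → Prop
  | const k => k ≤ B
  | var x => s.reg x ≤ B
  | read a => a.Fits B s ∧ s.mem (a.eval s) ≤ B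
  | add e f => e.Fits B s ∧ f.Fits B s ∧ e.eval s + f.eval s ≤ B
  | sub e f => e.Fits B s ∧ f.Fits B s
  | mul e f => e.Fits B s ∧ f.Fits B s ∧ e.eval s * f.eval s ≤ B
  | lt e f => e.Fits B s ∧ f.Fits B s ∧ 1 ≤ B

/-- Programs. `store a e` writes the value of `e` to the memory cell with address `a`; a condition
holds if its value is not `0`. -/
inductive Program where
  | skip
  | assign (x : ℕ) (e : Exp)
  | store (a e : Exp)
  | seq (c d : Program)
  | ite (e : Exp) (c d : Program)
  | while (e : Exp) (c : Program)

/-- `Exec B c s t s'`: started in state `s`, the program `c` halts in state `s'` after exactly `t`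
elementary steps, and no word that it computes exceeds `B`. -/
inductive Exec (B : ℕ) : Program → State → ℕ → State → Prop
  | skip (s : State) : Exec B .skip s 1 s
  | assign (s : State) (x : ℕ) (e : Exp) (he : e.Fits B s) :
      Exec B (.assign x e) s (e.cost + 1) (s.setReg x (e.eval s))
  | store (s : State) (a e : Exp) (ha : a.Fits B s) (he : e.Fits B s) :
      Exec B (.store a e) s (a.cost + e.cost + 1) (s.setMem (a.eval s) (e.eval s))
  | seq {c d : Program} {s s₁ s₂ : State} {t₁ t₂ : ℕ}
      (hc : Exec B c s t₁ s₁) (hd : Exec B d s₁ t₂ s₂) :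
      Exec B (.seq c d) s (t₁ + t₂) s₂
  | ite_true {e : Exp} {c d : Program} {s s' : State} {t : ℕ}
      (he : e.Fits B s) (hv : e.eval s ≠ 0) (hc : Exec B c s t s') :
      Exec B (.ite e c d) s (e.cost + 1 + t) s'
  | ite_false {e : Exp} {c d : Program} {s s' : State} {t : ℕ}
      (he : e.Fits B s) (hv : e.eval s = 0) (hd : Exec B d s t s') :
      Exec B (.ite e c d) s (e.cost + 1 + t) s'
  | while_true {e : Exp} {c : Program} {s s₁ s₂ : State} {t₁ t₂ : ℕ}
      (he : e.Fits B s) (hv : e.eval s ≠ 0) (hc : Exec B c s t₁ s₁)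
      (hw : Exec B (.while e c) s₁ t₂ s₂) :
      Exec B (.while e c) s (e.cost + 1 + t₁ + t₂) s₂
  | while_false {e : Exp} {c : Program} {s : State}
      (he : e.Fits B s) (hv : e.eval s = 0) :
      Exec B (.while e c) s (e.cost + 1) s

end WordRAM

/-! Single-machine scheduling with an external resource that is rented once, for an uninterrupted
period: minimize the renting period subject to a budget on the total weighted completion time. -/

/-- An instance: `n` jobs with processing times `p` and weights `w`, the set `Jr` of jobs that
require the external resource, and the budget `K` on the total weighted completion time. -/
structure RentInstance where
  n : ℕ
  p : Fin n → ℕ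
  w : Fin n → ℕ
  Jr : Finset (Fin n)
  K : ℕ

namespace RentInstance

/-- The total processing time. -/
def P (I : RentInstance) : ℕ := ∑ j, I.p j

/-- The total weight. -/
def W (I : RentInstance) : ℕ := ∑ j, I.w j

/-- The completion time of job `j` in the sequence `σ`, where `σ i` is the job in position `i`
and the jobs are processed one after the other from time `0` on. -/
def completionTime (I : RentInstance) (σ : Equiv.Perm (Fin I.n)) (j : Fin I.n) : ℕ :=
  ∑ i with σ.symm i ≤ σ.symm j, I.p i

/-- The total weighted completion time of the sequence `σ`. -/
def twc (I : RentInstance) (σ : Equiv.Perm (Fin I.n)) : ℕ :=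
  ∑ j, I.w j * I.completionTime σ j

/-- The length of the renting period of the sequence `σ`: the time from the first start to the last
completion of a job in `Jr`, and `0` if nothing has to be rented. The subtractions are exact, since
a job completes no earlier than its processing time. -/
def er (I : RentInstance) (σ : Equiv.Perm (Fin I.n)) : ℕ :=
  if h : I.Jr.Nonempty then
    I.Jr.sup' h (I.completionTime σ) - I.Jr.inf' h (fun j => I.completionTime σ j - I.p j)
  else 0

/-- `σ` minimizes the renting period among all sequences that respect the budget. -/
def IsOptimal (I : RentInstance) (σ : Equiv.Perm (Fin I.n)) : Prop :=
  I.twc σ ≤ I.K ∧ ∀ τ : Equiv.Perm (Fin I.n), I.twc τ ≤ I.K → I.er σ ≤ I.er τ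

/-- The input as a word sequence: `n`, `K`, and then for each job `j` the three words `p j`, `w j`
and the indicator of `j ∈ Jr`. -/
def input (I : RentInstance) : List ℕ :=
  I.n :: I.K ::
    (List.finRange I.n).flatMap fun j => [I.p j, I.w j, if j ∈ I.Jr then 1 else 0]

/-- The initial state: the input stands in the memory from address `0` on, and all other memory
cells and all registers are `0`. -/
def initialState (I : RentInstance) : WordRAM.State where
  reg := fun _ => 0
  mem := fun a => I.input.getD a 0

/-- The final state `s` holds a solution: either register `0` is `1` and the memory cells
`0, …, n - 1` list the jobs in the order of an optimal sequence, or register `0` is `0` and no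
sequence respects the budget. -/
def IsSolvedBy (I : RentInstance) (s : WordRAM.State) : Prop :=
  (s.reg 0 = 1 ∧ ∃ σ : Equiv.Perm (Fin I.n), I.IsOptimal σ ∧ ∀ i : Fin I.n, s.mem i = (σ i : ℕ)) ∨
  (s.reg 0 = 0 ∧ ∀ σ : Equiv.Perm (Fin I.n), I.K < I.twc σ)

end RentInstance

/-! Index the jobs by nonincreasing ratio `w / p` (Smith's order). Any sequence costs as much as the
sorted one plus, for each inverted pair `u < v`, the nonnegative amount `p v * w u - p u * w v`
(`seqCost_eq`). The jobs processed during the renting period form a block `S` that contains `Jr`,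
and the period lasts `p(S)`; conversely, a sequence in which the jobs of `S ⊇ Jr` are consecutive
has a renting period of at most `p(S)` (`exists_block`, `er_le_of_blockClass`). It remains to choose
`S` and to place each other job before or behind the block.

For fixed `S`, a job `v` outside pays for the selected jobs with smaller index if it goes to the
front, and for those with larger index if it goes to the back. The difference is `p v * w(S) - w v *
p(S)`, so the better side depends on how the ratio of `v` compares with that of `S`. Hence there is
a cut `k`: unselected jobs before `k` go to the front, the others to the back
(`exists_blockCost_le`), and all other inversions are avoided (`inversionCost_of_blockClass`). The
cut decouples the problem: the front cost involves only the jobs in `[0, k)`, the back cost only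
those from `k` on. Two independent dynamic programs suffice, one over prefixes and one over
suffixes; the second is the first for the reversed order with the sign of the costs changed.

A state consists of a number `j` of jobs, the selected processing time and a second variable `x`. If
`W < P`, then `x` is the selected weight, and the cost of leaving a job out is known at once.
Otherwise `x` guesses the unselected processing time of the whole part; the term `p v * w u` is then
charged to the selected job `u`, since the unselected time behind `u` is `x` minus what has been
seen, and final states with a wrong guess are discarded. Either way `x ≤ min W P`, which gives `O(nP
min{W,P})` states with constant time each. `value_le_shifted` and `trace_spec` are the two halves of
correctness. A shift by `w j * P` per job keeps all values natural; the shifts add up to `P * W`, so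
the budget test compares with `K + P * W + 1`, where values are truncated.

For each `j` and `b` the least value with selected time at most `b` is stored. For each cut a
monotone walk then looks for a smaller sum `b₁ + b₂` of affordable bounds in `O(P)` steps, because
the best sum never grows. The decisions are traced back, and the jobs are arranged by block class
and index. As `n ≤ P`, quadratic sorting by ranks is affordable.

The program is written in a layer with arrays and compiled. If all stored numbers are at most `V`,
then all intermediate words are at most a fixed power of `V`, so that only stored values have to be
bounded. -/

/-! A structured layer over word RAM programs: besides the registers and a low memory segment there
are multi-dimensional arrays, which are laid out in the memory by an injective address map. -/

namespace WordRAM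

/-- An injective pairing that can be evaluated without branching. -/
def quadPair (a b : ℕ) : ℕ := (a + b) * (a + b) + a

/-- Since `(a + b)² + a < (a + b + 1)²`, different sums `a + b` yield values in disjoint intervals;
the value determines the sum and then `a`. -/
theorem quadPair_inj {a b c d : ℕ} (h : quadPair a b = quadPair c d) : a = c ∧ b = d := by
  unfold quadPair at h
  have h1 : a + b = c + d := by
    rcases lt_trichotomy (a + b) (c + d) with h1 | h1 | h1
    · nlinarith
    · exact h1
    · nlinarith
  rw [h1] at h
  omega

/-- The offset of the entry `(a, b, c)` of the array number `t`. -/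
def arrayOffset (t a b c : ℕ) : ℕ := quadPair (quadPair (quadPair t a) b) c

theorem arrayOffset_inj {t a b c t' a' b' c' : ℕ}
    (h : arrayOffset t a b c = arrayOffset t' a' b' c') :
    t = t' ∧ a = a' ∧ b = b' ∧ c = c' := by
  obtain ⟨h, hc⟩ := quadPair_inj h
  obtain ⟨h, hb⟩ := quadPair_inj h
  obtain ⟨ht, ha⟩ := quadPair_inj h
  exact ⟨ht, ha, hb, hc⟩

/-- A state of the structured layer: registers, low memory and arrays. -/
@[ext] structure HState where
  reg : ℕ → ℕ
  low : ℕ → ℕ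
  arr : ℕ → ℕ → ℕ → ℕ → ℕ

namespace HState

def setReg (h : HState) (x v : ℕ) : HState :=
  { h with reg := fun y => if y = x then v else h.reg y }

def setLow (h : HState) (x v : ℕ) : HState :=
  { h with low := fun y => if y = x then v else h.low y }

def setArr (h : HState) (t a b c v : ℕ) : HState :=
  { h with arr := fun t' a' b' c' =>
      if t' = t ∧ a' = a ∧ b' = b ∧ c' = c then v else h.arr t' a' b' c' }

variable (h : HState) (x y t a b c v t' a' b' c' : ℕ)

@[simp] theorem reg_setReg : (h.setReg x v).reg y = if y = x then v else h.reg y := rfl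
@[simp] theorem low_setReg : (h.setReg x v).low = h.low := rfl
@[simp] theorem arr_setReg : (h.setReg x v).arr = h.arr := rfl
@[simp] theorem reg_setLow : (h.setLow x v).reg = h.reg := rfl
@[simp] theorem low_setLow : (h.setLow x v).low y = if y = x then v else h.low y := rfl
@[simp] theorem arr_setLow : (h.setLow x v).arr = h.arr := rfl
@[simp] theorem reg_setArr : (h.setArr t a b c v).reg = h.reg := rfl
@[simp] theorem low_setArr : (h.setArr t a b c v).low = h.low := rfl
@[simp] theorem arr_setArr : (h.setArr t a b c v).arr t' a' b' c' =
    if t' = t ∧ a' = a ∧ b' = b ∧ c' = c then v else h.arr t' a' b' c' := rfl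

end HState

/-- Expressions of the structured layer. -/
inductive HExp where
  | const (k : ℕ)
  | var (x : ℕ)
  | low (e : HExp)
  | cell (t : ℕ) (a b c : HExp)
  | add (e f : HExp)
  | sub (e f : HExp)
  | mul (e f : HExp)
  | lt (e f : HExp)

namespace HExp

@[simp] def eval (h : HState) : HExp → ℕ
  | const k => k
  | var x => h.reg x
  | low e => h.low (e.eval h)
  | cell t a b c => h.arr t (a.eval h) (b.eval h) (c.eval h)
  | add e f => e.eval h + f.eval h
  | sub e f => e.eval h - f.eval h
  | mul e f => e.eval h * f.eval h
  | lt e f => if e.eval h < f.eval h then 1 else 0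

/-- Low memory is only read below the address where the arrays start, which register `1` holds. -/
@[simp] def Safe (h : HState) : HExp → Prop
  | const _ => True
  | var _ => True
  | low e => e.Safe h ∧ e.eval h < h.reg 1
  | cell _ a b c => a.Safe h ∧ b.Safe h ∧ c.Safe h
  | add e f => e.Safe h ∧ f.Safe h
  | sub e f => e.Safe h ∧ f.Safe h
  | mul e f => e.Safe h ∧ f.Safe h
  | lt e f => e.Safe h ∧ f.Safe h

end HExp

def quadPairExp (a b : Exp) : Exp := .add (.mul (.add a b) (.add a b)) a

@[simp] theorem quadPairExp_eval (s : State) (a b : Exp) :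
    (quadPairExp a b).eval s = quadPair (a.eval s) (b.eval s) := rfl

def arrayExp (t : ℕ) (a b c : Exp) : Exp :=
  .add (.var 1) (quadPairExp (quadPairExp (quadPairExp (.const t) a) b) c)

@[simp] theorem arrayExp_eval (s : State) (t : ℕ) (a b c : Exp) :
    (arrayExp t a b c).eval s = s.reg 1 + arrayOffset t (a.eval s) (b.eval s) (c.eval s) := rfl

def HExp.compile : HExp → Exp
  | const k => .const k
  | var x => .var x
  | low e => .read e.compile
  | cell t a b c => .read (arrayExp t a.compile b.compile c.compile)
  | add e f => .add e.compile f.compile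
  | sub e f => .sub e.compile f.compile
  | mul e f => .mul e.compile f.compile
  | lt e f => .lt e.compile f.compile

/-! ### Word lengths of intermediate results -/

/-- An exponent that bounds all values occurring in the evaluation of an expression, in terms of a
bound on the registers and memory cells. -/
def Exp.deg : Exp → ℕ
  | const k => k + 1
  | var _ => 1
  | read a => a.deg
  | add e f => e.deg + f.deg
  | sub e f => e.deg + f.deg
  | mul e f => e.deg + f.deg
  | lt e f => e.deg + f.deg

def Program.deg : Program → ℕ
  | skip => 0
  | assign _ e => e.deg
  | store a e => a.deg + e.deg
  | seq c d => c.deg + d.deg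
  | ite e c d => e.deg + c.deg + d.deg
  | .while e c => e.deg + c.deg

/-- All registers and memory cells are at most `V`. -/
def State.Bdd (V : ℕ) (s : State) : Prop := (∀ r, s.reg r ≤ V) ∧ ∀ a, s.mem a ≤ V

theorem Exp.deg_pos (e : Exp) : 0 < e.deg := by
  induction e <;> simp_all [Exp.deg]

/-- A sum of two numbers that are at least `2` is at most their product. Thus exponents add up for
additions as they do for multiplications. -/
theorem pow_add_pow_le {V m k : ℕ} (hV : 2 ≤ V) (hm : 0 < m) (hk : 0 < k) :
    V ^ m + V ^ k ≤ V ^ (m + k) := by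
  rw [pow_add]
  have h1 : 2 ≤ V ^ m := hV.trans (Nat.le_self_pow hm.ne' V)
  have h2 : 2 ≤ V ^ k := hV.trans (Nat.le_self_pow hk.ne' V)
  nlinarith

theorem Exp.eval_le {V : ℕ} (hV : 2 ≤ V) {s : State} (hs : s.Bdd V) (e : Exp) :
    e.eval s ≤ V ^ e.deg := by
  induction e with
  | const k =>
    simp only [eval, deg]
    exact ((Nat.lt_two_pow_self).le.trans (Nat.pow_le_pow_left hV k)).trans
      (Nat.pow_le_pow_right (by omega) (by omega))
  | var x => simpa [eval, deg] using hs.1 x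
  | read a ih => exact (hs.2 _).trans (Nat.le_self_pow a.deg_pos.ne' V)
  | add e f he hf =>
    exact (Nat.add_le_add he hf).trans (pow_add_pow_le hV e.deg_pos f.deg_pos)
  | sub e f he hf =>
    exact (Nat.sub_le _ _).trans (he.trans (Nat.pow_le_pow_right (by omega) (by simp [deg])))
  | mul e f he hf =>
    simp only [eval, deg, pow_add]
    exact Nat.mul_le_mul he hf
  | lt e f he hf =>
    simp only [eval]
    have := Nat.one_le_pow (lt e f).deg V (by omega)
    split <;> omega

/-- Degrees bound those of all subexpressions, so one exponent, in the end the degree of the whole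
program, serves every expression in it. -/
theorem Exp.fits_of_deg_le {V D : ℕ} (hV : 2 ≤ V) {s : State} (hs : s.Bdd V) (e : Exp)
    (hD : e.deg ≤ D) : e.Fits (V ^ D) s := by
  have key : ∀ f : Exp, f.deg ≤ D → f.eval s ≤ V ^ D := fun f hf =>
    (f.eval_le hV hs).trans (Nat.pow_le_pow_right (by omega) hf)
  induction e with
  | const k => exact key (const k) hD
  | var x => exact key (var x) hD
  | read a ih => exact ⟨ih hD, key (read a) hD⟩
  | add e f he hf =>
    have := hD; simp only [deg] at this
    exact ⟨he (by omega), hf (by omega), key (add e f) hD⟩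
  | sub e f he hf =>
    have := hD; simp only [deg] at this
    exact ⟨he (by omega), hf (by omega)⟩
  | mul e f he hf =>
    have := hD; simp only [deg] at this
    exact ⟨he (by omega), hf (by omega), key (mul e f) hD⟩
  | lt e f he hf =>
    have := hD; simp only [deg] at this
    exact ⟨he (by omega), hf (by omega), Nat.one_le_pow _ _ (by omega)⟩

/-! ### Commands, their compilation and rules for their runs -/

/-- Commands of the structured layer: assignments, stores into an array and into low memory. -/
inductive Cmd where
  | skip
  | assign (x : ℕ) (e : HExp)
  | put (t : ℕ) (a b c e : HExp)
  | out (a e : HExp)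
  | seq (c d : Cmd)
  | ite (e : HExp) (c d : Cmd)
  | while (e : HExp) (c : Cmd)

namespace Cmd

def compile : Cmd → Program
  | skip => .skip
  | assign x e => .assign x e.compile
  | put t a b c e => .store (arrayExp t a.compile b.compile c.compile) e.compile
  | out a e => .store a.compile e.compile
  | seq c d => .seq c.compile d.compile
  | ite e c d => .ite e.compile c.compile d.compile
  | .while e c => .while e.compile c.compile

/-- The command may write register `r`. -/
def writes (r : ℕ) : Cmd → Bool
  | skip => false
  | assign x _ => x == r
  | put .. => false
  | out .. => false
  | seq c d => c.writes r || d.writes r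
  | ite _ c d => c.writes r || d.writes r
  | .while _ c => c.writes r

/-- The command may write the array number `t`. -/
def puts (t : ℕ) : Cmd → Bool
  | skip => false
  | assign .. => false
  | put t' .. => t' == t
  | out .. => false
  | seq c d => c.puts t || d.puts t
  | ite _ c d => c.puts t || d.puts t
  | .while _ c => c.puts t

/-- The command may write the low memory. -/
def outs : Cmd → Bool
  | skip => false
  | assign .. => false
  | put .. => false
  | out .. => true
  | seq c d => c.outs || d.outs
  | ite _ c d => c.outs || d.outs
  | .while _ c => c.outs

/-- The states agree on all that the command does not write. -/
structure Frame (c : Cmd) (h h' : HState) : Prop where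
  reg : ∀ r, c.writes r = false → h'.reg r = h.reg r
  arr : ∀ t, c.puts t = false → h'.arr t = h.arr t
  low : c.outs = false → h'.low = h.low

theorem Frame.refl (c : Cmd) (h : HState) : c.Frame h h :=
  ⟨fun _ _ => rfl, fun _ _ => rfl, fun _ => rfl⟩

theorem Frame.trans {c : Cmd} {h₁ h₂ h₃ : HState} (h12 : c.Frame h₁ h₂) (h23 : c.Frame h₂ h₃) :
    c.Frame h₁ h₃ :=
  ⟨fun r hr => (h23.reg r hr).trans (h12.reg r hr),
    fun t ht => (h23.arr t ht).trans (h12.arr t ht), fun hl => (h23.low hl).trans (h12.low hl)⟩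

theorem Frame.mono {c d : Cmd} {h h' : HState} (hc : c.Frame h h')
    (h1 : ∀ r, d.writes r = false → c.writes r = false)
    (h2 : ∀ t, d.puts t = false → c.puts t = false) (h3 : d.outs = false → c.outs = false) :
    d.Frame h h' :=
  ⟨fun r hr => hc.reg r (h1 r hr), fun t ht => hc.arr t (h2 t ht), fun hl => hc.low (h3 hl)⟩

end Cmd

/-- The machine state `s` represents the state `h` of the structured layer. -/
structure Rep (h : HState) (s : State) : Prop where
  reg : s.reg = h.reg
  low : ∀ a < h.reg 1, s.mem a = h.low a
  arr : ∀ t a b c, s.mem (h.reg 1 + arrayOffset t a b c) = h.arr t a b c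

theorem HExp.compile_eval {h : HState} {s : State} (hr : Rep h s) (e : HExp) (he : e.Safe h) :
    e.compile.eval s = e.eval h := by
  induction e with
  | const k => rfl
  | var x => exact congrFun hr.reg x
  | low e ih =>
    simp only [compile, Exp.eval, eval]
    rw [ih he.1, hr.low _ he.2]
  | cell t a b c iha ihb ihc =>
    simp only [compile, Exp.eval, eval, arrayExp_eval]
    rw [iha he.1, ihb he.2.1, ihc he.2.2, hr.reg, hr.arr]
  | add e f ihe ihf => simp only [compile, Exp.eval, eval]; rw [ihe he.1, ihf he.2]
  | sub e f ihe ihf => simp only [compile, Exp.eval, eval]; rw [ihe he.1, ihf he.2]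
  | mul e f ihe ihf => simp only [compile, Exp.eval, eval]; rw [ihe he.1, ihf he.2]
  | lt e f ihe ihf => simp only [compile, Exp.eval, eval]; rw [ihe he.1, ihf he.2]

/-- Started in `h`, the command `c` halts after at most `T` steps in a state that satisfies `Q`,
writing only numbers up to `V`. -/
def HRuns (V : ℕ) (c : Cmd) (h : HState) (T : ℕ) (Q : HState → Prop) : Prop :=
  -- The final state and the time are fixed before `D` and the machine state. The exponent stays
  -- free above the degree, so that parts of a program can be run with the exponent of the whole.
  ∃ h' t, t ≤ T ∧ Q h' ∧ c.Frame h h' ∧ ∀ D, c.compile.deg ≤ D → ∀ s, Rep h s → s.Bdd V →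
    ∃ s', Exec (V ^ D) c.compile s t s' ∧ Rep h' s' ∧ s'.Bdd V

namespace HRuns

variable {V : ℕ} {c d : Cmd} {h : HState} {T T' : ℕ} {Q Q' : HState → Prop}

theorem mono (H : HRuns V c h T Q) (hT : T ≤ T') (hQ : ∀ h', c.Frame h h' → Q h' → Q' h') :
    HRuns V c h T' Q' := by
  obtain ⟨h', t, h1, h2, h3, h4⟩ := H
  exact ⟨h', t, h1.trans hT, hQ h' h3 h2, h3, h4⟩

theorem skip (hQ : Q h) : HRuns V .skip h 1 Q :=
  ⟨h, 1, le_rfl, hQ, .refl _ _, fun _ _ s hs hb => ⟨s, .skip s, hs, hb⟩⟩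

/-- Register `1` is excluded because it holds the base address of the arrays; a new value would move
all of them. -/
theorem assign {x : ℕ} {e : HExp} (hV : 2 ≤ V) (hx : x ≠ 1) (he : e.Safe h) (hv : e.eval h ≤ V)
    (hQ : Q (h.setReg x (e.eval h))) : HRuns V (.assign x e) h (e.compile.cost + 1) Q := by
  refine ⟨_, _, le_rfl, hQ, ⟨fun r hr => ?_, fun _ _ => rfl, fun _ => rfl⟩, fun D hD s hs hb =>
    ⟨_, .assign s x e.compile (Exp.fits_of_deg_le hV hb _ hD), ?_, ?_⟩⟩
  · have : r ≠ x := by rintro rfl; simp [Cmd.writes] at hr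
    simp [this]
  · rw [e.compile_eval hs he]
    refine ⟨?_, fun a ha => hs.low a (by simpa [hx.symm] using ha), fun t a b c => ?_⟩
    · ext y
      simp [State.setReg, hs.reg, Function.update_apply]
    · simpa [hx.symm, State.setReg] using hs.arr t a b c
  · rw [e.compile_eval hs he]
    refine ⟨fun r => ?_, hb.2⟩
    simp only [State.setReg, Function.update_apply]
    split
    · exact hv
    · exact hb.1 r

theorem put {t : ℕ} {a b c e : HExp} (hV : 2 ≤ V) (ha : a.Safe h) (hb : b.Safe h) (hc : c.Safe h)
    (he : e.Safe h) (hv : e.eval h ≤ V)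
    (hQ : Q (h.setArr t (a.eval h) (b.eval h) (c.eval h) (e.eval h))) :
    HRuns V (.put t a b c e) h
      ((arrayExp t a.compile b.compile c.compile).cost + e.compile.cost + 1) Q := by
  refine ⟨_, _, le_rfl, hQ, ⟨fun _ _ => rfl, fun r hr => ?_, fun _ => rfl⟩, fun D hD s hs hbd =>
    ⟨_, .store s _ e.compile (Exp.fits_of_deg_le hV hbd _ ?_)
      (Exp.fits_of_deg_le hV hbd _ ?_), ?_, ?_⟩⟩
  · have : r ≠ t := by rintro rfl; simp [Cmd.puts] at hr
    ext a b c
    simp [this]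
  · simp only [Cmd.compile, Program.deg] at hD; omega
  · simp only [Cmd.compile, Program.deg] at hD; omega
  · rw [arrayExp_eval, e.compile_eval hs he, a.compile_eval hs ha, b.compile_eval hs hb,
      c.compile_eval hs hc, hs.reg]
    refine ⟨hs.reg, fun i hi => ?_, fun t' a' b' c' => ?_⟩
    · have hi' : i < h.reg 1 := hi
      simp only [State.setMem, Function.update_apply, HState.low_setArr]
      rw [if_neg (by omega)]
      exact hs.low i hi
    · simp only [State.setMem, Function.update_apply, HState.arr_setArr, HState.reg_setArr]
      split_ifs with h1 h2 h2
      · rfl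
      · exact absurd (arrayOffset_inj (Nat.add_left_cancel h1)) h2
      · obtain ⟨rfl, rfl, rfl, rfl⟩ := h2; exact absurd rfl h1
      · exact hs.arr _ _ _ _
  · rw [e.compile_eval hs he]
    refine ⟨hbd.1, fun i => ?_⟩
    simp only [State.setMem, Function.update_apply]
    split
    · exact hv
    · exact hbd.2 i

theorem out {a e : HExp} (hV : 2 ≤ V) (ha : a.Safe h) (he : e.Safe h) (hav : a.eval h < h.reg 1)
    (hv : e.eval h ≤ V) (hQ : Q (h.setLow (a.eval h) (e.eval h))) :
    HRuns V (.out a e) h (a.compile.cost + e.compile.cost + 1) Q := by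
  refine ⟨_, _, le_rfl, hQ, ⟨fun _ _ => rfl, fun _ _ => rfl, fun hl => by simp [Cmd.outs] at hl⟩,
    fun D hD s hs hbd => ⟨_, .store s _ e.compile (Exp.fits_of_deg_le hV hbd _ ?_)
      (Exp.fits_of_deg_le hV hbd _ ?_), ?_, ?_⟩⟩
  · simp only [Cmd.compile, Program.deg] at hD; omega
  · simp only [Cmd.compile, Program.deg] at hD; omega
  · rw [e.compile_eval hs he, a.compile_eval hs ha]
    refine ⟨hs.reg, fun i hi => ?_, fun t' a' b' c' => ?_⟩
    · simp only [State.setMem, Function.update_apply, HState.low_setLow]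
      split
      · rfl
      · exact hs.low i hi
    · simp only [State.setMem, Function.update_apply, HState.arr_setLow, HState.reg_setLow]
      rw [if_neg (by omega)]
      exact hs.arr _ _ _ _
  · rw [e.compile_eval hs he]
    refine ⟨hbd.1, fun i => ?_⟩
    simp only [State.setMem, Function.update_apply]
    split
    · exact hv
    · exact hbd.2 i

theorem seq (H : HRuns V c h T (fun h' => HRuns V d h' T' Q)) :
    HRuns V (.seq c d) h (T + T') Q := by
  obtain ⟨h1, t1, ht1, ⟨h2, t2, ht2, hQ, f2, e2⟩, f1, e1⟩ := H
  refine ⟨h2, t1 + t2, by omega, hQ, (f1.mono ?_ ?_ ?_).trans (f2.mono ?_ ?_ ?_),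
    fun D hD s hs hb => ?_⟩
  iterate 6 (simp +contextual [Cmd.writes, Cmd.puts, Cmd.outs])
  simp only [Cmd.compile, Program.deg] at hD
  obtain ⟨s1, x1, r1, b1⟩ := e1 D (by omega) s hs hb
  obtain ⟨s2, x2, r2, b2⟩ := e2 D (by omega) s1 r1 b1
  exact ⟨s2, .seq x1 x2, r2, b2⟩

theorem ite {e : HExp} (hV : 2 ≤ V) (he : e.Safe h) (H1 : e.eval h ≠ 0 → HRuns V c h T Q)
    (H2 : e.eval h = 0 → HRuns V d h T Q) :
    HRuns V (.ite e c d) h (e.compile.cost + 1 + T) Q := by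
  by_cases hv : e.eval h = 0
  · obtain ⟨h1, t1, ht1, hQ, f1, e1⟩ := H2 hv
    refine ⟨h1, e.compile.cost + 1 + t1, by omega, hQ, f1.mono ?_ ?_ ?_, fun D hD s hs hb => ?_⟩
    iterate 3 (simp +contextual [Cmd.writes, Cmd.puts, Cmd.outs])
    simp only [Cmd.compile, Program.deg] at hD
    obtain ⟨s1, x1, r1, b1⟩ := e1 D (by omega) s hs hb
    exact ⟨s1, .ite_false (Exp.fits_of_deg_le hV hb _ (by omega))
      (by rw [e.compile_eval hs he, hv]) x1, r1, b1⟩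
  · obtain ⟨h1, t1, ht1, hQ, f1, e1⟩ := H1 hv
    refine ⟨h1, e.compile.cost + 1 + t1, by omega, hQ, f1.mono ?_ ?_ ?_, fun D hD s hs hb => ?_⟩
    iterate 3 (simp +contextual [Cmd.writes, Cmd.puts, Cmd.outs])
    simp only [Cmd.compile, Program.deg] at hD
    obtain ⟨s1, x1, r1, b1⟩ := e1 D (by omega) s hs hb
    exact ⟨s1, .ite_true (Exp.fits_of_deg_le hV hb _ (by omega))
      (by rwa [e.compile_eval hs he]) x1, r1, b1⟩

/-- A loop with an invariant `I` that carries a strictly decreasing measure. -/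
theorem whileLoop {e : HExp} (hV : 2 ≤ V) (I : ℕ → HState → Prop) (m : ℕ) (h0 : I m h)
    (hsafe : ∀ m h', c.Frame h h' → I m h' → e.Safe h')
    (hstep : ∀ m h', c.Frame h h' → I m h' → e.eval h' ≠ 0 →
      HRuns V c h' T (fun h'' => ∃ m' < m, I m' h''))
    (hend : ∀ m h', c.Frame h h' → I m h' → e.eval h' = 0 → Q h') :
    HRuns V (.while e c) h (m * (e.compile.cost + 1 + T) + (e.compile.cost + 1)) Q := by
  suffices H : ∀ m h', c.Frame h h' → I m h' →
      HRuns V (.while e c) h' (m * (e.compile.cost + 1 + T) + (e.compile.cost + 1)) Q from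
    H m h (.refl _ _) h0
  intro m
  induction m using Nat.strong_induction_on with
  | _ m ih =>
    intro h1 f1 i1
    by_cases hv : e.eval h1 = 0
    · refine ⟨h1, e.compile.cost + 1, by omega, hend m h1 f1 i1 hv, .refl _ _,
        fun D hD s hs hb => ⟨s, .while_false (Exp.fits_of_deg_le hV hb _ ?_) ?_, hs, hb⟩⟩
      · simp only [Cmd.compile, Program.deg] at hD; omega
      · rw [e.compile_eval hs (hsafe m h1 f1 i1), hv]
    · obtain ⟨h2, t2, ht2, ⟨m', hm', i2⟩, f2, e2⟩ := hstep m h1 f1 i1 hv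
      obtain ⟨h3, t3, ht3, hQ, f3, e3⟩ := ih m' hm' h2 (f1.trans f2) i2
      have f2' : (Cmd.while e c).Frame h1 h2 := f2.mono (fun _ h => h) (fun _ h => h) (fun h => h)
      refine ⟨h3, e.compile.cost + 1 + t2 + t3, ?_, hQ, f2'.trans f3, fun D hD s hs hb => ?_⟩
      · obtain ⟨k, rfl⟩ := Nat.exists_eq_add_of_lt hm'
        have : (m' + 1) * (e.compile.cost + 1 + T) ≤ (m' + k + 1) * (e.compile.cost + 1 + T) :=
          Nat.mul_le_mul_right _ (by omega)
        rw [Nat.add_mul, Nat.one_mul] at this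
        omega
      · have hD' := hD
        simp only [Cmd.compile, Program.deg] at hD'
        obtain ⟨s2, x2, r2, b2⟩ := e2 D (by omega) s hs hb
        obtain ⟨s3, x3, r3, b3⟩ := e3 D hD s2 r2 b2
        exact ⟨s3, .while_true (Exp.fits_of_deg_le hV hb _ (by omega))
          (by rwa [e.compile_eval hs (hsafe m h1 f1 i1)]) x2 x3, r3, b3⟩

end HRuns

namespace Cmd

/-- The number of steps of a loop-free command. -/
def time : Cmd → ℕ
  | skip => 1
  | assign _ e => e.compile.cost + 1
  | put t a b c e => (arrayExp t a.compile b.compile c.compile).cost + e.compile.cost + 1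
  | out a e => a.compile.cost + e.compile.cost + 1
  | seq c d => c.time + d.time
  -- The sum is an upper bound for whichever branch is taken.
  | ite e c d => e.compile.cost + 1 + (c.time + d.time)
  | .while _ _ => 0

/-- The weakest precondition of a loop-free command. -/
@[simp] def wp (V : ℕ) : Cmd → (HState → Prop) → HState → Prop
  | skip, Q, h => Q h
  | assign x e, Q, h => x ≠ 1 ∧ e.Safe h ∧ e.eval h ≤ V ∧ Q (h.setReg x (e.eval h))
  | put t a b c e, Q, h => a.Safe h ∧ b.Safe h ∧ c.Safe h ∧ e.Safe h ∧ e.eval h ≤ V ∧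
      Q (h.setArr t (a.eval h) (b.eval h) (c.eval h) (e.eval h))
  | out a e, Q, h => a.Safe h ∧ e.Safe h ∧ a.eval h < h.reg 1 ∧ e.eval h ≤ V ∧
      Q (h.setLow (a.eval h) (e.eval h))
  | seq c d, Q, h => c.wp V (d.wp V Q) h
  | ite e c d, Q, h => e.Safe h ∧ (e.eval h ≠ 0 → c.wp V Q h) ∧ (e.eval h = 0 → d.wp V Q h)
  -- Loops have no precondition here, so the dummy value `0` of `time` for them does no harm.
  | .while _ _, _, _ => False

end Cmd

theorem HRuns.of_wp {V : ℕ} (hV : 2 ≤ V) {c : Cmd} {h : HState} {Q : HState → Prop}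
    (H : c.wp V Q h) : HRuns V c h c.time Q := by
  induction c generalizing h Q with
  | skip => exact .skip H
  | assign x e => exact .assign hV H.1 H.2.1 H.2.2.1 H.2.2.2
  | put t a b c e => exact .put hV H.1 H.2.1 H.2.2.1 H.2.2.2.1 H.2.2.2.2.1 H.2.2.2.2.2
  | out a e => exact .out hV H.1 H.2.1 H.2.2.1 H.2.2.2.1 H.2.2.2.2
  | seq c d ihc ihd =>
    exact .seq ((ihc H).mono le_rfl fun h' _ hq => ihd hq)
  | ite e c d ihc ihd =>
    exact .ite hV H.1 (fun hv => (ihc (H.2.1 hv)).mono (by omega) fun _ _ h => h)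
      (fun hv => (ihd (H.2.2 hv)).mono (by omega) fun _ _ h => h)
  | _ => exact H.elim

/-- `for i in [0, N)` where the bound `N` is given by an expression. -/
def Cmd.forLoop (i : ℕ) (N : HExp) (c : Cmd) : Cmd :=
  .seq (.assign i (.const 0))
    (.while (.lt (.var i) N) (.seq c (.assign i (.add (.var i) (.const 1)))))

/-- A number of steps for a `for` loop with `N` iterations of at most `T` steps each. -/
def forTime (e : HExp) (N T : ℕ) : ℕ :=
  2 + (N * (e.compile.cost + T + 8) + (e.compile.cost + 3))

/-- The bound is evaluated anew before each iteration, so its value must be `N` in every state that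
agrees on the registers outside the loop. The invariant refers to the state after the counter has
been increased. -/
theorem HRuns.forLoop {V : ℕ} (hV : 2 ≤ V) {c : Cmd} {h : HState} {i : ℕ} {e : HExp} {T : ℕ}
    {Q : HState → Prop} (N : ℕ) (I : ℕ → HState → Prop) (hi : i ≠ 1) (hci : c.writes i = false)
    (hNV : N ≤ V)
    (hN : ∀ h', (∀ r, r ≠ i → c.writes r = false → h'.reg r = h.reg r) →
      e.Safe h' ∧ e.eval h' = N)
    (h0 : I 0 (h.setReg i 0))
    (hstep : ∀ k < N, ∀ h', (Cmd.forLoop i e c).Frame h h' → h'.reg i = k → I k h' →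
      HRuns V c h' T (fun h'' => I (k + 1) (h''.setReg i (k + 1))))
    (hend : ∀ h', (Cmd.forLoop i e c).Frame h h' → I N h' → Q h') :
    HRuns V (.forLoop i e c) h (forTime e N T) Q := by
  have fr0 : (Cmd.forLoop i e c).Frame h (h.setReg i 0) :=
    ⟨fun r hr => by
      have : r ≠ i := by rintro rfl; simp [Cmd.forLoop, Cmd.writes] at hr
      simp [this], fun _ _ => rfl, fun _ => rfl⟩
  have fr : ∀ h', (Cmd.seq c (.assign i (.add (.var i) (.const 1)))).Frame (h.setReg i 0) h' →
      (Cmd.forLoop i e c).Frame h h' := fun h' f =>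
    fr0.trans (f.mono (by simp +contextual [Cmd.forLoop, Cmd.writes])
      (by simp +contextual [Cmd.forLoop, Cmd.puts]) (by simp +contextual [Cmd.forLoop, Cmd.outs]))
  have frN : ∀ h', (Cmd.forLoop i e c).Frame h h' → e.Safe h' ∧ e.eval h' = N := fun h' f =>
    hN h' fun r h1 h2 => f.reg r (by simp [Cmd.forLoop, Cmd.writes, h1.symm, h2])
  refine (HRuns.seq (T := 2) (T' := N * ((e.compile.cost + 2) + 1 + (T + 4)) +
    ((e.compile.cost + 2) + 1)) ?_).mono ?_ fun _ _ h => h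
  · refine HRuns.mono (HRuns.assign hV hi trivial (by simp) ?_) le_rfl fun _ _ h => h
    have hcost : (HExp.lt (.var i) e).compile.cost = e.compile.cost + 2 := by
      simp only [HExp.compile, Exp.cost]; omega
    have := HRuns.whileLoop (V := V) (c := .seq c (.assign i (.add (.var i) (.const 1))))
      (h := h.setReg i 0) (T := T + 4) (Q := Q) (e := .lt (.var i) e) hV
      -- The measure is the number of remaining iterations.
      (fun m h' => m + h'.reg i = N ∧ I (h'.reg i) h') N (by simpa using h0) ?_ ?_ ?_
    · rw [hcost] at this; exact this
    · intro m h' f _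
      exact ⟨trivial, (frN h' (fr h' f)).1⟩
    · rintro m h' f ⟨hm, hI⟩ hv
      have hlt : h'.reg i < N := by
        by_contra hcon
        simp [(frN h' (fr h' f)).2, hcon] at hv
      refine HRuns.seq ((hstep _ hlt h' (fr h' f) rfl hI).mono le_rfl fun h'' f'' hI'' => ?_)
      have hreg := f''.reg i hci
      refine (HRuns.assign (e := .add (.var i) (.const 1)) hV hi ⟨trivial, trivial⟩ ?_ ?_).mono ?_ fun _ _ h => h
      · simp only [HExp.eval]; omega
      · refine ⟨m - 1, by omega, ?_, ?_⟩
        · simp; omega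
        · simpa [hreg] using hI''
      · exact le_rfl
    · rintro m h' f ⟨hm, hI⟩ hv
      have : h'.reg i = N := by
        by_contra hcon
        have : h'.reg i < N := by omega
        simp [(frN h' (fr h' f)).2, this] at hv
      exact hend h' (fr h' f) (this ▸ hI)
  · unfold forTime
    have : e.compile.cost + 2 + 1 + (T + 4) ≤ e.compile.cost + T + 8 := by omega
    have := Nat.mul_le_mul_left N this
    omega

end WordRAM

/-! ### The dynamic program for selections -/

namespace RentSchedule

open Finset

/-- The sum of `f` over the elements of `[0, j)` that `S` selects. -/
def selSum (S f : ℕ → ℕ) (j : ℕ) : ℕ := ∑ i ∈ range j, S i * f i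

theorem selSum_succ (S f : ℕ → ℕ) (j : ℕ) : selSum S f (j + 1) = selSum S f j + S j * f j :=
  sum_range_succ _ _

theorem selSum_congr {S S' : ℕ → ℕ} {f : ℕ → ℕ} {j : ℕ} (h : ∀ i < j, S i = S' i) :
    selSum S f j = selSum S' f j :=
  sum_congr rfl fun i hi => by rw [h i (mem_range.1 hi)]

theorem selSum_le {S f : ℕ → ℕ} {j : ℕ} (h : ∀ i < j, S i ≤ 1) :
    selSum S f j ≤ ∑ i ∈ range j, f i :=
  sum_le_sum fun i hi => by
    have := h i (mem_range.1 hi)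
    nlinarith [Nat.zero_le (f i)]

/-- The cost of delaying the selected jobs behind all later jobs that are not selected, where the
cost of interchanging `u` and `v` is `p v * w u - p u * w v`. -/
def crossCost (p w S : ℕ → ℕ) (m : ℕ) : ℤ :=
  ∑ v ∈ range m, (1 - (S v : ℤ)) * ((p v : ℤ) * selSum S w v - selSum S p v * w v)

theorem crossCost_congr {p w S S' : ℕ → ℕ} {j : ℕ} (h : ∀ i < j, S i = S' i) :
    crossCost p w S j = crossCost p w S' j :=
  sum_congr rfl fun i hi => by
    have hi := mem_range.1 hi
    rw [h i hi, selSum_congr fun k hk => h k (hk.trans hi),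
      selSum_congr fun k hk => h k (hk.trans hi)]

/-- The data of a dynamic program for the selection of jobs: processing times, weights, an indicator
of the jobs that have to be selected, the kind `μ` of the second state variable (the selected weight
for `μ = 1`, a guess for the total processing time of the other jobs for `μ = 0`), a cap, an upper
bound on the total processing time, and the sign of the costs. -/
structure SelectDP where
  p : ℕ → ℕ
  w : ℕ → ℕ
  r : ℕ → ℕ
  μ : ℕ
  cap : ℕ
  P : ℕ
  rev : Bool

namespace SelectDP

variable (D : SelectDP)

/-- The shift `w * P` makes the truncated subtraction exact for either sign. Its total over the jobs
does not depend on the selection. -/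
def stepCost (w a b : ℕ) : ℕ := if D.rev then w * D.P + b - a else w * D.P + a - b

def pre (j : ℕ) : ℕ := ∑ i ∈ range j, D.p i

/-- For `μ = 1` this is the full cost of delaying the selected jobs behind job `j`. For `μ = 0` the
selected weight is unknown, and only the part with `w j` is charged here; the rest is charged in
`inCost`. -/
def outCost (j x p : ℕ) : ℕ := D.stepCost (D.w j) (D.μ * (D.p j * x)) (D.w j * p)

/-- For `μ = 0`, the unselected time behind job `j` is the guess `x` minus the unselected time `pre
(j + 1) - p` before it, where `p` already includes job `j`; it is charged with weight `w j`. For `μ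
= 1` only the shift remains. -/
def inCost (j x p : ℕ) : ℕ :=
  D.stepCost (D.w j) ((1 - D.μ) * (D.w j * x)) ((1 - D.μ) * (D.w j * (D.pre (j + 1) - p)))

/-- The best value among those for which job `j` is not selected, given the values `t` for the
jobs before. -/
def outValue (t : ℕ → ℕ → ℕ) (j x p : ℕ) : ℕ :=
  if D.r j = 0 then min D.cap (t x p + D.outCost j x p) else D.cap

def inValue (t : ℕ → ℕ → ℕ) (j x p : ℕ) : ℕ :=
  t (x - D.μ * D.w j) (p - D.p j) + D.inCost j x p

/-- The minimal shifted cost for the jobs in `[0, j)`, by the state variables. -/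
def value : ℕ → ℕ → ℕ → ℕ
  -- For `μ = 0` every `x` is admitted, since a guess cannot be refuted before the end.
  | 0, x, p => if p + D.μ * x = 0 then 0 else D.cap
  | j + 1, x, p =>
    if D.p j ≤ p ∧ D.μ * D.w j ≤ x ∧
      D.inValue (value j) j x p < D.outValue (value j) j x p
    then D.inValue (value j) j x p else D.outValue (value j) j x p

/-- `1` if the minimum is attained by selecting the last job, and `0` otherwise. -/
def decision : ℕ → ℕ → ℕ → ℕ
  | 0, _, _ => 0
  | j + 1, x, p =>
    if D.p j ≤ p ∧ D.μ * D.w j ≤ x ∧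
      D.inValue (D.value j) j x p < D.outValue (D.value j) j x p
    then 1 else 0

/-- The selection that the decisions describe. -/
def trace : ℕ → ℕ → ℕ → ℕ → ℕ
  | 0, _, _, _ => 0
  | j + 1, x, p, i =>
    if i = j then D.decision (j + 1) x p
    else trace j (x - D.decision (j + 1) x p * (D.μ * D.w j)) (p - D.decision (j + 1) x p * D.p j) i

theorem decision_le_one (j x p : ℕ) : D.decision j x p ≤ 1 := by
  cases j
  · simp [decision]
  · simp only [decision]; split <;> simp

theorem trace_le_one (j x p i : ℕ) : D.trace j x p i ≤ 1 := by
  induction j generalizing x p with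
  | zero => simp [trace]
  | succ j ih =>
    simp only [trace]
    split
    · exact D.decision_le_one _ _ _
    · exact ih _ _

theorem outValue_le (t : ℕ → ℕ → ℕ) (j x p : ℕ) : D.outValue t j x p ≤ D.cap := by
  unfold outValue; split
  · exact min_le_left _ _
  · exact le_rfl

theorem value_le (j x p : ℕ) : D.value j x p ≤ D.cap := by
  cases j with
  | zero => simp only [value]; split <;> omega
  | succ j =>
    have := D.outValue_le (D.value j) j x p
    simp only [value]; split <;> omega

/-- The sign of the costs. -/
def sign : ℤ := if D.rev then -1 else 1

/-- The shifted cost of a selection. -/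
def shifted (S : ℕ → ℕ) (j x : ℕ) : ℤ :=
  D.P * (∑ i ∈ range j, D.w i : ℕ) + D.sign * (crossCost D.p D.w S j +
    -- For `μ = 0`, a guess that exceeds the unselected time by some amount overcharges every
    -- selected job by that amount times its weight; this term accounts for it.
    (1 - (D.μ : ℤ)) * ((x : ℤ) - (D.pre j - selSum S D.p j)) * selSum S D.w j)

/-- The assumptions on a dynamic program for `n` jobs. -/
structure Valid (n : ℕ) : Prop where
  mu : D.μ = 0 ∨ D.μ = 1
  pre_le : ∀ j ≤ n, D.pre j ≤ D.P
  sorted : D.rev = true → ∀ u v, u < v → v < n → D.w u * D.p v ≤ D.w v * D.p u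

variable {D} {n : ℕ}

theorem cast_stepCost {w a b : ℕ} (h1 : D.rev = false → b ≤ w * D.P + a)
    (h2 : D.rev = true → a ≤ w * D.P + b) :
    (D.stepCost w a b : ℤ) = D.P * w + D.sign * ((a : ℤ) - b) := by
  unfold stepCost sign
  cases hr : D.rev
  · have := h1 hr
    simp only [Bool.false_eq_true, if_false]
    push_cast [Nat.cast_sub this]; ring
  · have := h2 hr
    simp only [if_true]
    push_cast [Nat.cast_sub this]; ring

theorem shifted_congr {S S' : ℕ → ℕ} {j : ℕ} (x : ℕ) (h : ∀ i < j, S i = S' i) :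
    D.shifted S j x = D.shifted S' j x := by
  unfold shifted
  rw [crossCost_congr h, selSum_congr h, selSum_congr h]

theorem selSum_p_le (hD : D.Valid n) {S : ℕ → ℕ} {j : ℕ} (hj : j ≤ n) (hS : ∀ i < j, S i ≤ 1) :
    selSum S D.p j ≤ D.P := (selSum_le hS).trans (hD.pre_le j hj)

/-- The cross cost grows by `p j` times the selected weight minus `w j` times the selected time. For
`μ = 0` the first of these is cancelled by the correction term, because the unselected time grows by
`p j`. -/
theorem shifted_succ_of_eq_zero (hD : D.Valid n) {S : ℕ → ℕ} {j x : ℕ} (hj : j < n)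
    (hS : ∀ i < j, S i ≤ 1) (h0 : S j = 0) (hx : D.μ = 1 → x = selSum S D.w j) :
    D.shifted S (j + 1) x = D.shifted S j x + D.outCost j x (selSum S D.p j) := by
  have hle := selSum_p_le hD hj.le hS
  have hc : (D.outCost j x (selSum S D.p j) : ℤ) = D.P * D.w j +
      D.sign * ((D.μ * (D.p j * x) : ℕ) - (D.w j * selSum S D.p j : ℕ) : ℤ) := by
    refine cast_stepCost (fun _ => ?_) fun hr => ?_
    · exact (Nat.mul_le_mul_left _ hle).trans (Nat.le_add_right _ _)
    · rcases hD.mu with hm | hm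
      · simp [hm]
      · rw [hx hm, hm, one_mul]
        -- The reversed order has nondecreasing ratios, so `p j * w i ≤ w j * p i` for each selected
        -- `i < j`; summation shows that nothing is truncated.
        refine le_trans ?_ (Nat.le_add_left _ _)
        unfold selSum
        rw [mul_sum, mul_sum]
        refine sum_le_sum fun i hi => ?_
        have h1 := hD.sorted hr i j (mem_range.1 hi) hj
        have h2 := Nat.mul_le_mul_left (S i) h1
        calc D.p j * (S i * D.w i) = S i * (D.w i * D.p j) := by ring
          _ ≤ S i * (D.w j * D.p i) := h2
          _ = _ := by ring
  rw [hc]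
  unfold shifted pre crossCost
  rw [selSum_succ, selSum_succ, sum_range_succ, sum_range_succ, sum_range_succ, h0]
  rcases hD.mu with hm | hm
  · rw [hm]; push_cast; ring
  · rw [hx hm, hm]; push_cast; ring

/-- A selected last job leaves the cross cost unchanged. For `μ = 0` the excess of the guess is
unchanged too, and the selected weight in the correction term grows by `w j`. -/
theorem shifted_succ_of_eq_one (hD : D.Valid n) {S : ℕ → ℕ} {j x : ℕ} (hj : j < n)
    (hS : ∀ i < j, S i ≤ 1) (h1 : S j = 1) (hx : D.μ = 0 → x ≤ D.P) :
    D.shifted S (j + 1) x =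
      D.shifted S j (x - D.μ * D.w j) + D.inCost j x (selSum S D.p (j + 1)) := by
  have hpre : selSum S D.p (j + 1) ≤ D.pre (j + 1) :=
    selSum_le fun i hi => by
      rcases Nat.lt_succ_iff_lt_or_eq.1 hi with h | rfl
      · exact hS i h
      · exact h1.le
  have hc : (D.inCost j x (selSum S D.p (j + 1)) : ℤ) = D.P * D.w j +
      D.sign * (((1 - D.μ) * (D.w j * x) : ℕ) -
        ((1 - D.μ) * (D.w j * (D.pre (j + 1) - selSum S D.p (j + 1))) : ℕ) : ℤ) := by
    have hP := hD.pre_le (j + 1) hj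
    refine cast_stepCost (fun _ => ?_) fun hr => ?_
    · rcases hD.mu with hm | hm
      · rw [hm]
        have : D.pre (j + 1) - selSum S D.p (j + 1) ≤ D.P := by omega
        have := Nat.mul_le_mul_left (D.w j) this
        omega
      · simp [hm]
    · rcases hD.mu with hm | hm
      · have := Nat.mul_le_mul_left (D.w j) (hx hm)
        rw [hm]; omega
      · simp [hm]
  rw [hc]
  unfold shifted
  rcases hD.mu with hm | hm
  · rw [hm]
    have e1 : D.pre (j + 1) = D.pre j + D.p j := sum_range_succ _ _
    simp only [Nat.sub_zero, one_mul, zero_mul]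
    push_cast [Nat.cast_sub hpre]
    rw [e1, selSum_succ, selSum_succ, crossCost, crossCost, sum_range_succ, sum_range_succ, h1]
    push_cast; ring
  · rw [hm]
    unfold crossCost
    rw [selSum_succ, selSum_succ, sum_range_succ, sum_range_succ, h1]
    push_cast; ring

/-- The values are lower bounds. -/
theorem value_le_shifted (hD : D.Valid n) {S : ℕ → ℕ} (hS : ∀ i < n, S i ≤ 1)
    (hr : ∀ i < n, D.r i ≠ 0 → S i = 1) :
    ∀ j ≤ n, ∀ x, (D.μ = 0 → x ≤ D.P) → (D.μ = 1 → x = selSum S D.w j) →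
      (D.value j x (selSum S D.p j) : ℤ) ≤ D.shifted S j x := by
  -- For `μ = 0` the guess stays the same along the recursion, so the induction has to cover guesses
  -- that are wrong for a shorter prefix.
  intro j
  induction j with
  | zero =>
    intro _ x _ hx
    have : D.μ * x = 0 := by
      rcases hD.mu with hm | hm
      · simp [hm]
      · simp [hx hm, selSum]
    simp [value, shifted, selSum, crossCost, this]
  | succ j ih =>
    intro hj x hxP hx
    have hj' : j < n := hj
    have hS' : ∀ i < j, S i ≤ 1 := fun i hi => hS i (hi.trans hj')
    rcases (by have := hS j hj'; omega : S j = 0 ∨ S j = 1) with h0 | h1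
    · have hr0 : D.r j = 0 := by
        by_contra hne
        have := hr j hj' hne
        omega
      have hx' : D.μ = 1 → x = selSum S D.w j := fun hm => by
        rw [hx hm, selSum_succ, h0]; simp
      rw [shifted_succ_of_eq_zero hD hj' hS' h0 hx', selSum_succ, h0, zero_mul, add_zero]
      have h2 : D.value (j + 1) x (selSum S D.p j) ≤
          D.value j x (selSum S D.p j) + D.outCost j x (selSum S D.p j) := by
        have : D.outValue (D.value j) j x (selSum S D.p j) ≤
            D.value j x (selSum S D.p j) + D.outCost j x (selSum S D.p j) := by
          simp only [outValue, hr0, if_true]; exact min_le_right _ _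
        simp only [value]
        split <;> omega
      have := ih hj'.le x hxP hx'
      calc _ ≤ ((D.value j x (selSum S D.p j) + D.outCost j x (selSum S D.p j) : ℕ) : ℤ) := by
            exact_mod_cast h2
        _ ≤ _ := by push_cast; linarith
    · have hx' : D.μ * D.w j ≤ x := by
        rcases hD.mu with hm | hm
        · simp [hm]
        · rw [hx hm, selSum_succ, hm, h1]; omega
      have hp' : D.p j ≤ selSum S D.p (j + 1) := by rw [selSum_succ, h1]; omega
      rw [shifted_succ_of_eq_one hD hj' hS' h1 hxP]
      have h2 : D.value (j + 1) x (selSum S D.p (j + 1)) ≤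
          D.inValue (D.value j) j x (selSum S D.p (j + 1)) := by
        simp only [value, hp', hx', true_and]
        split <;> omega
      have := ih hj'.le (x - D.μ * D.w j) (fun hm => (Nat.sub_le _ _).trans (hxP hm)) fun hm => by
        rw [hx hm, hm, selSum_succ, h1]; omega
      have e : selSum S D.p (j + 1) - D.p j = selSum S D.p j := by
        rw [selSum_succ, h1]; omega
      calc _ ≤ ((D.inValue (D.value j) j x (selSum S D.p (j + 1)) : ℕ) : ℤ) := by exact_mod_cast h2
        _ ≤ _ := by
          unfold inValue
          rw [e]; push_cast
          linarith

/-- The values below the cap are attained by the traced selections. -/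
theorem trace_spec (hD : D.Valid n) :
    ∀ j ≤ n, ∀ x p, (D.μ = 0 → x ≤ D.P) → D.value j x p < D.cap →
      (∀ i < j, D.r i ≠ 0 → D.trace j x p i = 1) ∧ selSum (D.trace j x p) D.p j = p ∧
      (D.μ = 1 → selSum (D.trace j x p) D.w j = x) ∧
      D.shifted (D.trace j x p) j x = D.value j x p := by
  intro j
  induction j with
  | zero =>
    intro _ x p _ hlt
    simp only [value] at hlt ⊢
    split at hlt
    · rename_i h0
      have h1 : p = 0 := by omega
      have h2 : D.μ * x = 0 := by omega
      refine ⟨by simp, by simp [selSum, h1], fun hm => ?_, ?_⟩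
      · rw [hm, one_mul] at h2; simp [selSum, h2]
      · simp [shifted, selSum, crossCost, h1, h2]
    · omega
  | succ j ih =>
    intro hj x p hxP hlt
    have hj' : j < n := hj
    set S := D.trace (j + 1) x p with hSdef
    have hS1 : ∀ i < j, S i ≤ 1 := fun i _ => D.trace_le_one _ _ _ _
    have hSj : S j = D.decision (j + 1) x p := by simp [hSdef, trace]
    by_cases hc : D.p j ≤ p ∧ D.μ * D.w j ≤ x ∧
      D.inValue (D.value j) j x p < D.outValue (D.value j) j x p
    · have hd : D.decision (j + 1) x p = 1 := by simp only [decision, if_pos hc]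
      rw [hd] at hSj
      have hv : D.value (j + 1) x p = D.inValue (D.value j) j x p := by simp only [value, if_pos hc]
      have hlt' : D.value j (x - D.μ * D.w j) (p - D.p j) < D.cap := by
        rw [hv] at hlt; unfold inValue at hlt; omega
      obtain ⟨i1, i2, i3, i4⟩ := ih hj'.le (x - D.μ * D.w j) (p - D.p j)
        (fun hm => (Nat.sub_le _ _).trans (hxP hm)) hlt'
      have hag : ∀ i < j, S i = D.trace j (x - D.μ * D.w j) (p - D.p j) i := fun i hi => by
        simp [hSdef, trace, hd, hi.ne]
      have e2 : selSum S D.p (j + 1) = p := by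
        rw [selSum_succ, selSum_congr hag, i2, hSj]; omega
      refine ⟨fun i hi hri => ?_, e2, fun hm => ?_, ?_⟩
      · rcases Nat.lt_succ_iff_lt_or_eq.1 hi with h | rfl
        · rw [hag i h]; exact i1 i h hri
        · exact hSj
      · have := hc.2.1
        rw [selSum_succ, selSum_congr hag, i3 hm, hSj, hm]
        rw [hm] at this; omega
      · rw [shifted_succ_of_eq_one hD hj' hS1 hSj hxP, shifted_congr _ hag, i4, hv, e2]
        unfold inValue; push_cast; rfl
    · have hd : D.decision (j + 1) x p = 0 := by simp only [decision, if_neg hc]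
      rw [hd] at hSj
      have hv : D.value (j + 1) x p = D.outValue (D.value j) j x p := by
        simp only [value, if_neg hc]
      rw [hv] at hlt
      -- A required job that is left out has the value `cap`, contrary to the assumption.
      have hr0 : D.r j = 0 := by
        by_contra hne
        simp [outValue, hne] at hlt
      simp only [outValue, hr0, if_true] at hlt hv
      have hv' : D.value (j + 1) x p = D.value j x p + D.outCost j x p := by
        rw [hv]; omega
      obtain ⟨i1, i2, i3, i4⟩ := ih hj'.le x p hxP (by omega)
      have hag : ∀ i < j, S i = D.trace j x p i := fun i hi => by
        simp [hSdef, trace, hd, hi.ne]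
      have e2 : selSum S D.p j = p := by rw [selSum_congr hag, i2]
      have e3 : D.μ = 1 → selSum S D.w j = x := fun hm => by rw [selSum_congr hag, i3 hm]
      refine ⟨fun i hi hri => ?_, ?_, fun hm => ?_, ?_⟩
      · rcases Nat.lt_succ_iff_lt_or_eq.1 hi with h | rfl
        · rw [hag i h]; exact i1 i h hri
        · exact absurd hr0 hri
      · rw [selSum_succ, e2, hSj]; simp
      · rw [selSum_succ, e3 hm, hSj]; simp
      · rw [shifted_succ_of_eq_zero hD hj' hS1 hSj (fun hm => (e3 hm).symm), shifted_congr _ hag,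
          i4, hv', e2]
        push_cast; rfl

/-- A pair of state variables that describes a selection without a wrong guess. -/
def Exact (D : SelectDP) (j x p : ℕ) : Prop := D.μ = 1 ∨ x + p = D.pre j

theorem shifted_of_exact {S : ℕ → ℕ} {j x : ℕ}
    (h : D.Exact j x (selSum S D.p j)) :
    D.shifted S j x = D.P * (∑ i ∈ range j, D.w i : ℕ) + D.sign * crossCost D.p D.w S j := by
  unfold shifted
  rcases h with h | h
  · simp [h]
  · have : (x : ℤ) - (D.pre j - selSum S D.p j) = 0 := by rw [← h]; push_cast; ring
    rw [this]; simp

end SelectDP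

end RentSchedule

/-! ### Inversions, blocks and the cut -/

namespace RentSchedule

open Finset

theorem sum_range_ite_lt {M : Type*} [AddCommMonoid M] {m n : ℕ} (hm : m ≤ n) (f : ℕ → M) :
    ∑ v ∈ range n, (if v < m then f v else 0) = ∑ v ∈ range m, f v := by
  rw [← sum_filter]
  congr 1
  ext v
  simp only [mem_filter, mem_range]
  omega

/-- The total weighted completion time when job `i` has position `q i`. -/
def seqCost (n : ℕ) (p w q : ℕ → ℕ) : ℕ :=
  ∑ j ∈ range n, ∑ i ∈ range n, if q i ≤ q j then w j * p i else 0

theorem seqCost_id (n : ℕ) (p w : ℕ → ℕ) :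
    seqCost n p w id = ∑ j ∈ range n, w j * ∑ i ∈ range (j + 1), p i := by
  refine sum_congr rfl fun j hj => ?_
  rw [mul_sum, ← sum_range_ite_lt (mem_range.1 hj) (fun i => w j * p i)]
  exact sum_congr rfl fun i _ => by simp

/-- The cost of interchanging `u` and `v`. -/
def swapCost (p w : ℕ → ℕ) (u v : ℕ) : ℤ := (p v : ℤ) * w u - p u * w v

theorem swapCost_swap (p w : ℕ → ℕ) (u v : ℕ) : swapCost p w v u = - swapCost p w u v := by
  unfold swapCost; ring

/-- The total cost of the inversions of a sequence. -/
def inversionCost (n : ℕ) (p w q : ℕ → ℕ) : ℤ :=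
  ∑ v ∈ range n, ∑ u ∈ range n, if u < v ∧ q v < q u then swapCost p w u v else 0

theorem sum_sum_eq_diag_add (n : ℕ) (F : ℕ → ℕ → ℤ) :
    ∑ j ∈ range n, ∑ i ∈ range n, F j i = ∑ j ∈ range n, F j j +
      ∑ v ∈ range n, ∑ u ∈ range n, if u < v then F v u + F u v else 0 := by
  have h1 : ∀ j ∈ range n, ∑ i ∈ range n, F j i = F j j +
      (∑ i ∈ range n, (if i < j then F j i else 0) + ∑ i ∈ range n, if j < i then F j i else 0) := by
    intro j hj
    have : F j j = ∑ i ∈ range n, if i = j then F j i else 0 := by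
      rw [sum_ite_eq' (range n) j, if_pos hj]
    rw [this, ← sum_add_distrib, ← sum_add_distrib]
    refine sum_congr rfl fun i _ => ?_
    rcases lt_trichotomy i j with h | h | h
    · simp [h, h.ne, h.not_gt]
    · simp [h]
    · simp [h, h.ne', h.not_gt]
  rw [sum_congr rfl h1, sum_add_distrib, sum_add_distrib,
    sum_comm (f := fun j i => if j < i then F j i else 0), ← sum_add_distrib]
  congr 1
  refine sum_congr rfl fun v _ => ?_
  rw [← sum_add_distrib]
  refine sum_congr rfl fun u _ => ?_
  split <;> simp

/-- Each pair `u < v` contributes `w v * p u` in sorted order and `w u * p v` if inverted; the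
difference is `swapCost p w u v`. -/
theorem seqCost_eq {n : ℕ} (p w : ℕ → ℕ) {q : ℕ → ℕ}
    (hq : ∀ i < n, ∀ j < n, q i = q j → i = j) :
    (seqCost n p w q : ℤ) = seqCost n p w id + inversionCost n p w q := by
  have key : ∀ q : ℕ → ℕ, (seqCost n p w q : ℤ) =
      ∑ j ∈ range n, ∑ i ∈ range n, if q i ≤ q j then (w j * p i : ℤ) else 0 := by
    intro q; unfold seqCost; push_cast; rfl
  rw [key, key, sum_sum_eq_diag_add n (fun j i => if q i ≤ q j then (w j * p i : ℤ) else 0),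
    sum_sum_eq_diag_add n (fun j i => if id i ≤ id j then (w j * p i : ℤ) else 0), add_assoc]
  congr 1
  · simp
  · unfold inversionCost
    rw [← sum_add_distrib]
    refine sum_congr rfl fun v hv => ?_
    rw [← sum_add_distrib]
    refine sum_congr rfl fun u hu => ?_
    by_cases huv : u < v
    · have hne : q u ≠ q v := fun h => huv.ne (hq u (mem_range.1 hu) v (mem_range.1 hv) h)
      rcases lt_or_gt_of_ne hne with h | h
      · simp [huv, h.le, h.not_ge, h.not_gt, huv.le, huv.not_ge]
      · simp [huv, h, h.le, h.not_ge, huv.le, huv.not_ge, swapCost]; ring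
    · simp [huv]

/-- The sequence `f` read from the end. -/
def revSeq (n : ℕ) (f : ℕ → ℕ) (i : ℕ) : ℕ := f (n - 1 - i)

/-- The total cost of a selection `S` with cut `k`: the jobs before `k` that are not selected move
to the front, and the jobs from `k` on that are not selected move to the end. -/
def blockCost (n : ℕ) (p w S : ℕ → ℕ) (k : ℕ) : ℤ :=
  crossCost p w S k - crossCost (revSeq n p) (revSeq n w) (revSeq n S) (n - k)

theorem crossCost_eq_sum_sum {m n : ℕ} (hm : m ≤ n) (p w S : ℕ → ℕ) :
    crossCost p w S m = ∑ v ∈ range n, ∑ u ∈ range n,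
      if v < m ∧ u < v then (1 - (S v : ℤ)) * S u * swapCost p w u v else 0 := by
  unfold crossCost
  rw [← sum_range_ite_lt hm]
  refine sum_congr rfl fun v hv => ?_
  by_cases h : v < m
  · simp only [h, true_and, if_true]
    rw [sum_range_ite_lt (mem_range.1 hv).le]
    unfold selSum swapCost
    push_cast
    rw [mul_sum, sum_mul, ← sum_sub_distrib, mul_sum]
    exact sum_congr rfl fun u _ => by ring
  · simp [h]

theorem sum_sum_reflect (n : ℕ) (F : ℕ → ℕ → ℤ) :
    ∑ v ∈ range n, ∑ u ∈ range n, F v u =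
      ∑ v ∈ range n, ∑ u ∈ range n, F (n - 1 - v) (n - 1 - u) := by
  rw [← sum_range_reflect]
  exact sum_congr rfl fun v _ => (sum_range_reflect (fun u => F (n - 1 - v) u) n).symm

/-- Reflecting indices turns the prefix of length `n - k` into the jobs from `k` on and `u < v` into
`v < u`. For such pairs the inversion costs `swapCost p w v u = - swapCost p w u v`, whence the
minus sign in `blockCost`. -/
theorem crossCost_rev_eq_sum_sum {k n : ℕ} (p w S : ℕ → ℕ) :
    crossCost (revSeq n p) (revSeq n w) (revSeq n S) (n - k) =
      ∑ v ∈ range n, ∑ u ∈ range n,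
        if k ≤ v ∧ v < u then (1 - (S v : ℤ)) * S u * swapCost p w u v else 0 := by
  rw [crossCost_eq_sum_sum (Nat.sub_le n k), sum_sum_reflect]
  refine sum_congr rfl fun v hv => sum_congr rfl fun u hu => ?_
  have hv := mem_range.1 hv
  have hu := mem_range.1 hu
  have e1 : n - 1 - (n - 1 - v) = v := by omega
  have e2 : n - 1 - (n - 1 - u) = u := by omega
  simp only [revSeq, swapCost, e1, e2]
  refine if_congr ?_ rfl rfl
  omega

/-- The class of job `i`: `0` before, `1` in and `2` after the block of the selected jobs. -/
def blockClass (S : ℕ → ℕ) (k i : ℕ) : ℕ := if i < k then S i else 2 - S i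

/-- Classes keep the sorted order inside, and every front job has a smaller index than every back
job. Thus an inversion pairs a front job with a selected job of smaller index, or a back job with a
selected job of larger index. -/
theorem inversionCost_of_blockClass {n k : ℕ} (hk : k ≤ n) (p w : ℕ → ℕ) {S q : ℕ → ℕ}
    (hS : ∀ i < n, S i ≤ 1)
    (hq : ∀ i < n, ∀ j < n, (q i < q j ↔ blockClass S k i < blockClass S k j ∨
      blockClass S k i = blockClass S k j ∧ i < j)) :
    inversionCost n p w q = blockCost n p w S k := by
  unfold blockCost
  rw [crossCost_rev_eq_sum_sum, crossCost_eq_sum_sum hk,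
    sum_comm (f := fun v u => if k ≤ v ∧ v < u then (1 - (S v : ℤ)) * S u * swapCost p w u v else 0),
    ← sum_sub_distrib]
  refine sum_congr rfl fun v hv => ?_
  rw [← sum_sub_distrib]
  refine sum_congr rfl fun u hu => ?_
  have hv := mem_range.1 hv
  have hu := mem_range.1 hu
  simp only [hq v hv u hu, swapCost_swap p w u v]
  by_cases huv : u < v
  · have h3 : ¬ v < u := by omega
    have hSv := hS v hv
    have hSu := hS u hu
    simp only [huv, h3, and_false, or_false, true_and, and_true, blockClass]
    by_cases h1 : v < k
    · have h2 : u < k := by omega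
      have h2' : ¬ k ≤ u := by omega
      simp only [h1, h2, h2', if_true, if_false]
      interval_cases S v <;> interval_cases S u <;> simp
    · by_cases h2 : u < k
      · have h2' : ¬ k ≤ u := by omega
        simp only [h1, h2, h2', if_true, if_false]
        interval_cases S v <;> interval_cases S u <;> simp
      · have h2' : k ≤ u := by omega
        simp only [h1, h2, h2', if_true, if_false]
        interval_cases S v <;> interval_cases S u <;> simp
  · simp [huv]

/-- Whenever the selected jobs form a block in a sequence, moving the jobs before and after the
block according to a suitable cut does not increase the cost. -/
theorem exists_blockCost_le {n : ℕ} {p w S q : ℕ → ℕ} (hp : ∀ i < n, 0 < p i)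
    (hsort : ∀ u v, u < v → v < n → p u * w v ≤ p v * w u) (hS : ∀ i < n, S i ≤ 1)
    (hsep : ∀ v < n, S v = 0 → (∀ u < n, S u = 1 → q v < q u) ∨ (∀ u < n, S u = 1 → q u < q v)) :
    ∃ k ≤ n, blockCost n p w S k ≤ inversionCost n p w q := by
  classical
  have hδ : ∀ u v, u < v → v < n → 0 ≤ swapCost p w u v := fun u v h1 h2 => by
    have := hsort u v h1 h2
    unfold swapCost
    have : ((p u * w v : ℕ) : ℤ) ≤ (p v * w u : ℕ) := by exact_mod_cast this
    push_cast at this; linarith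
  -- `α v` and `γ v` are the costs of the inversions of `v` with the selected jobs if `v` is placed
  -- before, respectively behind, all of them.
  set α : ℕ → ℤ := fun v => ∑ u ∈ range n, if u < v then (S u : ℤ) * swapCost p w u v else 0
    with hα
  set γ : ℕ → ℤ := fun v => ∑ u ∈ range n, if v < u then (S u : ℤ) * swapCost p w v u else 0
    with hγ
  have hcost : ∀ k ≤ n, blockCost n p w S k =
      ∑ v ∈ range n, (1 - (S v : ℤ)) * (if v < k then α v else γ v) := by
    intro k hk
    unfold blockCost
    rw [crossCost_rev_eq_sum_sum, crossCost_eq_sum_sum hk, ← sum_sub_distrib]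
    refine sum_congr rfl fun v _ => ?_
    rw [← sum_sub_distrib]
    by_cases h : v < k
    · have h' : ¬ k ≤ v := by omega
      simp only [h, h', if_true, hα, mul_sum, true_and, false_and, if_false, sub_zero]
      refine sum_congr rfl fun u _ => ?_
      split <;> ring
    · have h' : k ≤ v := by omega
      simp only [h, h', if_false, hγ, mul_sum, true_and, false_and, zero_sub]
      refine sum_congr rfl fun u _ => ?_
      rw [swapCost_swap p w v u]
      split <;> ring
  -- Passing from back to front changes the order of `v` and every selected job, so the difference
  -- involves only the totals of `S`.
  have hdiff : ∀ v ∈ range n, α v - γ v = (p v : ℤ) * selSum S w n - w v * selSum S p n := by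
    intro v _
    unfold selSum
    simp only [hα, hγ]
    push_cast
    rw [← sum_sub_distrib, mul_sum, mul_sum, ← sum_sub_distrib]
    refine sum_congr rfl fun u _ => ?_
    rcases lt_trichotomy u v with h | h | h
    · simp [h, h.not_gt, swapCost]; ring
    · simp [h]; ring
    · simp [h, h.not_gt, swapCost]; ring
  have hlow : ∀ v ∈ range n, (1 - (S v : ℤ)) * min (α v) (γ v) ≤
      ∑ u ∈ range n, (1 - (S v : ℤ)) * S u *
        ((if u < v ∧ q v < q u then swapCost p w u v else 0) +
          if v < u ∧ q u < q v then swapCost p w v u else 0) := by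
    intro v hv
    have hSv := hS v (mem_range.1 hv)
    rcases (by omega : S v = 0 ∨ S v = 1) with h0 | h1
    · rcases hsep v (mem_range.1 hv) h0 with h | h
      · refine (mul_le_mul_of_nonneg_left (min_le_left _ _) (by simp [h0])).trans (le_of_eq ?_)
        simp only [hα, mul_sum]
        refine sum_congr rfl fun u hu => ?_
        have hSu := hS u (mem_range.1 hu)
        rcases (by omega : S u = 0 ∨ S u = 1) with g0 | g1
        · simp [g0]
        · have := h u (mem_range.1 hu) g1
          simp [h0, g1, this, this.not_gt]
      · refine (mul_le_mul_of_nonneg_left (min_le_right _ _) (by simp [h0])).trans (le_of_eq ?_)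
        simp only [hγ, mul_sum]
        refine sum_congr rfl fun u hu => ?_
        have hSu := hS u (mem_range.1 hu)
        rcases (by omega : S u = 0 ∨ S u = 1) with g0 | g1
        · simp [g0]
        · have := h u (mem_range.1 hu) g1
          simp [h0, g1, this, this.not_gt]
    · simp [h1]
  -- Inversions among selected jobs and among unselected jobs are dropped; they cost a nonnegative
  -- amount.
  have hinv : ∑ v ∈ range n, (1 - (S v : ℤ)) * min (α v) (γ v) ≤ inversionCost n p w q := by
    refine (sum_le_sum hlow).trans ?_
    simp only [mul_add, sum_add_distrib]
    rw [sum_comm (f := fun v u => (1 - (S v : ℤ)) * S u *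
      if v < u ∧ q u < q v then swapCost p w v u else 0), ← sum_add_distrib]
    unfold inversionCost
    refine sum_le_sum fun v hv => ?_
    rw [← sum_add_distrib]
    refine sum_le_sum fun u hu => ?_
    have hSv := hS v (mem_range.1 hv)
    have hSu := hS u (mem_range.1 hu)
    split_ifs with h
    · have := hδ u v h.1 (mem_range.1 hv)
      interval_cases S v <;> interval_cases S u <;> simp <;> linarith
    · simp
  -- The cut is the first job for which the back is strictly better, or `n` if there is none.
  have hex : ∃ k, k = n ∨ ¬ (p k * selSum S w n ≤ w k * selSum S p n) := ⟨n, .inl rfl⟩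
  have hkn : Nat.find hex ≤ n := Nat.find_min' hex (.inl rfl)
  refine ⟨Nat.find hex, hkn, ?_⟩
  rw [hcost _ hkn]
  refine le_trans (sum_le_sum fun v hv => ?_) hinv
  have hvn := mem_range.1 hv
  have hSv := hS v hvn
  refine mul_le_mul_of_nonneg_left ?_ (by
    have : (S v : ℤ) ≤ 1 := by exact_mod_cast hSv
    linarith)
  have hd := hdiff v hv
  by_cases h : v < Nat.find hex
  · rw [if_pos h]
    have h1 := Nat.find_min hex h
    push Not at h1
    have h2 : ((p v * selSum S w n : ℕ) : ℤ) ≤ (w v * selSum S p n : ℕ) := by exact_mod_cast h1.2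
    push_cast at h2
    exact le_min le_rfl (by linarith)
  · rw [if_neg h]
    -- If the front were at least as good for some `v` from the cut on, then also for the job at the
    -- cut, whose ratio is at least that of `v`.
    have h1 : ¬ (p v * selSum S w n ≤ w v * selSum S p n) := by
      intro hgood
      have hk := Nat.find_spec hex
      set k := Nat.find hex with hkdef
      rcases hk with hk | hk
      · omega
      · refine hk ?_
        rcases Nat.lt_or_eq_of_le (not_lt.1 h) with hlt | heq
        · have hs := hsort k v hlt hvn
          have hpv := hp v hvn
          refine le_of_mul_le_mul_left (a := p v) ?_ hpv
          calc p v * (p k * selSum S w n) = p k * (p v * selSum S w n) := by ring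
            _ ≤ p k * (w v * selSum S p n) := Nat.mul_le_mul_left _ hgood
            _ = (p k * w v) * selSum S p n := by ring
            _ ≤ (p v * w k) * selSum S p n := Nat.mul_le_mul_right _ hs
            _ = _ := by ring
        · rw [heq]; exact hgood
    have h2 : ((w v * selSum S p n : ℕ) : ℤ) < (p v * selSum S w n : ℕ) := by
      exact_mod_cast not_le.1 h1
    push_cast at h2
    exact le_min (by linarith) le_rfl

end RentSchedule

/-! ### Combining the front and the back program -/

namespace RentSchedule

open Finset

theorem sum_range_add_sum_revSeq {k n : ℕ} (hk : k ≤ n) (f : ℕ → ℕ) :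
    ∑ i ∈ range k, f i + ∑ i ∈ range (n - k), f (n - 1 - i) = ∑ i ∈ range n, f i := by
  obtain ⟨m, rfl⟩ := Nat.exists_eq_add_of_le hk
  rw [sum_range_add, Nat.add_sub_cancel_left, ← sum_range_reflect (fun i => f (k + i)) m]
  congr 1
  refine sum_congr rfl fun i hi => ?_
  have := mem_range.1 hi
  congr 1
  omega

theorem selSum_add_selSum_revSeq {k n : ℕ} (hk : k ≤ n) (S f : ℕ → ℕ) :
    selSum S f k + selSum (revSeq n S) (revSeq n f) (n - k) = selSum S f n :=
  sum_range_add_sum_revSeq hk fun i => S i * f i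

/-- The dynamic program for the front part (`dir = false`) or the back part (`dir = true`) of a
sequence, with budget `K`. -/
def blockDP (n K : ℕ) (p w r : ℕ → ℕ) (dir : Bool) : SelectDP where
  p := if dir then revSeq n p else p
  w := if dir then revSeq n w else w
  r := if dir then revSeq n r else r
  -- The second state variable ranges over weights or processing times, whichever total is smaller.
  μ := if ∑ i ∈ range n, w i < ∑ i ∈ range n, p i then 1 else 0
  cap := K + (∑ i ∈ range n, p i) * (∑ i ∈ range n, w i) + 1
  P := ∑ i ∈ range n, p i
  rev := dir

theorem blockDP_valid (n K : ℕ) {p w : ℕ → ℕ} (r : ℕ → ℕ) (dir : Bool)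
    (hsort : ∀ u v, u < v → v < n → p u * w v ≤ p v * w u) :
    (blockDP n K p w r dir).Valid n where
  mu := by simp only [blockDP]; split <;> simp
  pre_le j hj := by
    simp only [blockDP, SelectDP.pre]
    cases dir
    · simpa using sum_le_sum_of_subset (range_subset_range.2 hj)
    · have := sum_range_add_sum_revSeq (Nat.sub_le n j) p
      rw [Nat.sub_sub_self hj] at this
      simp only [if_true, revSeq]
      omega
  sorted hr u v huv hv := by
    simp only [blockDP] at hr
    subst hr
    simp only [blockDP, revSeq, if_true]
    have := hsort (n - 1 - v) (n - 1 - u) (by omega) (by omega)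
    rw [mul_comm, mul_comm (w _)]
    exact this

/-- `m` is the minimal value below the cap over all exact states with selected processing time at
most `b`, and it is attained at `(x, q)`. -/
structure SelectDP.IsMin (D : SelectDP) (M j b m x q : ℕ) : Prop where
  le_cap : m ≤ D.cap
  le : ∀ x' ≤ M, ∀ q' ≤ b, D.Exact j x' q' → m ≤ D.value j x' q'
  attained : m < D.cap → x ≤ M ∧ q ≤ b ∧ D.Exact j x q ∧ D.value j x q = m

theorem SelectDP.IsMin.mono {D : SelectDP} {M j b b' m m' x x' q q' : ℕ} (h : D.IsMin M j b m x q)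
    (h' : D.IsMin M j b' m' x' q') (hb : b ≤ b') : m' ≤ m := by
  rcases Nat.lt_or_ge m D.cap with hm | hm
  · obtain ⟨h1, h2, h3, h4⟩ := h.attained hm
    exact h4 ▸ h'.le x h1 q (h2.trans hb) h3
  · exact h'.le_cap.trans hm

section

variable {n K : ℕ} {p w r : ℕ → ℕ}

/-- A selection enters the table at an exact state within the range of the second variable, so the
lower bound for that state applies to the minimum. -/
theorem SelectDP.IsMin.le_of_selection {dir : Bool} {j b m x q : ℕ}
    (hsort : ∀ u v, u < v → v < n → p u * w v ≤ p v * w u) (hj : j ≤ n)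
    (h : (blockDP n K p w r dir).IsMin (min (∑ i ∈ range n, w i) (∑ i ∈ range n, p i)) j b m x q)
    {S : ℕ → ℕ} (hS : ∀ i < n, S i ≤ 1)
    (hr : ∀ i < n, (blockDP n K p w r dir).r i ≠ 0 → S i = 1)
    (hb : selSum S (blockDP n K p w r dir).p j ≤ b)
    (hw : selSum S (blockDP n K p w r dir).w j ≤ ∑ i ∈ range n, w i) :
    (m : ℤ) ≤ (∑ i ∈ range n, p i : ℕ) * (∑ i ∈ range j, (blockDP n K p w r dir).w i : ℕ) +
      (blockDP n K p w r dir).sign *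
        crossCost (blockDP n K p w r dir).p (blockDP n K p w r dir).w S j := by
  have hD := blockDP_valid n K r dir hsort
  set D := blockDP n K p w r dir with hDdef
  have hpre : selSum S D.p j ≤ D.pre j := selSum_le fun i hi => hS i (hi.trans_le hj)
  have hpre' : D.pre j ≤ ∑ i ∈ range n, p i := hD.pre_le j hj
  have hμ : D.μ = if ∑ i ∈ range n, w i < ∑ i ∈ range n, p i then 1 else 0 := rfl
  -- The witness is the selected weight for `μ = 1` and the true unselected time for `μ = 0`.
  obtain ⟨y, hyM, hyE, hy1, hy0⟩ : ∃ y ≤ min (∑ i ∈ range n, w i) (∑ i ∈ range n, p i),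
      D.Exact j y (selSum S D.p j) ∧ (D.μ = 1 → y = selSum S D.w j) ∧ (D.μ = 0 → y ≤ D.P) := by
    by_cases hlt : ∑ i ∈ range n, w i < ∑ i ∈ range n, p i
    · rw [if_pos hlt] at hμ
      exact ⟨selSum S D.w j, by omega, .inl hμ, fun _ => rfl, fun h0 => by omega⟩
    · rw [if_neg hlt] at hμ
      refine ⟨D.pre j - selSum S D.p j, by omega, .inr (by omega), fun h1 => by omega, fun _ => ?_⟩
      have : D.P = ∑ i ∈ range n, p i := rfl
      omega
  have h1 := h.le y hyM _ hb hyE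
  have h2 := SelectDP.value_le_shifted hD hS hr j hj y hy0 hy1
  rw [SelectDP.shifted_of_exact hyE] at h2
  have h3 : (m : ℤ) ≤ D.value j y (selSum S D.p j) := by exact_mod_cast h1
  exact h3.trans h2

theorem revSeq_revSeq {f : ℕ → ℕ} {i : ℕ} (hi : i < n) : revSeq n f (n - 1 - i) = f i := by
  unfold revSeq
  congr 1
  omega

/-- A selection and a cut within the budget are found by the dynamic programs. -/
theorem lt_cap_of_blockCost_le {k b₁ b₂ m₁ m₂ x₁ x₂ q₁ q₂ : ℕ}
    (hsort : ∀ u v, u < v → v < n → p u * w v ≤ p v * w u) (hk : k ≤ n)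
    (h₁ : (blockDP n K p w r false).IsMin
      (min (∑ i ∈ range n, w i) (∑ i ∈ range n, p i)) k b₁ m₁ x₁ q₁)
    (h₂ : (blockDP n K p w r true).IsMin
      (min (∑ i ∈ range n, w i) (∑ i ∈ range n, p i)) (n - k) b₂ m₂ x₂ q₂)
    {S : ℕ → ℕ} (hS : ∀ i < n, S i ≤ 1) (hr : ∀ i < n, r i ≠ 0 → S i = 1)
    (hb₁ : selSum S p k ≤ b₁) (hb₂ : selSum (revSeq n S) (revSeq n p) (n - k) ≤ b₂)
    (hcost : (seqCost n p w id : ℤ) + blockCost n p w S k ≤ K) :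
    m₁ + m₂ + seqCost n p w id <
      K + (∑ i ∈ range n, p i) * (∑ i ∈ range n, w i) + 1 := by
  have hSw : selSum S w k + selSum (revSeq n S) (revSeq n w) (n - k) ≤ ∑ i ∈ range n, w i := by
    rw [selSum_add_selSum_revSeq hk]; exact selSum_le hS
  have e1 := h₁.le_of_selection hsort hk hS hr hb₁ (by simp only [blockDP]; simp; omega)
  have e2 := h₂.le_of_selection (S := revSeq n S) hsort (Nat.sub_le n k)
    (fun i hi => hS _ (by omega)) (fun i hi => hr _ (by omega)) hb₂
    (by simp only [blockDP]; simp; omega)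
  -- The weights of the front and back part add up to the total weight, so the two shifts add up to
  -- `P * W`.
  have e3 := sum_range_add_sum_revSeq hk w
  simp only [blockDP, SelectDP.sign, if_true, Bool.false_eq_true, if_false, revSeq] at e1 e2
  unfold blockCost at hcost
  have e4 : ((∑ i ∈ range n, w i : ℕ) : ℤ) = (∑ i ∈ range k, w i : ℕ) +
      (∑ i ∈ range (n - k), w (n - 1 - i) : ℕ) := by exact_mod_cast e3.symm
  zify
  push_cast at e1 e2 e4 hcost ⊢
  rw [e4]
  linarith

/-- The selection that the traces of the two dynamic programs describe. -/
def tracedSelection (n K : ℕ) (p w r : ℕ → ℕ) (k x₁ q₁ x₂ q₂ i : ℕ) : ℕ :=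
  if i < k then (blockDP n K p w r false).trace k x₁ q₁ i
  else (blockDP n K p w r true).trace (n - k) x₂ q₂ (n - 1 - i)

/-- The converse direction: if the sum is below the cap, so is each minimum. Both are then attained
at exact states, whose traces realize these costs, and the shifts cancel against `P * W`. -/
theorem tracedSelection_spec {k b₁ b₂ m₁ m₂ x₁ x₂ q₁ q₂ : ℕ}
    (hsort : ∀ u v, u < v → v < n → p u * w v ≤ p v * w u) (hk : k ≤ n)
    (h₁ : (blockDP n K p w r false).IsMin
      (min (∑ i ∈ range n, w i) (∑ i ∈ range n, p i)) k b₁ m₁ x₁ q₁)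
    (h₂ : (blockDP n K p w r true).IsMin
      (min (∑ i ∈ range n, w i) (∑ i ∈ range n, p i)) (n - k) b₂ m₂ x₂ q₂)
    (hlt : m₁ + m₂ + seqCost n p w id <
      K + (∑ i ∈ range n, p i) * (∑ i ∈ range n, w i) + 1) :
    let S := tracedSelection n K p w r k x₁ q₁ x₂ q₂
    (∀ i < n, S i ≤ 1) ∧ (∀ i < n, r i ≠ 0 → S i = 1) ∧ selSum S p n ≤ b₁ + b₂ ∧
      (seqCost n p w id : ℤ) + blockCost n p w S k ≤ K := by
  intro S
  have hcap : ∀ dir, (blockDP n K p w r dir).cap =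
    K + (∑ i ∈ range n, p i) * (∑ i ∈ range n, w i) + 1 := fun _ => rfl
  have hD₁ := blockDP_valid n K r false hsort
  have hD₂ := blockDP_valid n K r true hsort
  obtain ⟨a1, a2, a3, a4⟩ := h₁.attained (by rw [hcap]; omega)
  obtain ⟨c1, c2, c3, c4⟩ := h₂.attained (by rw [hcap]; omega)
  have hP : ∀ dir, (blockDP n K p w r dir).P = ∑ i ∈ range n, p i := fun _ => rfl
  obtain ⟨f1, f2, -, f4⟩ := SelectDP.trace_spec hD₁ k hk x₁ q₁ (fun _ => by rw [hP]; omega)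
    (by rw [hcap]; omega)
  obtain ⟨g1, g2, -, g4⟩ := SelectDP.trace_spec hD₂ (n - k) (Nat.sub_le _ _) x₂ q₂
    (fun _ => by rw [hP]; omega) (by rw [hcap]; omega)
  have hag₁ : ∀ i < k, S i = (blockDP n K p w r false).trace k x₁ q₁ i := fun i hi => by
    simp only [S, tracedSelection, hi, if_true]
  have hag₂ : ∀ i < n - k, revSeq n S i = (blockDP n K p w r true).trace (n - k) x₂ q₂ i :=
    fun i hi => by
      have h1 : ¬ n - 1 - i < k := by omega
      have h2 : n - 1 - (n - 1 - i) = i := by omega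
      simp only [S, revSeq, tracedSelection, h1, if_false, h2]
  have hS : ∀ i < n, S i ≤ 1 := fun i _ => by
    simp only [S, tracedSelection]
    split <;> exact SelectDP.trace_le_one _ _ _ _ _
  rw [SelectDP.shifted_of_exact (by rw [f2]; exact a3)] at f4
  rw [SelectDP.shifted_of_exact (by rw [g2]; exact c3)] at g4
  have q1 : selSum S p k = q₁ := by rw [← f2]; exact selSum_congr hag₁
  have q2 : selSum (revSeq n S) (revSeq n p) (n - k) = q₂ := by
    rw [← g2]; exact selSum_congr hag₂
  refine ⟨hS, fun i hi hri => ?_, ?_, ?_⟩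
  · by_cases h : i < k
    · rw [hag₁ i h]
      exact f1 i h hri
    · have h1 := hag₂ (n - 1 - i) (by omega)
      rw [revSeq_revSeq hi] at h1
      rw [h1]
      refine g1 _ (by omega) ?_
      have : (blockDP n K p w r true).r (n - 1 - i) = r i := revSeq_revSeq hi
      rwa [this]
  · rw [← selSum_add_selSum_revSeq hk, q1, q2]; omega
  · unfold blockCost
    rw [crossCost_congr hag₁, crossCost_congr hag₂]
    simp only [SelectDP.sign, hP] at f4 g4
    have e3 := sum_range_add_sum_revSeq hk w
    have e4 : ((∑ i ∈ range n, w i : ℕ) : ℤ) = (∑ i ∈ range k, w i : ℕ) +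
      (∑ i ∈ range (n - k), revSeq n w i : ℕ) := by exact_mod_cast e3.symm
    have r1 : (blockDP n K p w r false).rev = false := rfl
    have r2 : (blockDP n K p w r true).rev = true := rfl
    have p1 : (blockDP n K p w r false).p = p := rfl
    have p2 : (blockDP n K p w r true).p = revSeq n p := rfl
    have w1 : (blockDP n K p w r false).w = w := rfl
    have w2 : (blockDP n K p w r true).w = revSeq n w := rfl
    rw [r1, p1, w1, a4] at f4
    rw [r2, p2, w2, c4] at g4
    simp only [if_true, Bool.false_eq_true, if_false] at f4 g4
    zify at hlt
    push_cast at e4 f4 g4 hlt ⊢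
    rw [e4] at hlt
    linarith

end

end RentSchedule

/-! ### From sequences to selections with a cut and back -/

namespace RentSchedule

open Finset

/-- The number of elements with a smaller key. -/
def rank {n : ℕ} {L : Type*} [LinearOrder L] (κ : Fin n → L) (j : Fin n) : ℕ := #{i | κ i < κ j}

theorem rank_lt_rank_iff {n : ℕ} {L : Type*} [LinearOrder L] (κ : Fin n → L) (i j : Fin n) :
    rank κ i < rank κ j ↔ κ i < κ j := by
  have key : ∀ i j, κ i ≤ κ j → rank κ i ≤ rank κ j := fun i j h =>
    card_le_card fun l hl => by
      simp only [mem_filter, mem_univ, true_and] at hl ⊢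
      exact hl.trans_le h
  constructor
  · intro h
    by_contra hcon
    exact absurd (key j i (not_lt.1 hcon)) (not_le.2 h)
  · intro h
    refine card_lt_card ⟨fun l hl => ?_, fun hsub => ?_⟩
    · simp only [mem_filter, mem_univ, true_and] at hl ⊢
      exact hl.trans h
    · have := hsub (by simpa using h : i ∈ _)
      simp at this

theorem rank_lt {n : ℕ} {L : Type*} [LinearOrder L] (κ : Fin n → L) (j : Fin n) :
    rank κ j < n := by
  have : rank κ j < #(univ : Finset (Fin n)) :=
    card_lt_card ⟨fun _ _ => mem_univ _, fun hsub => by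
      have := hsub (mem_univ j)
      simp at this⟩
  simpa using this

/-- Distinct keys sort the elements. -/
theorem exists_perm_rank {n : ℕ} {L : Type*} [LinearOrder L] (κ : Fin n → L)
    (hκ : Function.Injective κ) : ∃ e : Equiv.Perm (Fin n), ∀ j, (e j : ℕ) = rank κ j := by
  let f : Fin n → Fin n := fun j => ⟨rank κ j, rank_lt κ j⟩
  have hf : Function.Injective f := by
    intro i j hij
    have h : rank κ i = rank κ j := congrArg Fin.val hij
    have h1 := (rank_lt_rank_iff κ i j).not.1 (by omega)
    have h2 := (rank_lt_rank_iff κ j i).not.1 (by omega)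
    exact hκ (le_antisymm (not_lt.1 h2) (not_lt.1 h1))
  exact ⟨Equiv.ofBijective f (Finite.injective_iff_bijective.1 hf), fun j => rfl⟩

/-- A function on `Fin n`, extended by `0`. -/
def extend {n : ℕ} (f : Fin n → ℕ) (i : ℕ) : ℕ := if h : i < n then f ⟨i, h⟩ else 0

theorem extend_of_lt {n : ℕ} (f : Fin n → ℕ) {i : ℕ} (h : i < n) : extend f i = f ⟨i, h⟩ := by
  simp [extend, h]

@[simp] theorem extend_val {n : ℕ} (f : Fin n → ℕ) (i : Fin n) : extend f i = f i := by
  simp [extend]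

theorem sum_extend {n : ℕ} (f : Fin n → ℕ) (π : Equiv.Perm (Fin n)) :
    ∑ i ∈ range n, extend (fun i => f (π i)) i = ∑ j, f j := by
  rw [← Fin.sum_univ_eq_sum_range]
  simp only [extend_val]
  exact Equiv.sum_comp π f

variable (I : RentInstance) (π σ : Equiv.Perm (Fin I.n))

/-- The processing times in the order `π`. -/
def sortedP : ℕ → ℕ := extend fun i => I.p (π i)

/-- The weights in the order `π`. -/
def sortedW : ℕ → ℕ := extend fun i => I.w (π i)

/-- The indicator of the jobs that require the resource in the order `π`. -/
def sortedR : ℕ → ℕ := extend fun i => if π i ∈ I.Jr then 1 else 0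

/-- The position in `σ` of the `i`-th job in the order `π`. -/
def positionIn : ℕ → ℕ := extend fun i => (σ.symm (π i) : ℕ)

theorem sum_sortedP : ∑ i ∈ range I.n, sortedP I π i = I.P := sum_extend _ _

theorem sum_sortedW : ∑ i ∈ range I.n, sortedW I π i = I.W := sum_extend _ _

theorem completionTime_eq (j : Fin I.n) : I.completionTime σ (π j) =
    ∑ i ∈ range I.n, if positionIn I π σ i ≤ positionIn I π σ j then sortedP I π i else 0 := by
  unfold RentInstance.completionTime
  rw [← Fin.sum_univ_eq_sum_range
    (fun i => if positionIn I π σ i ≤ positionIn I π σ j then sortedP I π i else 0), sum_filter,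
    ← Equiv.sum_comp π]
  exact sum_congr rfl fun i _ => by simp [positionIn, sortedP]

theorem twc_eq_seqCost :
    I.twc σ = seqCost I.n (sortedP I π) (sortedW I π) (positionIn I π σ) := by
  unfold RentInstance.twc seqCost
  rw [← Equiv.sum_comp π, ← Fin.sum_univ_eq_sum_range (fun j => ∑ i ∈ range I.n,
    if positionIn I π σ i ≤ positionIn I π σ j then sortedW I π j * sortedP I π i else 0)]
  refine sum_congr rfl fun j _ => ?_
  rw [completionTime_eq, mul_sum]
  refine sum_congr rfl fun i _ => ?_
  simp [sortedW]

theorem positionIn_inj {i j : ℕ} (hi : i < I.n) (hj : j < I.n)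
    (h : positionIn I π σ i = positionIn I π σ j) : i = j := by
  unfold positionIn at h
  rw [extend_of_lt _ hi, extend_of_lt _ hj] at h
  have := π.injective (σ.symm.injective (Fin.ext h))
  simpa using this

variable {I π σ}

/-- The jobs that are processed during the renting period form a block. -/
theorem exists_block (σ : Equiv.Perm (Fin I.n)) : ∃ S : ℕ → ℕ, (∀ i < I.n, S i ≤ 1) ∧
    (∀ i < I.n, sortedR I π i ≠ 0 → S i = 1) ∧
    selSum S (sortedP I π) I.n ≤ I.er σ ∧
    (∀ v < I.n, S v = 0 →
      (∀ u < I.n, S u = 1 → positionIn I π σ v < positionIn I π σ u) ∨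
      (∀ u < I.n, S u = 1 → positionIn I π σ u < positionIn I π σ v)) := by
  by_cases hne : I.Jr.Nonempty
  · obtain ⟨a, haJ, ha⟩ := exists_min_image I.Jr (fun j => σ.symm j) hne
    obtain ⟨b, hbJ, hb⟩ := exists_max_image I.Jr (fun j => σ.symm j) hne
    obtain ⟨a, rfl⟩ := π.surjective a
    obtain ⟨b, rfl⟩ := π.surjective b
    set q := positionIn I π σ with hq
    have hqa : ∀ i : Fin I.n, q i = (σ.symm (π i) : ℕ) := fun i => by simp [hq, positionIn]
    refine ⟨fun i => if q a ≤ q i ∧ q i ≤ q b then 1 else 0, fun i _ => ?_, fun i hi hr => ?_, ?_,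
      fun v _ h0 => ?_⟩
    · dsimp only; split <;> simp
    · have hmem : π ⟨i, hi⟩ ∈ I.Jr := by
        unfold sortedR at hr
        rw [extend_of_lt _ hi] at hr
        by_contra hcon
        simp [hcon] at hr
      have h1 := ha _ hmem
      have h2 := hb _ hmem
      have h3 := hqa ⟨i, hi⟩
      simp only at h3
      refine if_pos ?_
      rw [hqa, hqa, h3]
      exact ⟨h1, h2⟩
    · rw [RentInstance.er, dif_pos hne]
      have h1 : I.completionTime σ (π b) ≤ I.Jr.sup' hne (I.completionTime σ) :=
        le_sup' _ hbJ
      have h2 : I.Jr.inf' hne (fun j => I.completionTime σ j - I.p j) ≤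
          I.completionTime σ (π a) - I.p (π a) := inf'_le _ haJ
      -- The processing time of the block is the completion time of `b` minus the start time of `a`,
      -- stated without subtraction and proved summand by summand.
      have h3 : selSum (fun i => if q a ≤ q i ∧ q i ≤ q b then 1 else 0) (sortedP I π) I.n +
          I.completionTime σ (π a) ≤ I.completionTime σ (π b) + I.p (π a) := by
        have e : I.p (π a) = ∑ i ∈ range I.n, if i = (a : ℕ) then sortedP I π i else 0 := by
          rw [sum_ite_eq' (range I.n), if_pos (mem_range.2 a.2)]; simp [sortedP]
        rw [e, completionTime_eq, completionTime_eq, selSum, ← sum_add_distrib, ← sum_add_distrib]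
        refine sum_le_sum fun i hi => ?_
        have hab : q a ≤ q b := by
          rw [hqa, hqa]; exact ha _ hbJ
        have hinj : q i = q a → i = a := fun h => positionIn_inj I π σ (mem_range.1 hi) a.2 h
        simp only [← hq]
        rcases lt_trichotomy (q i) (q a) with h | h | h
        · simp [h.not_ge, h.le, (h.le.trans hab)]
        · have := hinj h
          subst this
          simp [hab]
        · by_cases hib : q i ≤ q b
          · simp [h.le, h.not_ge, hib]
          · simp [hib, h.not_ge]
      have h4 : I.p (π a) ≤ I.completionTime σ (π a) :=
        single_le_sum (f := I.p) (fun _ _ => Nat.zero_le _) (by simp)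
      omega
    · have h0' : ¬ (q a ≤ q v ∧ q v ≤ q b) := by
        intro h; simp [h] at h0
      have key : ∀ u, (if q a ≤ q u ∧ q u ≤ q b then 1 else 0) = 1 → q a ≤ q u ∧ q u ≤ q b := by
        intro u hu
        by_contra hcon
        simp [hcon] at hu
      rcases Nat.lt_or_ge (q v) (q a) with h | h
      · exact .inl fun u _ hu => h.trans_le (key u hu).1
      · exact .inr fun u _ hu => (key u hu).2.trans_lt (by omega)
  · refine ⟨fun _ => 0, by simp, fun i hi hr => ?_, by simp [selSum], by simp⟩
    unfold sortedR at hr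
    rw [extend_of_lt _ hi] at hr
    by_cases hmem : π ⟨i, hi⟩ ∈ I.Jr
    · exact absurd ⟨_, hmem⟩ hne
    · simp [hmem] at hr

/-- With `A` the total processing time of class `0`, no job of class `1` starts before `A` or
completes after `A` plus the selected time. -/
theorem er_le_of_blockClass {S : ℕ → ℕ} {k : ℕ} (hS : ∀ i < I.n, S i ≤ 1)
    (hr : ∀ i < I.n, sortedR I π i ≠ 0 → S i = 1)
    (hq : ∀ i < I.n, ∀ j < I.n, (positionIn I π σ i < positionIn I π σ j ↔
      blockClass S k i < blockClass S k j ∨ blockClass S k i = blockClass S k j ∧ i < j)) :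
    I.er σ ≤ selSum S (sortedP I π) I.n := by
  unfold RentInstance.er
  split
  · rename_i hne
    set q := positionIn I π σ with hqdef
    set A := ∑ i ∈ range I.n, if blockClass S k i = 0 then sortedP I π i else 0 with hA
    have hcl : ∀ j : Fin I.n, π j ∈ I.Jr → blockClass S k j = 1 := fun j hj => by
      have := hr j j.2 (by simp [sortedR, hj])
      simp [blockClass, this]
    have hup : I.Jr.sup' hne (I.completionTime σ) ≤ A + selSum S (sortedP I π) I.n := by
      refine sup'_le _ _ fun j hj => ?_
      obtain ⟨j, rfl⟩ := π.surjective j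
      have hj1 := hcl j hj
      rw [completionTime_eq, hA, selSum, ← sum_add_distrib]
      refine sum_le_sum fun i hi => ?_
      have hi := mem_range.1 hi
      by_cases hij : q i ≤ q j
      · have h1 := (hq j j.2 i hi).not.1 (by omega)
        rw [hj1] at h1
        rw [if_pos hij]
        have hSi := hS i hi
        rcases (by omega : S i = 0 ∨ S i = 1) with h0 | h2
        · have : blockClass S k i = 0 := by
            unfold blockClass at h1 ⊢
            rw [h0] at h1 ⊢
            split_ifs with hk
            · rfl
            · simp [hk] at h1
          simp [this]
        · simp [h2]
      · rw [if_neg hij]; exact Nat.zero_le _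
    have hlow : A ≤ I.Jr.inf' hne (fun j => I.completionTime σ j - I.p j) := by
      refine le_inf' _ _ fun j hj => ?_
      obtain ⟨j, rfl⟩ := π.surjective j
      have hj1 := hcl j hj
      refine Nat.le_sub_of_add_le ?_
      have e : I.p (π j) = ∑ i ∈ range I.n, if i = (j : ℕ) then sortedP I π i else 0 := by
        rw [sum_ite_eq' (range I.n), if_pos (mem_range.2 j.2)]; simp [sortedP]
      rw [e, completionTime_eq, hA, ← sum_add_distrib]
      refine sum_le_sum fun i hi => ?_
      by_cases h0 : blockClass S k i = 0
      · have h1 : q i < q j := (hq i (mem_range.1 hi) j j.2).2 (.inl (by omega))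
        have h2 : i ≠ j := by rintro rfl; omega
        simp [← hqdef, h0, h1.le, h2]
      · by_cases h2 : i = j
        · subst h2; simp [h0]
        · simp [h0, h2]
    omega
  · exact Nat.zero_le _

/-- The key by which the jobs are sorted: decreasing ratios of weight and processing time. -/
def ratioKey (I : RentInstance) (j : Fin I.n) : ℚ ×ₗ Fin I.n :=
  toLex (-((I.w j : ℚ) / I.p j), j)

theorem ratioKey_injective (I : RentInstance) : Function.Injective (ratioKey I) := fun i j h => by
  have := congrArg (fun x => (ofLex x).2) h
  exact this

/-- Cross multiplication gives a comparison in natural numbers that the machine can evaluate; ties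
are broken by the index. -/
theorem ratioKey_lt_iff (hp : ∀ j, 0 < I.p j) (i j : Fin I.n) : ratioKey I i < ratioKey I j ↔
    I.w j * I.p i < I.w i * I.p j ∨ ¬ I.w i * I.p j < I.w j * I.p i ∧ i < j := by
  have hi : (0 : ℚ) < I.p i := by exact_mod_cast hp i
  have hj : (0 : ℚ) < I.p j := by exact_mod_cast hp j
  have key : ∀ a b : Fin I.n, (0 : ℚ) < I.p a → (0 : ℚ) < I.p b →
      ((-((I.w a : ℚ) / I.p a) < -((I.w b : ℚ) / I.p b)) ↔ I.w b * I.p a < I.w a * I.p b) := by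
    intro a b ha hb
    rw [neg_lt_neg_iff, div_lt_div_iff₀ hb ha]
    exact_mod_cast Iff.rfl
  unfold ratioKey
  rw [Prod.Lex.toLex_lt_toLex]
  simp only
  rw [key i j hi hj]
  constructor
  · rintro (h | ⟨h1, h2⟩)
    · exact .inl h
    · refine .inr ⟨fun h => ?_, h2⟩
      exact absurd h1 (ne_of_gt ((key j i hj hi).2 h))
  · rintro (h | ⟨h1, h2⟩)
    · exact .inl h
    · by_cases h3 : I.w j * I.p i < I.w i * I.p j
      · exact .inl h3
      · refine .inr ⟨le_antisymm (not_lt.1 fun h => h1 ((key j i hj hi).1 h))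
          (not_lt.1 fun h => h3 ((key i j hi hj).1 h)), h2⟩

/-- The order `π` lists the jobs by increasing `ratioKey`. -/
def IsSorted (I : RentInstance) (π : Equiv.Perm (Fin I.n)) : Prop :=
  ∀ j, (π.symm j : ℕ) = rank (ratioKey I) j

theorem exists_isSorted (I : RentInstance) : ∃ π, IsSorted I π := by
  obtain ⟨e, he⟩ := exists_perm_rank (ratioKey I) (ratioKey_injective I)
  exact ⟨e.symm, he⟩

theorem IsSorted.mul_le_mul (h : IsSorted I π) (hp : ∀ j, 0 < I.p j) (u v : ℕ) (huv : u < v)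
    (hv : v < I.n) : sortedP I π u * sortedW I π v ≤ sortedP I π v * sortedW I π u := by
  have hu : u < I.n := huv.trans hv
  have h1 : rank (ratioKey I) (π ⟨u, hu⟩) < rank (ratioKey I) (π ⟨v, hv⟩) := by
    rw [← h, ← h]; simpa using huv
  rw [rank_lt_rank_iff, ratioKey_lt_iff hp] at h1
  unfold sortedP sortedW
  rw [extend_of_lt _ hu, extend_of_lt _ hv, extend_of_lt _ hu, extend_of_lt _ hv,
    mul_comm, mul_comm (I.p _)]
  rcases h1 with h1 | ⟨h1, -⟩
  · exact h1.le
  · exact not_lt.1 h1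

/-- The key by which the jobs are arranged in the end. -/
def classKey {n : ℕ} (cls : ℕ → ℕ) (i : Fin n) : ℕ ×ₗ Fin n := toLex (cls i, i)

theorem classKey_injective {n : ℕ} (cls : ℕ → ℕ) :
    Function.Injective (classKey cls : Fin n → ℕ ×ₗ Fin n) := fun i j h => by
  have := congrArg (fun x => (ofLex x).2) h
  exact this

theorem classKey_lt_iff {n : ℕ} (cls : ℕ → ℕ) (i j : Fin n) :
    classKey cls i < classKey cls j ↔ cls i < cls j ∨ cls i = cls j ∧ i < j := by
  unfold classKey
  rw [Prod.Lex.toLex_lt_toLex]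

/-- Every sequence within the budget is dominated by a selection and a cut. -/
theorem exists_selection_of_twc_le (hp : ∀ j, 0 < I.p j) (hπ : IsSorted I π)
    (hσ : I.twc σ ≤ I.K) : ∃ (S : ℕ → ℕ) (k : ℕ), k ≤ I.n ∧ (∀ i < I.n, S i ≤ 1) ∧
      (∀ i < I.n, sortedR I π i ≠ 0 → S i = 1) ∧ selSum S (sortedP I π) I.n ≤ I.er σ ∧
      (seqCost I.n (sortedP I π) (sortedW I π) id : ℤ) +
        blockCost I.n (sortedP I π) (sortedW I π) S k ≤ I.K := by
  obtain ⟨S, h1, h2, h3, h4⟩ := exists_block (π := π) σ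
  obtain ⟨k, hk, hle⟩ := exists_blockCost_le (p := sortedP I π) (w := sortedW I π)
    (q := positionIn I π σ) (n := I.n)
    (fun i hi => by unfold sortedP; rw [extend_of_lt _ hi]; exact hp _)
    (hπ.mul_le_mul hp) h1 h4
  refine ⟨S, k, hk, h1, h2, h3, ?_⟩
  have h5 := seqCost_eq (n := I.n) (sortedP I π) (sortedW I π) (q := positionIn I π σ)
    fun i hi j hj h => positionIn_inj I π σ hi hj h
  rw [← twc_eq_seqCost] at h5
  have : (I.twc σ : ℤ) ≤ I.K := by exact_mod_cast hσ
  linarith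

/-- A selection and a cut within the budget yield a sequence within the budget. -/
theorem twc_le_and_er_le {S cls : ℕ → ℕ} {k : ℕ} (hk : k ≤ I.n) (hS : ∀ i < I.n, S i ≤ 1)
    (hr : ∀ i < I.n, sortedR I π i ≠ 0 → S i = 1)
    (hcost : (seqCost I.n (sortedP I π) (sortedW I π) id : ℤ) +
        blockCost I.n (sortedP I π) (sortedW I π) S k ≤ I.K)
    (hcls : ∀ i < I.n, cls i = blockClass S k i) {e : Equiv.Perm (Fin I.n)}
    (he : ∀ j, (e j : ℕ) = rank (classKey cls) j) :
    I.twc (e.symm.trans π) ≤ I.K ∧ I.er (e.symm.trans π) ≤ selSum S (sortedP I π) I.n := by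
  have hpos : ∀ i (hi : i < I.n), positionIn I π (e.symm.trans π) i = e ⟨i, hi⟩ := fun i hi => by
    unfold positionIn
    rw [extend_of_lt _ hi]
    simp
  have hq : ∀ i < I.n, ∀ j < I.n, (positionIn I π (e.symm.trans π) i <
      positionIn I π (e.symm.trans π) j ↔
      blockClass S k i < blockClass S k j ∨ blockClass S k i = blockClass S k j ∧ i < j) := by
    intro i hi j hj
    rw [hpos i hi, hpos j hj, he, he, rank_lt_rank_iff, classKey_lt_iff]
    simp only [hcls i hi, hcls j hj, Fin.mk_lt_mk]
  refine ⟨?_, er_le_of_blockClass hS hr hq⟩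
  have h5 := seqCost_eq (n := I.n) (sortedP I π) (sortedW I π)
    (q := positionIn I π (e.symm.trans π)) fun i hi j hj h => positionIn_inj I π _ hi hj h
  rw [← twc_eq_seqCost, inversionCost_of_blockClass hk _ _ hS hq] at h5
  have : (I.twc (e.symm.trans π) : ℤ) ≤ I.K := by linarith
  exact_mod_cast this

end RentSchedule

/-! ### Registers, arrays and reading the input -/

namespace RentSchedule

open Finset WordRAM

notation "ρOff" => (1 : ℕ)
notation "ρN" => (2 : ℕ)
notation "ρK" => (3 : ℕ)
notation "ρP" => (4 : ℕ)
notation "ρW" => (5 : ℕ)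
notation "ρM" => (6 : ℕ)
notation "ρMu" => (7 : ℕ)
notation "ρCap" => (8 : ℕ)
notation "ρBase" => (9 : ℕ)
notation "ρI" => (10 : ℕ)
notation "ρJ" => (11 : ℕ)
notation "ρRank" => (12 : ℕ)
notation "ρTime" => (13 : ℕ)

notation "αOrd" => (0 : ℕ)
notation "αP" => (1 : ℕ)
notation "αW" => (2 : ℕ)
notation "αR" => (3 : ℕ)
notation "αCls" => (4 : ℕ)

/-- The bound has the same product form as the hypothesis on the body, so nested loops only add to
the constant. -/
theorem forTime_le_mul {e : HExp} {N T c X : ℕ} (he : e.compile.cost ≤ 10) (hX : 1 ≤ X)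
    (hT : T ≤ c * X) : forTime e N T ≤ (c + 18) * ((N + 1) * X) := by
  unfold forTime
  obtain ⟨Y, rfl⟩ := Nat.exists_eq_add_of_le hX
  have h1 := Nat.mul_le_mul_left N hT
  have h0 := Nat.mul_le_mul_left N he
  have h2 : (c + 18) * ((N + 1) * (1 + Y)) =
    N * 18 + 18 + N * (c * (1 + Y)) + c * (1 + Y) + 18 * ((N + 1) * Y) := by ring
  have h3 : N * (e.compile.cost + T + 8) = N * e.compile.cost + N * T + N * 8 := by ring
  omega

theorem of_wp_le {V T : ℕ} {c : Cmd} {h : HState} {Q : HState → Prop} (hV : 2 ≤ V)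
    (H : c.wp V Q h) (hT : c.time ≤ T) : HRuns V c h T Q :=
  (HRuns.of_wp hV H).mono hT fun _ _ h => h

/-- An instance whose numbers fit into words up to `V`. -/
structure FitsIn (I : RentInstance) (V : ℕ) : Prop where
  two_le : 2 ≤ V
  n_le : I.n + 1 ≤ V
  K_le : I.K ≤ V
  P_le : I.P + 1 ≤ V
  W_le : I.W ≤ V
  cap_le : I.K + I.P * I.W + 1 ≤ V

/-- The array number `t` of the state `h` lists the first `n` values of `f`. -/
def Lists (h : HState) (t n : ℕ) (f : ℕ → ℕ) : Prop := ∀ i < n, h.arr t i 0 0 = f i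

theorem Lists.congr {h h' : HState} {t n : ℕ} {f : ℕ → ℕ} (H : Lists h t n f)
    (e : h'.arr t = h.arr t) : Lists h' t n f := fun i hi => by rw [e]; exact H i hi

/-- The low memory holds the input. -/
structure HasInput (I : RentInstance) (h : HState) : Prop where
  off : h.reg ρOff = 3 * I.n + 2
  n : h.low 0 = I.n
  K : h.low 1 = I.K
  p : ∀ j : Fin I.n, h.low (3 * j + 2) = I.p j
  w : ∀ j : Fin I.n, h.low (3 * j + 3) = I.w j
  r : ∀ j : Fin I.n, h.low (3 * j + 4) = if j ∈ I.Jr then 1 else 0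

/-- The parameters of the instance are in the registers. -/
structure HasParams (I : RentInstance) (h : HState) : Prop where
  off : h.reg ρOff = 3 * I.n + 2
  n : h.reg ρN = I.n
  K : h.reg ρK = I.K
  P : h.reg ρP = I.P
  W : h.reg ρW = I.W
  M : h.reg ρM = min I.W I.P
  mu : h.reg ρMu = if I.W < I.P then 1 else 0
  cap : h.reg ρCap = I.K + I.P * I.W + 1

theorem HasParams.congr {I : RentInstance} {h h' : HState} (H : HasParams I h)
    (e : ∀ r, 1 ≤ r → r ≤ 8 → h'.reg r = h.reg r) : HasParams I h' where
  off := by rw [e _ (by norm_num) (by norm_num), H.off]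
  n := by rw [e _ (by norm_num) (by norm_num), H.n]
  K := by rw [e _ (by norm_num) (by norm_num), H.K]
  P := by rw [e _ (by norm_num) (by norm_num), H.P]
  W := by rw [e _ (by norm_num) (by norm_num), H.W]
  M := by rw [e _ (by norm_num) (by norm_num), H.M]
  mu := by rw [e _ (by norm_num) (by norm_num), H.mu]
  cap := by rw [e _ (by norm_num) (by norm_num), H.cap]

/-- `low (3 * x + k)` for the value `x` of a register. -/
def lowExp (x k : ℕ) : HExp := .low (.add (.mul (.const 3) (.var x)) (.const k))

/-- Read the parameters of the instance. -/
def readCmd : Cmd :=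
  .seq (.seq (.assign ρN (.low (.const 0))) (.assign ρK (.low (.const 1)))) <|
  .seq (.seq (.assign ρP (.const 0)) (.assign ρW (.const 0))) <|
  .seq (.forLoop ρJ (.var ρN) (.seq
    (.assign ρP (.add (.var ρP) (lowExp ρJ 2)))
    (.assign ρW (.add (.var ρW) (lowExp ρJ 3))))) <|
  .seq (.assign ρMu (.lt (.var ρW) (.var ρP))) <|
  -- The minimum is formed without a branch from the result of the comparison `W < P`.
  .seq (.assign ρM (.add (.mul (.var ρMu) (.var ρW))
    (.mul (.sub (.const 1) (.var ρMu)) (.var ρP)))) <|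
  .assign ρCap (.add (.add (.var ρK) (.mul (.var ρP) (.var ρW))) (.const 1))

theorem readCmd_runs {I : RentInstance} {V : ℕ} {h : HState} (hV : FitsIn I V)
    (hI : HasInput I h) : HRuns V readCmd h (1000 * (I.n + 1)) (HasParams I) := by
  have hp : ∀ k ≤ I.n, ∑ i ∈ range k, extend I.p i ≤ I.P := fun k hk =>
    (sum_le_sum_of_subset (range_subset_range.2 hk)).trans (sum_extend I.p 1).le
  have hw : ∀ k ≤ I.n, ∑ i ∈ range k, extend I.w i ≤ I.W := fun k hk =>
    (sum_le_sum_of_subset (range_subset_range.2 hk)).trans (sum_extend I.w 1).le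
  have ⟨v1, v2, v3, v4, v5, v6⟩ := hV
  refine HRuns.mono (.seq ((of_wp_le (T := 50) v1
    (Q := fun h' => HasInput I h' ∧ h'.reg ρN = I.n ∧ h'.reg ρK = I.K) ?_ (by decide)).mono le_rfl
      fun h1 _ ⟨i1, n1, k1⟩ => .seq ((of_wp_le (T := 50) v1
    (Q := fun h' => HasInput I h' ∧ h'.reg ρN = I.n ∧ h'.reg ρK = I.K ∧
      h'.reg ρP = 0 ∧ h'.reg ρW = 0) ?_ (by decide)).mono le_rfl
      fun h2 _ ⟨i2, n2, k2, p2, w2⟩ => .seq ((HRuns.forLoop v1 I.n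
      (fun k h' => h'.reg ρP = ∑ i ∈ range k, extend I.p i ∧
        h'.reg ρW = ∑ i ∈ range k, extend I.w i) (T := 50)
      (Q := fun h' => h'.reg ρP = I.P ∧ h'.reg ρW = I.W)
      (by norm_num) rfl (by omega) ?_ ?_ ?_ ?_).mono
        (forTime_le_mul (c := 50) (X := 1) (by decide) le_rfl le_rfl)
      fun h3 f3 ⟨p3, w3⟩ => of_wp_le (T := 100) v1 ?_ (by decide))))) (by omega) (fun _ _ h => h)
  · have ⟨a1, a2, a3, a4, a5, a6⟩ := hI
    simp [a1, a2, a3]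
    exact ⟨by omega, by omega, ⟨by simpa using a1, a2, a3, a4, a5, a6⟩⟩
  · have ⟨a1, a2, a3, a4, a5, a6⟩ := i1
    simp [n1, k1]
    exact ⟨by simpa using a1, a2, a3, a4, a5, a6⟩
  · intro h' e
    exact ⟨trivial, by rw [← n2]; exact e ρN (by norm_num) rfl⟩
  · simp [p2, w2]
  · rintro k hk h' f e ⟨e1, e2⟩
    refine of_wp_le hV.two_le ?_ (by decide)
    have el := f.low rfl
    have eo : h'.reg 1 = 3 * I.n + 2 := (f.reg 1 rfl).trans i2.off
    have b1 := hp (k + 1) hk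
    have b2 := hw (k + 1) hk
    have c1 := i2.p ⟨k, hk⟩
    have c2 := i2.w ⟨k, hk⟩
    simp only at c1 c2
    rw [sum_range_succ, extend_of_lt _ hk] at b1 b2
    simp [lowExp, eo, e1, e2, e, el, c1, c2, sum_range_succ, extend_of_lt _ hk]
    omega
  · rintro h' f ⟨e1, e2⟩
    exact ⟨e1.trans (sum_extend I.p 1), e2.trans (sum_extend I.w 1)⟩
  · have ea : h3.reg 2 = I.n := (f3.reg 2 rfl).trans n2
    have eb : h3.reg 3 = I.K := (f3.reg 3 rfl).trans k2
    have ec : h3.reg 1 = 3 * I.n + 2 := (f3.reg 1 rfl).trans i2.off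
    by_cases hlt : I.W < I.P
    · simp [p3, w3, eb, hlt]
      refine ⟨by omega, by omega, by omega, ?_⟩
      constructor <;> simp [p3, w3, ea, eb, ec, hlt, hlt.le]
    · simp [p3, w3, eb, hlt]
      refine ⟨by omega, by omega, ?_⟩
      constructor <;> simp [p3, w3, ea, eb, ec, hlt, not_lt.1 hlt]

end RentSchedule

/-! ### Sorting by ranks -/

namespace RentSchedule

open Finset WordRAM

/-- Count the indices `i` that satisfy the condition `e`. -/
def rankCmd (e : HExp) : Cmd :=
  .seq (.assign ρRank (.const 0))
    (.forLoop ρI (.var ρN) (.assign ρRank (.add (.var ρRank) (.lt (.const 0) e))))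

/-- The comparison is a parameter, because the same loop serves the initial sorting by ratios and
the final arrangement by classes. -/
theorem rankCmd_runs {V n : ℕ} {L : Type*} [LinearOrder L] {e : HExp} {h : HState}
    (κ : Fin n → L) (j : Fin n) (hV : 2 ≤ V) (hnV : n ≤ V) (hn : h.reg ρN = n)
    (ht : (Cmd.assign ρRank (.add (.var ρRank) (.lt (.const 0) e))).time ≤ 1000)
    (he : ∀ h', (∀ r, r ≠ ρI → r ≠ ρRank → h'.reg r = h.reg r) → h'.arr = h.arr →
      h'.low = h.low → ∀ i : Fin n, h'.reg ρI = (i : ℕ) → e.Safe h' ∧ (0 < e.eval h' ↔ κ i < κ j)) :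
    HRuns V (rankCmd e) h (2000 * (n + 1)) (fun h' => h'.reg ρRank = rank κ j) := by
  set F : ℕ → ℕ := extend fun i => if κ i < κ j then 1 else 0 with hF
  have hrank : ∑ i ∈ range n, F i = rank κ j := by
    rw [rank, card_filter]
    exact sum_extend (fun i => if κ i < κ j then 1 else 0) 1
  have hle : ∀ k ≤ n, ∑ i ∈ range k, F i ≤ n := fun k hk =>
    ((sum_le_sum_of_subset (range_subset_range.2 hk)).trans hrank.le).trans (rank_lt κ j).le
  refine HRuns.mono (.seq ((of_wp_le (T := 50) (Q := fun h' => h' = h.setReg ρRank 0) hV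
    (by simp) (by decide)).mono le_rfl fun h1 _ e1 =>
    (HRuns.forLoop hV n (fun k h' => h'.reg ρRank = ∑ i ∈ range k, F i) (T := 1000)
      (Q := fun h' => h'.reg ρRank = rank κ j) (by norm_num) rfl hnV ?_ ?_ ?_ ?_).mono
        (forTime_le_mul (c := 1000) (X := 1) (by decide) le_rfl (by simp)) fun _ _ h => h))
    (by omega) fun _ _ h => h
  · intro h' f
    exact ⟨trivial, by rw [← hn]; simpa [e1] using f ρN (by norm_num) rfl⟩
  · simp [e1]
  · intro k hk h' f hi hr
    subst e1
    have := he h' (fun r h1 h2 => by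
      simpa [h2] using f.reg r (by simp [Cmd.forLoop, Cmd.writes, h1.symm, h2.symm]))
      (funext fun t => by simpa using f.arr t rfl) (by simpa using f.low rfl) ⟨k, hk⟩ hi
    refine of_wp_le hV ?_ ht
    have b := hle (k + 1) hk
    rw [sum_range_succ] at b
    have hFk : F k = if 0 < e.eval h' then 1 else 0 := by
      rw [hF, extend_of_lt _ hk]
      exact if_congr this.2.symm rfl rfl
    rw [hFk] at b
    simp [hr, sum_range_succ, hFk, this.1]
    exact ⟨b.trans hnV, rfl⟩
  · intro h' _ hr
    rw [hr, hrank]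

/-- Job `i` precedes job `j` in the order of decreasing ratios of weight and processing time. -/
def ratioExp : HExp :=
  .add (.lt (.mul (lowExp ρJ 3) (lowExp ρI 2)) (.mul (lowExp ρI 3) (lowExp ρJ 2)))
    (.mul (.sub (.const 1) (.lt (.mul (lowExp ρI 3) (lowExp ρJ 2))
      (.mul (lowExp ρJ 3) (lowExp ρI 2)))) (.lt (.var ρI) (.var ρJ)))

/-- Sort the jobs by decreasing ratios of weight and processing time. -/
def sortCmd : Cmd :=
  .forLoop ρJ (.var ρN) <| .seq (rankCmd ratioExp) <|
    .seq (.put αOrd (.var ρRank) (.const 0) (.const 0) (.var ρJ)) <|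
    .seq (.put αP (.var ρRank) (.const 0) (.const 0) (lowExp ρJ 2)) <|
    .seq (.put αW (.var ρRank) (.const 0) (.const 0) (lowExp ρJ 3)) <|
    .put αR (.var ρRank) (.const 0) (.const 0) (lowExp ρJ 4)

/-- The arrays hold the jobs in the order `π`. -/
structure HasSorted (I : RentInstance) (π : Equiv.Perm (Fin I.n)) (h : HState) : Prop where
  ord : Lists h αOrd I.n (extend fun i => (π i : ℕ))
  p : Lists h αP I.n (sortedP I π)
  w : Lists h αW I.n (sortedW I π)
  r : Lists h αR I.n (sortedR I π)

theorem HasSorted.congr {I : RentInstance} {π : Equiv.Perm (Fin I.n)} {h h' : HState}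
    (H : HasSorted I π h) (e : ∀ t ≤ 3, h'.arr t = h.arr t) : HasSorted I π h' :=
  ⟨H.ord.congr (e _ (by norm_num)), H.p.congr (e _ (by norm_num)), H.w.congr (e _ (by norm_num)),
    H.r.congr (e _ (by norm_num))⟩

theorem p_le_P (I : RentInstance) (j : Fin I.n) : I.p j ≤ I.P :=
  single_le_sum (f := I.p) (fun _ _ => Nat.zero_le _) (mem_univ j)

theorem w_le_W (I : RentInstance) (j : Fin I.n) : I.w j ≤ I.W :=
  single_le_sum (f := I.w) (fun _ _ => Nat.zero_le _) (mem_univ j)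

theorem sortCmd_runs {I : RentInstance} {V : ℕ} {h : HState} (hp : ∀ j, 0 < I.p j)
    {π : Equiv.Perm (Fin I.n)} (hπ : IsSorted I π) (hV : FitsIn I V)
    (hI : HasInput I h) (hn : h.reg ρN = I.n) :
    HRuns V sortCmd h (10018 * ((I.n + 1) * (I.n + 1))) (HasSorted I π) := by
  have ⟨v1, v2, v3, v4, v5, v6⟩ := hV
  refine (HRuns.forLoop v1 I.n (fun k h' => ∀ j : Fin I.n, (j : ℕ) < k →
    h'.arr αOrd (rank (ratioKey I) j) 0 0 = j ∧ h'.arr αP (rank (ratioKey I) j) 0 0 = I.p j ∧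
    h'.arr αW (rank (ratioKey I) j) 0 0 = I.w j ∧
    h'.arr αR (rank (ratioKey I) j) 0 0 = if j ∈ I.Jr then 1 else 0)
    (T := 2000 * (I.n + 1) + 8000) (by norm_num) rfl (by omega) ?_ (by simp) ?_ ?_).mono
    (forTime_le_mul (c := 10000) (X := I.n + 1) (by decide) (by omega) (by omega)) fun _ _ h => h
  · intro h' f
    exact ⟨trivial, by rw [← hn]; exact f ρN (by norm_num) rfl⟩
  · intro k hk h' f hj hinv
    have el : h'.low = h.low := f.low rfl
    have eo : h'.reg ρOff = 3 * I.n + 2 := (f.reg ρOff rfl).trans hI.off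
    refine .seq ((rankCmd_runs (ratioKey I) ⟨k, hk⟩ v1 (by omega) ((f.reg ρN rfl).trans hn)
      (by decide) ?_).mono le_rfl fun h1 f1 e1 => of_wp_le v1 ?_ (by decide))
    · intro h1 e1 e2 e3 i hi
      have hj1 : h1.reg 11 = k := (e1 11 (by norm_num) (by norm_num)).trans hj
      have ho1 : h1.reg 1 = 3 * I.n + 2 := (e1 1 (by norm_num) (by norm_num)).trans eo
      have c1 := hI.p i
      have c2 := hI.w i
      have c3 := hI.p ⟨k, hk⟩
      have c4 := hI.w ⟨k, hk⟩
      have hi' := i.2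
      simp only at c3 c4
      rw [ratioKey_lt_iff hp]
      constructor
      · simp [ratioExp, lowExp, hj1, ho1, hi]; omega
      · simp only [ratioExp, lowExp, HExp.eval, hj1, hi, e3, el, c1, c2, c3, c4]
        rw [Fin.lt_def]
        split_ifs with g1 g2 g3 <;> simp_all
    · have hj1 : h1.reg 11 = k := (f1.reg 11 rfl).trans hj
      have ho1 : h1.reg 1 = 3 * I.n + 2 := (f1.reg 1 rfl).trans eo
      have el1 : h1.low = h.low := (f1.low rfl).trans el
      have c1 := hI.p ⟨k, hk⟩
      have c2 := hI.w ⟨k, hk⟩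
      have c3 := hI.r ⟨k, hk⟩
      have d1 := p_le_P I ⟨k, hk⟩
      have d2 := w_le_W I ⟨k, hk⟩
      have d3 : (if (⟨k, hk⟩ : Fin I.n) ∈ I.Jr then 1 else 0) ≤ V := by split <;> omega
      have hr := rank_lt (ratioKey I) ⟨k, hk⟩
      simp only at c1 c2 c3
      simp only [lowExp, Cmd.wp, HExp.eval, HExp.Safe, hj1, ho1, el1, c1, c2, c3, e1,
        HState.reg_setArr, HState.low_setArr, HState.arr_setArr, HState.arr_setReg]
      refine ⟨trivial, trivial, trivial, trivial, by omega, trivial, trivial, trivial,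
        by simp; omega, by omega, trivial, trivial, trivial, by simp; omega, by omega, trivial,
        trivial, trivial, by simp; omega, d3, fun j hjk => ?_⟩
      by_cases hjk' : (j : ℕ) = k
      · subst hjk'
        simp
      · have hlt : (j : ℕ) < k := by omega
        -- Different jobs have different ranks, so earlier entries are not overwritten.
        have hne : rank (ratioKey I) j ≠ rank (ratioKey I) ⟨k, hk⟩ := by
          rw [← hπ, ← hπ]
          intro he
          have := π.symm.injective (Fin.ext he)
          exact hjk' (congrArg Fin.val this)
        have := hinv j hlt
        simp [hne, f1.arr _ rfl, this]
  · intro h' f hinv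
    have key : ∀ i (hi : i < I.n), rank (ratioKey I) (π ⟨i, hi⟩) = i := fun i hi => by
      rw [← hπ]; simp
    refine ⟨fun i hi => ?_, fun i hi => ?_, fun i hi => ?_, fun i hi => ?_⟩
    all_goals
      have := hinv (π ⟨i, hi⟩) (Fin.is_lt _)
      rw [key i hi] at this
      obtain ⟨g1, g2, g3, g4⟩ := this
    · rw [g1, extend_of_lt _ hi]
    · rw [g2, sortedP, extend_of_lt _ hi]
    · rw [g3, sortedW, extend_of_lt _ hi]
    · rw [g4, sortedR, extend_of_lt _ hi]

/-- The entry of a list with index in a register. -/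
def entry (t x : ℕ) : HExp := .cell t (.var x) (.const 0) (.const 0)

/-- Compute the total weighted completion time of the sorted sequence. -/
def baseCmd : Cmd :=
  .seq (.seq (.assign ρTime (.const 0)) (.assign ρBase (.const 0))) <|
  .forLoop ρI (.var ρN) <| .seq (.assign ρTime (.add (.var ρTime) (entry αP ρI)))
    (.assign ρBase (.add (.var ρBase) (.mul (entry αW ρI) (.var ρTime))))

theorem baseCmd_runs {n V : ℕ} {p w : ℕ → ℕ} {h : HState} (hV : 2 ≤ V) (hnV : n ≤ V)
    (hpV : ∑ i ∈ range n, p i ≤ V) (hb : (∑ i ∈ range n, p i) * (∑ i ∈ range n, w i) ≤ V)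
    (hn : h.reg ρN = n) (hp : Lists h αP n p) (hw : Lists h αW n w) :
    HRuns V baseCmd h (3000 * (n + 1)) (fun h' => h'.reg ρBase = seqCost n p w id) := by
  have hP : ∀ k ≤ n, ∑ i ∈ range k, p i ≤ ∑ i ∈ range n, p i := fun k hk =>
    sum_le_sum_of_subset (range_subset_range.2 hk)
  have hB : ∀ k ≤ n, ∑ j ∈ range k, w j * ∑ i ∈ range (j + 1), p i ≤ V := fun k hk => by
    refine le_trans ?_ hb
    rw [mul_sum]
    refine (sum_le_sum fun j hj => ?_).trans (sum_le_sum_of_subset (range_subset_range.2 hk))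
    rw [mul_comm]
    exact Nat.mul_le_mul_right _ (hP _ ((mem_range.1 hj).trans_le hk))
  refine HRuns.mono (.seq ((of_wp_le (T := 50) (Q := fun h' => h'.reg ρTime = 0 ∧ h'.reg ρBase = 0)
    hV (by simp) (by decide)).mono le_rfl fun h1 f1 e1 =>
    (HRuns.forLoop hV n (fun k h' => h'.reg ρTime = ∑ i ∈ range k, p i ∧
      h'.reg ρBase = ∑ j ∈ range k, w j * ∑ i ∈ range (j + 1), p i) (T := 1000)
      (Q := fun h' => h'.reg ρBase = seqCost n p w id) (by norm_num) rfl hnV ?_ ?_ ?_ ?_).mono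
        (forTime_le_mul (c := 1000) (X := 1) (by decide) le_rfl (by simp)) fun _ _ h => h))
    (by omega) fun _ _ h => h
  · intro h' f
    exact ⟨trivial, by rw [← hn, ← f1.reg ρN rfl]; exact f ρN (by norm_num) rfl⟩
  · simp [e1]
  · rintro k hk h' f hi ⟨r1, r2⟩
    refine of_wp_le hV ?_ (by decide)
    have a1 := (hp.congr ((f.arr αP rfl).trans (f1.arr αP rfl))) k hk
    have a2 := (hw.congr ((f.arr αW rfl).trans (f1.arr αW rfl))) k hk
    have b1 := (hP (k + 1) hk).trans hpV
    have b2 := hB (k + 1) hk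
    rw [sum_range_succ] at b1
    simp only [sum_range_succ] at b2
    simp [entry, hi, a1, a2, r1, r2, sum_range_succ, b1, b2]
  · intro h' _ hr
    rw [hr.2, seqCost_id]

end RentSchedule

/-! ### One value of the dynamic program -/

namespace RentSchedule

open Finset WordRAM

notation "ρPre" => (14 : ℕ)
notation "ρX" => (15 : ℕ)
notation "ρQ" => (16 : ℕ)
notation "ρPj" => (17 : ℕ)
notation "ρWj" => (18 : ℕ)
notation "ρRj" => (19 : ℕ)
notation "ρMin" => (20 : ℕ)
notation "ρMinX" => (21 : ℕ)
notation "ρMinQ" => (22 : ℕ)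
notation "ρVal" => (23 : ℕ)
notation "ρDec" => (24 : ℕ)

/-- The array of the values of the dynamic program. -/
def αVal (dir : Bool) : ℕ := if dir then 6 else 5

/-- The array of the decisions. -/
def αDec (dir : Bool) : ℕ := if dir then 8 else 7

/-- The array of the minimal values. -/
def αMin (dir : Bool) : ℕ := if dir then 10 else 9

/-- The array of the second state variables that attain the minimal values. -/
def αMinX (dir : Bool) : ℕ := if dir then 12 else 11

/-- The array of the selected processing times that attain the minimal values. -/
def αMinQ (dir : Bool) : ℕ := if dir then 14 else 13

def stepExp (dir : Bool) (w a b : HExp) : HExp :=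
  if dir then .sub (.add (.mul w (.var ρP)) b) a else .sub (.add (.mul w (.var ρP)) a) b

def outExp (dir : Bool) : HExp :=
  .add (.cell (αVal dir) (.sub (.var ρJ) (.const 1)) (.var ρX) (.var ρQ))
    (stepExp dir (.var ρWj) (.mul (.var ρMu) (.mul (.var ρPj) (.var ρX)))
      (.mul (.var ρWj) (.var ρQ)))

def inExp (dir : Bool) : HExp :=
  .add (.cell (αVal dir) (.sub (.var ρJ) (.const 1)) (.sub (.var ρX) (.mul (.var ρMu) (.var ρWj)))
      (.sub (.var ρQ) (.var ρPj)))
    (stepExp dir (.var ρWj) (.mul (.sub (.const 1) (.var ρMu)) (.mul (.var ρWj) (.var ρX)))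
      (.mul (.sub (.const 1) (.var ρMu)) (.mul (.var ρWj) (.sub (.var ρPre) (.var ρQ)))))

/-- Take the value for not selecting a job into account. -/
def outValueCmd (dir : Bool) : Cmd :=
  .ite (.var ρRj) .skip
    (.ite (.lt (outExp dir) (.var ρVal)) (.assign ρVal (outExp dir)) .skip)

/-- Take the value for selecting a job into account. -/
def inValueCmd (dir : Bool) : Cmd :=
  .ite (.mul (.lt (.var ρPj) (.add (.var ρQ) (.const 1)))
      (.lt (.mul (.var ρMu) (.var ρWj)) (.add (.var ρX) (.const 1))))
    (.ite (.lt (inExp dir) (.var ρVal))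
      (.seq (.assign ρVal (inExp dir)) (.assign ρDec (.const 1))) .skip) .skip

/-- Compute a value and a decision of the dynamic program. -/
def valueCmd (dir : Bool) : Cmd :=
  .seq (.seq (.assign ρVal (.var ρCap)) (.assign ρDec (.const 0))) <|
  .ite (.var ρJ) (.seq (outValueCmd dir) (inValueCmd dir))
    (.ite (.add (.var ρQ) (.mul (.var ρMu) (.var ρX))) .skip (.assign ρVal (.const 0)))

/-- The registers hold the parameters of the dynamic program. -/
structure HasDP (D : SelectDP) (n M : ℕ) (h : HState) : Prop where
  n : h.reg ρN = n
  P : h.reg ρP = D.P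
  M : h.reg ρM = M
  mu : h.reg ρMu = D.μ
  cap : h.reg ρCap = D.cap

theorem HasDP.congr {D : SelectDP} {n M : ℕ} {h h' : HState} (H : HasDP D n M h)
    (e : ∀ r, 1 ≤ r → r ≤ 8 → h'.reg r = h.reg r) : HasDP D n M h' where
  n := by rw [e _ (by norm_num) (by norm_num), H.n]
  P := by rw [e _ (by norm_num) (by norm_num), H.P]
  M := by rw [e _ (by norm_num) (by norm_num), H.M]
  mu := by rw [e _ (by norm_num) (by norm_num), H.mu]
  cap := by rw [e _ (by norm_num) (by norm_num), H.cap]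

/-- The registers hold the data of stage `j` of the dynamic program. -/
structure HasStage (D : SelectDP) (j : ℕ) (h : HState) : Prop where
  stage : h.reg ρJ = j
  pre : h.reg ρPre = D.pre j
  p : ∀ i, j = i + 1 → h.reg ρPj = D.p i
  w : ∀ i, j = i + 1 → h.reg ρWj = D.w i
  r : ∀ i, j = i + 1 → h.reg ρRj = D.r i

theorem HasStage.congr {D : SelectDP} {j : ℕ} {h h' : HState} (H : HasStage D j h)
    (e : ∀ r, r = ρJ ∨ r = ρPre ∨ r = ρPj ∨ r = ρWj ∨ r = ρRj → h'.reg r = h.reg r) :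
    HasStage D j h' where
  stage := by rw [e _ (by norm_num), H.stage]
  pre := by rw [e _ (by norm_num), H.pre]
  p i hi := by rw [e _ (by norm_num), H.p i hi]
  w i hi := by rw [e _ (by norm_num), H.w i hi]
  r i hi := by rw [e _ (by norm_num), H.r i hi]

theorem stepExp_eval (D : SelectDP) {h : HState} (hP : h.reg ρP = D.P) (w a b : HExp) :
    (stepExp D.rev w a b).eval h = D.stepCost (w.eval h) (a.eval h) (b.eval h) := by
  unfold stepExp SelectDP.stepCost
  split <;> simp [hP]

theorem stepExp_safe (dir : Bool) (h : HState) {w a b : HExp} (hw : w.Safe h) (ha : a.Safe h)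
    (hb : b.Safe h) : (stepExp dir w a b).Safe h := by
  unfold stepExp
  split <;> simp [hw, ha, hb]

theorem outExp_safe (dir : Bool) (h : HState) : (outExp dir).Safe h :=
  ⟨by simp, stepExp_safe dir h (by simp) (by simp) (by simp)⟩

theorem inExp_safe (dir : Bool) (h : HState) : (inExp dir).Safe h :=
  ⟨by simp, stepExp_safe dir h (by simp) (by simp) (by simp)⟩

theorem outExp_eval {D : SelectDP} {n M j x q : ℕ} {h : HState} (hD : HasDP D n M h)
    (hs : HasStage D (j + 1) h) (hx : h.reg ρX = x) (hq : h.reg ρQ = q)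
    (hT : h.arr (αVal D.rev) j x q = D.value j x q) :
    (outExp D.rev).eval h = D.value j x q + D.outCost j x q := by
  simp only [outExp, HExp.eval]
  rw [stepExp_eval D hD.P]
  simp [hs.stage, hx, hq, hD.mu, hs.p j rfl, hs.w j rfl, hT, SelectDP.outCost]

theorem inExp_eval {D : SelectDP} {n M j x q : ℕ} {h : HState} (hD : HasDP D n M h)
    (hs : HasStage D (j + 1) h) (hx : h.reg ρX = x) (hq : h.reg ρQ = q)
    (hT : h.arr (αVal D.rev) j (x - D.μ * D.w j) (q - D.p j) =
      D.value j (x - D.μ * D.w j) (q - D.p j)) :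
    (inExp D.rev).eval h = D.inValue (D.value j) j x q := by
  simp only [inExp, HExp.eval]
  rw [stepExp_eval D hD.P]
  simp [hs.stage, hx, hq, hD.mu, hs.p j rfl, hs.w j rfl, hT, SelectDP.inCost, SelectDP.inValue,
    hs.pre]

/-- The register starts at the cap and is replaced only by strictly smaller candidates, first for
leaving the job out and then for selecting it. This gives the truncation and the tie rule of `value`
and `decision`. -/
theorem valueCmd_runs {D : SelectDP} {V n M j x q : ℕ} {h : HState} (hV : 2 ≤ V)
    (hcap : D.cap ≤ V) (hD : HasDP D n M h) (hs : HasStage D j h) (hx : h.reg ρX = x)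
    (hq : h.reg ρQ = q)
    (hT : ∀ i, j = i + 1 → ∀ x' ≤ x, ∀ q' ≤ q, h.arr (αVal D.rev) i x' q' = D.value i x' q') :
    HRuns V (valueCmd D.rev) h 20000
      (fun h' => h'.reg ρVal = D.value j x q ∧ h'.reg ρDec = D.decision j x q) := by
  refine HRuns.mono (.seq ((of_wp_le (T := 50) (Q := fun h' => h'.reg ρVal = D.cap ∧
    h'.reg ρDec = 0) hV (by simp [hD.cap, hcap]) (by decide)).mono le_rfl fun h1 f1 ⟨v1, d1⟩ =>
    .ite (T := 19000) hV trivial ?_ ?_)) (by decide) fun _ _ h => h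
  · intro hv
    have s1 : HasStage D j h1 := hs.congr fun r hr => f1.reg r (by
      rcases hr with rfl | rfl | rfl | rfl | rfl <;> rfl)
    have D1 : HasDP D n M h1 := hD.congr fun r h1 h2 => f1.reg r (by interval_cases r <;> rfl)
    have hx1 : h1.reg ρX = x := (f1.reg _ rfl).trans hx
    have hq1 : h1.reg ρQ = q := (f1.reg _ rfl).trans hq
    have a1 : h1.arr (αVal D.rev) = h.arr (αVal D.rev) := f1.arr _ rfl
    obtain ⟨i, rfl⟩ : ∃ i, j = i + 1 :=
      Nat.exists_eq_succ_of_ne_zero (by rw [← s1.stage]; exact hv)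
    have hT1 : ∀ x' ≤ x, ∀ q' ≤ q, h1.arr (αVal D.rev) i x' q' = D.value i x' q' := by
      rw [a1]; exact hT i rfl
    have eo := outExp_eval D1 s1 hx1 hq1 (hT1 x le_rfl q le_rfl)
    refine HRuns.mono (.seq ((of_wp_le (T := 9500) (Q := fun h' => h'.reg ρVal =
      D.outValue (D.value i) i x q ∧ h'.reg ρDec = 0) hV ?_
      (by cases D.rev <;> decide)).mono le_rfl fun h2 f2 ⟨v2, d2⟩ =>
        of_wp_le (T := 9500) hV ?_ (by cases D.rev <;> decide))) le_rfl fun _ _ h => h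
    · simp only [outValueCmd, Cmd.wp, HExp.Safe, HExp.eval, outExp_safe, eo, s1.r i rfl, v1, d1,
        SelectDP.outValue, HState.reg_setReg]
      by_cases hr : D.r i = 0
      · by_cases ho : D.value i x q + D.outCost i x q < D.cap
        · simp [hr, ho, ho.le]; omega
        · simp [hr, ho, not_lt.1 ho]
      · simp [hr]
    · have fr : ∀ dir r, r ≠ ρVal → (outValueCmd dir).writes r = false := fun dir r hr => by
        simp [outValueCmd, Cmd.writes, hr.symm]
      have s2 : HasStage D (i + 1) h2 := s1.congr fun r hr => f2.reg r (fr _ _ (by omega))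
      have D2 : HasDP D n M h2 := D1.congr fun r h1 h2 => f2.reg r (fr _ _ (by omega))
      have hx2 : h2.reg ρX = x := (f2.reg _ rfl).trans hx1
      have hq2 : h2.reg ρQ = q := (f2.reg _ rfl).trans hq1
      have a2 : h2.arr (αVal D.rev) = h1.arr (αVal D.rev) := f2.arr _ rfl
      have ei := inExp_eval D2 s2 hx2 hq2
        (by rw [a2]; exact hT1 _ (Nat.sub_le _ _) _ (Nat.sub_le _ _))
      have hle := D.outValue_le (D.value i) i x q
      simp only [inValueCmd, Cmd.wp, HExp.Safe, HExp.eval, inExp_safe, ei, v2, d2, hx2, hq2,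
        s2.p i rfl, s2.w i rfl, D2.mu, SelectDP.value, SelectDP.decision, HState.reg_setReg,
        Nat.lt_succ_iff]
      by_cases hc : D.p i ≤ q ∧ D.μ * D.w i ≤ x
      · by_cases hlt : D.inValue (D.value i) i x q < D.outValue (D.value i) i x q
        · simp [hc, hlt]; omega
        · simp [hc, hlt]
      · have h1 : ¬ (D.p i ≤ q ∧ D.μ * D.w i ≤ x ∧
          D.inValue (D.value i) i x q < D.outValue (D.value i) i x q) := fun h => hc ⟨h.1, h.2.1⟩
        rw [if_neg h1, if_neg h1]
        refine ⟨by simp, fun hne => ?_, fun _ => ⟨rfl, rfl⟩⟩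
        exfalso
        refine hne ?_
        rw [not_and_or] at hc
        rcases hc with hc | hc <;> simp [hc]
  · intro hv
    have hj : j = 0 := by
      rw [← hs.stage, ← f1.reg ρJ rfl]; exact hv
    subst hj
    have hx1 : h1.reg ρX = x := (f1.reg _ rfl).trans hx
    have hq1 : h1.reg ρQ = q := (f1.reg _ rfl).trans hq
    have hm1 : h1.reg ρMu = D.μ := (f1.reg _ rfl).trans hD.mu
    refine of_wp_le hV ?_ (by decide)
    simp only [Cmd.wp, HExp.Safe, HExp.eval, hx1, hq1, hm1, SelectDP.value, SelectDP.decision,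
      v1, d1, HState.reg_setReg]
    by_cases h0 : q + D.μ * x = 0
    · simp [h0]
    · simp only [h0, if_false, ne_eq, not_false_eq_true, forall_true_left, false_imp_iff, and_self]

end RentSchedule

/-! ### Filling the tables -/

namespace RentSchedule

open Finset WordRAM

/-- All cells before the cell `(x, q)` of stage `j` are computed. -/
def Filled (D : SelectDP) (M j q x : ℕ) (h : HState) : Prop :=
  ∀ j' x' q', x' ≤ M → q' ≤ D.P → (j' < j ∨ j' = j ∧ q' < q ∨ j' = j ∧ q' = q ∧ x' < x) →
    h.arr (αVal D.rev) j' x' q' = D.value j' x' q' ∧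
    h.arr (αDec D.rev) j' x' q' = D.decision j' x' q'

theorem Filled.congr {D : SelectDP} {M j q x : ℕ} {h h' : HState} (H : Filled D M j q x h)
    (e1 : h'.arr (αVal D.rev) = h.arr (αVal D.rev))
    (e2 : h'.arr (αDec D.rev) = h.arr (αDec D.rev)) : Filled D M j q x h' := by
  intro j' x' q' h1 h2 h3
  rw [e1, e2]
  exact H j' x' q' h1 h2 h3

/-- The minima before the row `q` of stage `j` are computed. -/
def MinFilled (D : SelectDP) (M j q : ℕ) (h : HState) : Prop :=
  ∀ j' b, b ≤ D.P → (j' < j ∨ j' = j ∧ b < q) →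
    D.IsMin M j' b (h.arr (αMin D.rev) j' b 0) (h.arr (αMinX D.rev) j' b 0)
      (h.arr (αMinQ D.rev) j' b 0)

theorem MinFilled.congr {D : SelectDP} {M j q : ℕ} {h h' : HState} (H : MinFilled D M j q h)
    (e1 : h'.arr (αMin D.rev) = h.arr (αMin D.rev))
    (e2 : h'.arr (αMinX D.rev) = h.arr (αMinX D.rev))
    (e3 : h'.arr (αMinQ D.rev) = h.arr (αMinQ D.rev)) : MinFilled D M j q h' := by
  intro j' b h1 h2
  rw [e1, e2, e3]
  exact H j' b h1 h2

/-- `m` is the minimal value of the cells before `(x, q)`. -/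
structure PartialMin (D : SelectDP) (M j q x m mx mq : ℕ) : Prop where
  le_cap : m ≤ D.cap
  -- These two bounds hold even if nothing below the cap was found, since the registers must fit
  -- into words in any case.
  x_le : mx ≤ M
  q_le : mq ≤ q
  le : ∀ x' ≤ M, ∀ q', (q' < q ∨ q' = q ∧ x' < x) → D.Exact j x' q' → m ≤ D.value j x' q'
  attained : m < D.cap → mx ≤ M ∧ (mq < q ∨ mq = q ∧ mx < x) ∧ D.Exact j mx mq ∧
    D.value j mx mq = m

theorem PartialMin.isMin {D : SelectDP} {M j q m mx mq : ℕ}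
    (H : PartialMin D M j q (M + 1) m mx mq) : D.IsMin M j q m mx mq where
  le_cap := H.le_cap
  le x' hx' q' hq' := H.le x' hx' q' (by omega)
  attained hm := by
    obtain ⟨h1, h2, h3⟩ := H.attained hm
    exact ⟨h1, by omega, h3⟩

/-- The running minimum is not reset between rows, so the entry of row `q` covers all selected times
up to `q`. -/
theorem PartialMin.next_row {D : SelectDP} {M j q m mx mq : ℕ}
    (H : PartialMin D M j q (M + 1) m mx mq) : PartialMin D M j (q + 1) 0 m mx mq where
  le_cap := H.le_cap
  x_le := H.x_le
  q_le := H.q_le.trans (Nat.le_succ q)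
  le x' hx' q' hq' := H.le x' hx' q' (by omega)
  attained hm := by
    obtain ⟨h1, h2, h3⟩ := H.attained hm
    exact ⟨h1, by omega, h3⟩

theorem PartialMin.step_of_not {D : SelectDP} {M j q x m mx mq : ℕ}
    (H : PartialMin D M j q x m mx mq) (hn : D.value j x q < m → ¬ D.Exact j x q) :
    PartialMin D M j q (x + 1) m mx mq where
  le_cap := H.le_cap
  x_le := H.x_le
  q_le := H.q_le
  le x' hx' q' hq' he := by
    by_cases hxq : q' = q ∧ x' = x
    · obtain ⟨rfl, rfl⟩ := hxq
      by_contra hcon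
      exact hn (not_le.1 hcon) he
    · exact H.le x' hx' q' (by omega) he
  attained hm := by
    obtain ⟨h1, h2, h3⟩ := H.attained hm
    exact ⟨h1, by omega, h3⟩

theorem PartialMin.step_of_lt {D : SelectDP} {M j q x m mx mq : ℕ}
    (H : PartialMin D M j q x m mx mq) (hx : x ≤ M) (hlt : D.value j x q < m)
    (he : D.Exact j x q) : PartialMin D M j q (x + 1) (D.value j x q) x q where
  le_cap := hlt.le.trans H.le_cap
  x_le := hx
  q_le := le_rfl
  le x' hx' q' hq' he' := by
    by_cases hxq : q' = q ∧ x' = x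
    · obtain ⟨rfl, rfl⟩ := hxq; exact le_rfl
    · exact hlt.le.trans (H.le x' hx' q' (by omega) he')
  attained _ := ⟨hx, by omega, he, rfl⟩

/-- Store a value and a decision and update the minimum. -/
def storeCmd (dir : Bool) : Cmd :=
  .seq (.put (αVal dir) (.var ρJ) (.var ρX) (.var ρQ) (.var ρVal)) <|
  .seq (.put (αDec dir) (.var ρJ) (.var ρX) (.var ρQ) (.var ρDec)) <|
  .ite (.lt (.var ρVal) (.var ρMin))
    (.ite (.mul (.sub (.const 1) (.var ρMu))
        (.add (.sub (.add (.var ρX) (.var ρQ)) (.var ρPre))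
          (.sub (.var ρPre) (.add (.var ρX) (.var ρQ))))) .skip
      (.seq (.assign ρMin (.var ρVal)) (.seq (.assign ρMinX (.var ρX)) (.assign ρMinQ (.var ρQ)))))
    .skip

/-- Compute a cell of the dynamic program. -/
def cellCmd (dir : Bool) : Cmd := .seq (valueCmd dir) (storeCmd dir)

/-- The two truncated differences add up to the distance of `x + q` and `pre j`. -/
theorem exact_iff {D : SelectDP} (hmu : D.μ = 0 ∨ D.μ = 1) {j x q : ℕ} :
    (1 - D.μ) * ((x + q - D.pre j) + (D.pre j - (x + q))) = 0 ↔ D.Exact j x q := by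
  unfold SelectDP.Exact
  rcases hmu with hm | hm <;> rw [hm]
  · simp; omega
  · simp

theorem cellCmd_runs {D : SelectDP} {V n M j x q : ℕ} {h : HState} (hV : 2 ≤ V)
    (hcap : D.cap ≤ V) (hMV : M ≤ V) (hPV : D.P ≤ V) (hmu : D.μ = 0 ∨ D.μ = 1)
    (hD : HasDP D n M h) (hs : HasStage D j h) (hx : h.reg ρX = x) (hq : h.reg ρQ = q)
    (hxM : x ≤ M) (hqP : q ≤ D.P) (hF : Filled D M j q x h)
    (hm : PartialMin D M j q x (h.reg ρMin) (h.reg ρMinX) (h.reg ρMinQ)) :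
    HRuns V (cellCmd D.rev) h 30000 (fun h' => Filled D M j q (x + 1) h' ∧
      PartialMin D M j q (x + 1) (h'.reg ρMin) (h'.reg ρMinX) (h'.reg ρMinQ)) := by
  refine HRuns.mono (.seq ((valueCmd_runs hV hcap hD hs hx hq ?_).mono le_rfl
    fun h1 f1 ⟨v1, d1⟩ => of_wp_le (T := 10000) hV ?_ (by cases D.rev <;> decide))) le_rfl
      fun _ _ h => h
  · rintro i rfl x' hx' q' hq'
    exact (hF i x' q' (hx'.trans hxM) (hq'.trans hqP) (.inl (Nat.lt_succ_self i))).1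
  · have fr : ∀ dir r, r ≠ ρVal → r ≠ ρDec → (valueCmd dir).writes r = false := fun dir r h1 h2 => by
      simp [valueCmd, outValueCmd, inValueCmd, Cmd.writes, h1.symm, h2.symm]
    have s1 : HasStage D j h1 := hs.congr fun r hr => f1.reg r (fr _ _ (by omega) (by omega))
    have D1 : HasDP D n M h1 := hD.congr fun r h1 h2 => f1.reg r (fr _ _ (by omega) (by omega))
    have hx1 : h1.reg ρX = x := (f1.reg _ rfl).trans hx
    have hq1 : h1.reg ρQ = q := (f1.reg _ rfl).trans hq
    have hm1 : h1.reg ρMin = h.reg ρMin := f1.reg _ rfl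
    have hm2 : h1.reg ρMinX = h.reg ρMinX := f1.reg _ rfl
    have hm3 : h1.reg ρMinQ = h.reg ρMinQ := f1.reg _ rfl
    have hF1 : Filled D M j q x h1 := hF.congr (f1.arr _ rfl) (f1.arr _ rfl)
    have hval := (D.value_le j x q).trans hcap
    have hdec := D.decision_le_one j x q
    have hne : αVal D.rev ≠ αDec D.rev := by cases D.rev <;> decide
    have hFnew : ∀ j' x' q', x' ≤ M → q' ≤ D.P →
        (j' < j ∨ j' = j ∧ q' < q ∨ j' = j ∧ q' = q ∧ x' < x + 1) →
        (if j' = j ∧ x' = x ∧ q' = q then D.value j x q else h1.arr (αVal D.rev) j' x' q') =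
          D.value j' x' q' ∧
        (if j' = j ∧ x' = x ∧ q' = q then D.decision j x q else h1.arr (αDec D.rev) j' x' q') =
          D.decision j' x' q' := by
      intro j' x' q' h1 h2 h3
      by_cases hc : j' = j ∧ x' = x ∧ q' = q
      · obtain ⟨rfl, rfl, rfl⟩ := hc; simp
      · rw [if_neg hc, if_neg hc]
        exact hF1 j' x' q' h1 h2 (by omega)
    simp only [storeCmd, Cmd.wp, HExp.Safe, HExp.eval, v1, d1, hx1, hq1, s1.stage, D1.mu,
      s1.pre, hm1, hm2, hm3, HState.reg_setReg, HState.reg_setArr]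
    refine ⟨trivial, trivial, trivial, trivial, hval, trivial, trivial, trivial, trivial, by omega,
      ⟨trivial, trivial⟩, ?_, ?_⟩
    · intro hlt
      have hlt : D.value j x q < h.reg ρMin := by
        by_contra hcon
        rw [if_neg hcon] at hlt
        exact hlt rfl
      refine ⟨by simp, fun hex => ⟨?_, ?_⟩, fun hex => ?_⟩
      · intro j' x' q' a1 a2 a3
        simpa [hne, hne.symm] using hFnew j' x' q' a1 a2 a3
      · exact hm.step_of_not fun _ he => hex ((exact_iff hmu).2 he)
      · have he := (exact_iff hmu).1 hex
        refine ⟨by simp, trivial, hval, by simp, trivial, by simp; omega, by simp, trivial,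
          by simp; omega, ?_, ?_⟩
        · intro j' x' q' a1 a2 a3
          simpa [hne, hne.symm] using hFnew j' x' q' a1 a2 a3
        · simpa using hm.step_of_lt hxM hlt he
    · intro hlt
      have hlt : ¬ D.value j x q < h.reg ρMin := by
        intro hcon
        rw [if_pos hcon] at hlt
        exact absurd hlt (by norm_num)
      refine ⟨?_, hm.step_of_not fun h => absurd h hlt⟩
      intro j' x' q' a1 a2 a3
      simpa [hne, hne.symm] using hFnew j' x' q' a1 a2 a3

/-- Compute a row of the dynamic program. -/
def rowCmd (dir : Bool) : Cmd :=
  .seq (.forLoop ρX (.add (.var ρM) (.const 1)) (cellCmd dir)) <|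
  .seq (.put (αMin dir) (.var ρJ) (.var ρQ) (.const 0) (.var ρMin)) <|
  .seq (.put (αMinX dir) (.var ρJ) (.var ρQ) (.const 0) (.var ρMinX)) <|
  .put (αMinQ dir) (.var ρJ) (.var ρQ) (.const 0) (.var ρMinQ)

theorem cellCmd_writes (dir : Bool) {r : ℕ} (h : r < ρMin) : (cellCmd dir).writes r = false := by
  have : ∀ k, 20 ≤ k → (k == r) = false := fun k hk => by simp; omega
  simp [cellCmd, storeCmd, valueCmd, outValueCmd, inValueCmd, Cmd.writes, this]

theorem rowCmd_writes (dir : Bool) {r : ℕ} (h : r < ρMin) (h' : r ≠ ρX) :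
    (rowCmd dir).writes r = false := by
  simp [rowCmd, Cmd.forLoop, Cmd.writes, cellCmd_writes dir h, h'.symm]

theorem rowCmd_runs {D : SelectDP} {V n M j q : ℕ} {h : HState} (hV : 2 ≤ V)
    (hcap : D.cap ≤ V) (hMV : M + 1 ≤ V) (hPV : D.P ≤ V) (hmu : D.μ = 0 ∨ D.μ = 1)
    (hD : HasDP D n M h) (hs : HasStage D j h) (hq : h.reg ρQ = q) (hqP : q ≤ D.P)
    (hF : Filled D M j q 0 h) (hH : MinFilled D M j q h)
    (hm : PartialMin D M j q 0 (h.reg ρMin) (h.reg ρMinX) (h.reg ρMinQ)) :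
    HRuns V (rowCmd D.rev) h (40000 * (M + 2)) (fun h' => Filled D M j (q + 1) 0 h' ∧
      MinFilled D M j (q + 1) h' ∧
      PartialMin D M j (q + 1) 0 (h'.reg ρMin) (h'.reg ρMinX) (h'.reg ρMinQ)) := by
  have fr : ∀ h' : HState, (Cmd.forLoop ρX (.add (.var ρM) (.const 1)) (cellCmd D.rev)).Frame h h' →
      ∀ r, r < ρMin → r ≠ ρX → h'.reg r = h.reg r := fun h' f r h1 h2 => f.reg r (by
    simp [Cmd.forLoop, Cmd.writes, cellCmd_writes D.rev h1, h2.symm])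
  refine HRuns.mono (.seq ((HRuns.forLoop hV (M + 1) (fun x h' => Filled D M j q x h' ∧
    PartialMin D M j q x (h'.reg ρMin) (h'.reg ρMinX) (h'.reg ρMinQ)) (T := 30000)
    (Q := fun h' => Filled D M j q (M + 1) h' ∧
      PartialMin D M j q (M + 1) (h'.reg ρMin) (h'.reg ρMinX) (h'.reg ρMinQ))
    (by norm_num) (cellCmd_writes _ (by norm_num)) hMV ?_ ⟨hF, by simpa using hm⟩ ?_ fun _ _ h => h).mono
      (forTime_le_mul (c := 30000) (X := 1) (by decide) le_rfl le_rfl)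
    fun h1 f1 ⟨F1, m1⟩ => of_wp_le (T := 9000) hV ?_ (by cases D.rev <;> decide)))
      (by omega) fun _ _ h => h
  · intro h' e
    refine ⟨⟨trivial, trivial⟩, ?_⟩
    simp only [HExp.eval]
    rw [e ρM (by norm_num) (cellCmd_writes _ (by norm_num)), hD.M]
  · rintro x hx h' f hx' ⟨F', m'⟩
    exact cellCmd_runs hV hcap (by omega) hPV hmu
      (hD.congr fun r _ _ => fr h' f r (by omega) (by omega))
      (hs.congr fun r _ => fr h' f r (by omega) (by omega)) hx'
      ((fr h' f ρQ (by norm_num) (by norm_num)).trans hq) (by omega) hqP F' m'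
  · have b1 := m1.le_cap
    have b2 := m1.x_le
    have b3 := m1.q_le
    have hq1 : h1.reg ρQ = q := (fr h1 f1 ρQ (by norm_num) (by norm_num)).trans hq
    have hj1 : h1.reg ρJ = j := (fr h1 f1 ρJ (by norm_num) (by norm_num)).trans hs.stage
    have ne : αMin D.rev ≠ αMinX D.rev ∧ αMin D.rev ≠ αMinQ D.rev ∧ αMinX D.rev ≠ αMinQ D.rev := by
      cases D.rev <;> decide
    have ne' : αVal D.rev ≠ αMin D.rev ∧ αVal D.rev ≠ αMinX D.rev ∧ αVal D.rev ≠ αMinQ D.rev ∧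
        αDec D.rev ≠ αMin D.rev ∧ αDec D.rev ≠ αMinX D.rev ∧ αDec D.rev ≠ αMinQ D.rev := by
      cases D.rev <;> decide
    have H1 : MinFilled D M j q h1 := hH.congr
      (f1.arr _ (by cases D.rev <;> rfl)) (f1.arr _ (by cases D.rev <;> rfl))
      (f1.arr _ (by cases D.rev <;> rfl))
    simp only [Cmd.wp, HExp.Safe, HExp.eval, hq1, hj1, HState.reg_setArr]
    refine ⟨trivial, trivial, trivial, trivial, by omega, trivial, trivial, trivial, trivial,
      by omega, trivial, trivial, trivial, trivial, by omega, ?_, ?_, m1.next_row⟩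
    · intro j' x' q' a1 a2 a3
      simpa [ne'] using F1 j' x' q' a1 a2 (by omega)
    · intro j' b a1 a2
      by_cases hc : j' = j ∧ b = q
      · obtain ⟨rfl, rfl⟩ := hc
        simpa [ne, ne.1.symm, ne.2.1.symm, ne.2.2.symm] using m1.isMin
      · have := H1 j' b a1 (by omega)
        simpa [ne, ne.1.symm, ne.2.1.symm, ne.2.2.symm, hc] using this

/-- Load the data of stage `j`. -/
def loadCmd (dir : Bool) : Cmd :=
  .ite (.var ρJ)
    -- Stage `j` treats the job with index `j - 1` in reading direction, which is `n - j` from the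
    -- end; `ρX` serves as scratch space.
    (.seq (.assign ρX (if dir then .sub (.var ρN) (.var ρJ) else .sub (.var ρJ) (.const 1))) <|
      .seq (.assign ρPj (entry αP ρX)) <| .seq (.assign ρWj (entry αW ρX)) <|
      .seq (.assign ρRj (entry αR ρX)) <| .assign ρPre (.add (.var ρPre) (.var ρPj)))
    .skip

/-- Compute a stage of the dynamic program. -/
def stageCmd (dir : Bool) : Cmd :=
  .seq (.seq (loadCmd dir) (.seq (.assign ρMin (.var ρCap))
    (.seq (.assign ρMinX (.const 0)) (.assign ρMinQ (.const 0))))) <|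
  .forLoop ρQ (.add (.var ρP) (.const 1)) (rowCmd dir)

theorem stageCmd_writes (dir : Bool) {r : ℕ} (h : r < ρPre) : (stageCmd dir).writes r = false := by
  simp [stageCmd, loadCmd, Cmd.forLoop, Cmd.writes,
    rowCmd_writes dir (show r < 20 by omega) (show r ≠ 15 by omega)]
  omega

/-- Run the dynamic program. -/
def dpCmd (dir : Bool) : Cmd :=
  .seq (.assign ρPre (.const 0)) (.forLoop ρJ (.add (.var ρN) (.const 1)) (stageCmd dir))

section

variable {n K V M : ℕ} {p w r : ℕ → ℕ} {dir : Bool}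

theorem loadCmd_runs {j : ℕ} {h : HState} (hV : 2 ≤ V) (hD : (blockDP n K p w r dir).Valid n)
    (hPV : (blockDP n K p w r dir).P + 1 ≤ V) (hnV : n ≤ V)
    (hpV : ∀ i < n, p i ≤ V) (hwV : ∀ i < n, w i ≤ V) (hrV : ∀ i < n, r i ≤ V)
    (hn : h.reg ρN = n) (hj : j ≤ n) (hJ : h.reg ρJ = j)
    (hpre : h.reg ρPre = (blockDP n K p w r dir).pre (j - 1))
    (hp : Lists h αP n p) (hw : Lists h αW n w) (hr : Lists h αR n r) :
    HRuns V (loadCmd dir) h 5000 (HasStage (blockDP n K p w r dir) j) := by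
  refine of_wp_le hV ?_ (by cases dir <;> decide)
  rcases Nat.eq_zero_or_pos j with rfl | hpos
  -- Stage `0` loads no job, and the truncated index in `hpre` is the right one.
  · simp only [loadCmd, Cmd.wp, HExp.eval, hJ]
    refine ⟨trivial, fun h => absurd rfl h, fun _ => ⟨hJ, hpre, ?_, ?_, ?_⟩⟩ <;>
      exact fun i hi => absurd hi (by omega)
  · obtain ⟨i, rfl⟩ := Nat.exists_eq_add_of_le' hpos
    have hpre' := hD.pre_le (i + 1) hj
    have hsucc : (blockDP n K p w r dir).pre (i + 1) =
      (blockDP n K p w r dir).pre i + (blockDP n K p w r dir).p i := sum_range_succ _ _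
    rw [Nat.add_sub_cancel] at hpre
    simp only [loadCmd, Cmd.wp, HExp.eval, hJ]
    refine ⟨trivial, fun _ => ?_, fun h => absurd h (Nat.succ_ne_zero i)⟩
    obtain ⟨k, hk, hpos, e1, e2, e3⟩ : ∃ k < n,
        (if dir then HExp.sub (.var ρN) (.var ρJ) else .sub (.var ρJ) (.const 1)).eval h = k ∧
        p k = (blockDP n K p w r dir).p i ∧ w k = (blockDP n K p w r dir).w i ∧
        r k = (blockDP n K p w r dir).r i := by
      cases dir
      · exact ⟨i, by omega, by simp [hJ], rfl, rfl, rfl⟩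
      · refine ⟨n - 1 - i, by omega, ?_, rfl, rfl, rfl⟩
        simp [hn, hJ]; omega
    have s0 : (if dir then HExp.sub (.var ρN) (.var ρJ)
        else .sub (.var ρJ) (.const 1)).Safe h := by
      cases dir <;> simp
    have c1 := hpV k hk
    have c2 := hwV k hk
    have c3 := hrV k hk
    simp only [entry, HExp.Safe, HExp.eval, hpos, HState.reg_setReg, HState.arr_setReg]
    simp only [if_true, if_false, show (14 : ℕ) ≠ 15 by norm_num, show (14 : ℕ) ≠ 17 by norm_num,
      show (14 : ℕ) ≠ 18 by norm_num, show (14 : ℕ) ≠ 19 by norm_num,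
      show (17 : ℕ) ≠ 18 by norm_num, show (17 : ℕ) ≠ 19 by norm_num,
      show (15 : ℕ) ≠ 17 by norm_num, show (15 : ℕ) ≠ 18 by norm_num, hp k hk, hw k hk, hr k hk,
      hpre, e1, e2, e3]
    rw [e1] at c1
    rw [e2] at c2
    rw [e3] at c3
    refine ⟨by norm_num, s0, by omega, by norm_num, ⟨trivial, trivial, trivial⟩, c1, by norm_num,
      ⟨trivial, trivial, trivial⟩, c2, by norm_num, ⟨trivial, trivial, trivial⟩, c3, by norm_num,
      ⟨trivial, trivial⟩, by omega, ?_, ?_, ?_, ?_, ?_⟩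
    · simp [hJ]
    · simp [hsucc]
    all_goals
      intro i' hi'
      obtain rfl : i = i' := by omega
      simp

theorem stageCmd_runs {j : ℕ} {h : HState} (hV : 2 ≤ V) (hD : (blockDP n K p w r dir).Valid n)
    (hcap : (blockDP n K p w r dir).cap ≤ V) (hMV : M + 1 ≤ V)
    (hPV : (blockDP n K p w r dir).P + 1 ≤ V) (hnV : n ≤ V)
    (hpV : ∀ i < n, p i ≤ V) (hwV : ∀ i < n, w i ≤ V) (hrV : ∀ i < n, r i ≤ V)
    (hR : HasDP (blockDP n K p w r dir) n M h) (hj : j ≤ n) (hJ : h.reg ρJ = j)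
    (hpre : h.reg ρPre = (blockDP n K p w r dir).pre (j - 1))
    (hp : Lists h αP n p) (hw : Lists h αW n w) (hr : Lists h αR n r)
    (hF : Filled (blockDP n K p w r dir) M j 0 0 h)
    (hH : MinFilled (blockDP n K p w r dir) M j 0 h) :
    HRuns V (stageCmd dir) h (60000 * (((blockDP n K p w r dir).P + 2) * (M + 2))) (fun h' =>
      Filled (blockDP n K p w r dir) M (j + 1) 0 0 h' ∧
      MinFilled (blockDP n K p w r dir) M (j + 1) 0 h' ∧
      h'.reg ρPre = (blockDP n K p w r dir).pre j) := by
  set D := blockDP n K p w r dir with hDdef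
  have hrev : D.rev = dir := rfl
  have time : ∀ X Y : ℕ, 5000 + 100 + (40000 + 18) * ((X + 1 + 1) * (Y + 2)) ≤
      60000 * ((X + 2) * (Y + 2)) := fun X Y => by
    have : 1 ≤ (X + 2) * (Y + 2) := Nat.succ_le_of_lt (by positivity)
    rw [show X + 1 + 1 = X + 2 by rfl]
    generalize (X + 2) * (Y + 2) = Z at *
    omega
  refine HRuns.mono (.seq ((HRuns.seq ((loadCmd_runs hV hD hPV hnV hpV hwV hrV hR.n hj hJ hpre hp
    hw hr).mono le_rfl fun h1 f1 s1 => of_wp_le (T := 100) (Q := fun h' => HasStage D j h' ∧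
      h'.reg ρMin = D.cap ∧ h'.reg ρMinX = 0 ∧ h'.reg ρMinQ = 0) hV ?_ (by decide))).mono le_rfl
    fun h2 f2 ⟨s2, m2, x2, q2⟩ => (HRuns.forLoop hV (D.P + 1) (fun q h' =>
      Filled D M j q 0 h' ∧ MinFilled D M j q h' ∧
      PartialMin D M j q 0 (h'.reg ρMin) (h'.reg ρMinX) (h'.reg ρMinQ)) (T := 40000 * (M + 2))
      (by norm_num) (rowCmd_writes _ (by norm_num) (by norm_num)) hPV ?_ ?_ ?_ ?_).mono
        (forTime_le_mul (c := 40000) (X := M + 2) (by decide) (by omega) le_rfl) fun _ _ h => h))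
    (time _ _) fun _ _ h => h
  · have hc1 : h1.reg ρCap = D.cap := (f1.reg _ (by cases dir <;> rfl)).trans hR.cap
    simp only [Cmd.wp, HExp.Safe, HExp.eval, hc1]
    refine ⟨by norm_num, trivial, hcap, by norm_num, trivial, by omega, by norm_num, trivial,
      by omega, s1.congr ?_, by simp, by simp, by simp⟩
    rintro r (rfl | rfl | rfl | rfl | rfl) <;> simp
  · intro h' e
    refine ⟨⟨trivial, trivial⟩, ?_⟩
    simp only [HExp.eval]
    rw [e ρP (by norm_num) (rowCmd_writes _ (by norm_num) (by norm_num)),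
      f2.reg ρP (by cases dir <;> rfl), hR.P]
  · refine ⟨(hF.congr (f2.arr _ rfl) (f2.arr _ rfl)).congr rfl rfl,
      (hH.congr (f2.arr _ rfl) (f2.arr _ rfl) (f2.arr _ rfl)).congr rfl rfl rfl, ?_⟩
    simp only [HState.reg_setReg, m2, x2, q2]
    exact ⟨le_rfl, Nat.zero_le _, le_rfl, fun _ _ _ h => by omega,
      fun h => absurd h (lt_irrefl _)⟩
  · rintro q hq h3 f3 hq3 ⟨F3, H3, m3⟩
    have fr : ∀ r, r < ρX → h3.reg r = h2.reg r := fun r hr => f3.reg r (by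
      simp [Cmd.forLoop, Cmd.writes,
        rowCmd_writes dir (show r < 20 by omega) (show r ≠ 15 by omega)]; omega)
    have fr' : ∀ r, r = ρPj ∨ r = ρWj ∨ r = ρRj → h3.reg r = h2.reg r := fun r hr => f3.reg r (by
      rcases hr with rfl | rfl | rfl <;> cases dir <;> rfl)
    have := rowCmd_runs (D := D) (n := n) (h := h3) hV hcap hMV (by omega) hD.mu
      (hR.congr fun r h1 h2 => (fr r (by omega)).trans (f2.reg r (by
        cases dir <;> interval_cases r <;> rfl)))
      (s2.congr fun r hr => by
        rcases hr with rfl | rfl | h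
        · exact fr _ (by norm_num)
        · exact fr _ (by norm_num)
        · exact fr' _ h) hq3 (by omega) F3 H3 m3
    rw [hrev] at this
    exact this.mono le_rfl fun h4 _ ⟨a, b, c⟩ => ⟨a, b, by simpa using c⟩
  · rintro h' f ⟨a, b, c⟩
    refine ⟨fun j' x' q' a1 a2 a3 => a j' x' q' a1 a2 (by omega),
      fun j' b' a1 a2 => b j' b' a1 (by omega), ?_⟩
    rw [f.reg ρPre (by simp [Cmd.forLoop, Cmd.writes, rowCmd_writes dir (show 14 < 20 by omega)
      (show 14 ≠ 15 by omega)])]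
    exact s2.pre

theorem dpCmd_runs {h : HState} (hV : 2 ≤ V) (hD : (blockDP n K p w r dir).Valid n)
    (hcap : (blockDP n K p w r dir).cap ≤ V) (hMV : M + 1 ≤ V)
    (hPV : (blockDP n K p w r dir).P + 1 ≤ V) (hnV : n + 1 ≤ V)
    (hpV : ∀ i < n, p i ≤ V) (hwV : ∀ i < n, w i ≤ V) (hrV : ∀ i < n, r i ≤ V)
    (hR : HasDP (blockDP n K p w r dir) n M h)
    (hp : Lists h αP n p) (hw : Lists h αW n w) (hr : Lists h αR n r) :
    HRuns V (dpCmd dir) h (70000 * ((n + 2) * (((blockDP n K p w r dir).P + 2) * (M + 2))))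
      (fun h' => Filled (blockDP n K p w r dir) M (n + 1) 0 0 h' ∧
        MinFilled (blockDP n K p w r dir) M (n + 1) 0 h') := by
  set D := blockDP n K p w r dir with hDdef
  have time : ∀ X Y Z : ℕ, 100 + (60000 + 18) * ((X + 1 + 1) * ((Y + 2) * (Z + 2))) ≤
      70000 * ((X + 2) * ((Y + 2) * (Z + 2))) := fun X Y Z => by
    have : 1 ≤ (X + 2) * ((Y + 2) * (Z + 2)) := Nat.succ_le_of_lt (by positivity)
    linarith
  refine HRuns.mono (.seq ((of_wp_le (T := 100) (Q := fun h' => h'.reg ρPre = 0) hV (by simp)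
    (by decide)).mono le_rfl fun h1 f1 p1 => (HRuns.forLoop hV (n + 1) (fun j h' =>
      Filled D M j 0 0 h' ∧ MinFilled D M j 0 h' ∧ h'.reg ρPre = D.pre (j - 1))
      (T := 60000 * ((D.P + 2) * (M + 2))) (by norm_num) (stageCmd_writes _ (by norm_num)) hnV
      ?_ ?_ ?_ ?_).mono (forTime_le_mul (c := 60000) (X := (D.P + 2) * (M + 2)) (by decide)
        (Nat.succ_le_of_lt (by positivity)) le_rfl) fun _ _ h => h))
    (time _ _ _) fun _ _ h => h
  · intro h' e
    refine ⟨⟨trivial, trivial⟩, ?_⟩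
    simp only [HExp.eval]
    rw [e ρN (by norm_num) (stageCmd_writes _ (by norm_num)), f1.reg ρN rfl, hR.n]
  · exact ⟨fun _ _ _ _ _ h => by omega, fun _ _ _ h => by omega, by simpa [SelectDP.pre] using p1⟩
  · rintro j hj h2 f2 hj2 ⟨F2, H2, p2⟩
    have fr : ∀ r, r < ρJ → h2.reg r = h.reg r := fun r hr => (f2.reg r (by
      simp [Cmd.forLoop, Cmd.writes, stageCmd_writes dir (show r < 14 by omega)]; omega)).trans
        (f1.reg r (by simp [Cmd.writes]; omega))
    have fa : ∀ t, t ≤ αR → h2.arr t = h.arr t := fun t ht => (f2.arr t (by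
      cases dir <;> interval_cases t <;> rfl)).trans (f1.arr t rfl)
    refine (stageCmd_runs hV hD hcap hMV hPV (by omega) hpV hwV hrV
      (hR.congr fun r h1 h2 => fr r (by omega)) (by omega) hj2 p2 (hp.congr (fa _ (by norm_num)))
      (hw.congr (fa _ (by norm_num))) (hr.congr (fa _ (by norm_num))) F2 H2).mono le_rfl
      fun h3 _ ⟨a, b, c⟩ => ⟨a, b, by simpa using c⟩
  · rintro h' f ⟨a, b, -⟩
    exact ⟨a, b⟩

end

end RentSchedule

/-! ### The search for the shortest renting period -/

namespace RentSchedule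

open Finset WordRAM

notation "ρBest" => (25 : ℕ)
notation "ρCut" => (26 : ℕ)
notation "ρFront" => (27 : ℕ)

/-- The search for a smallest sum `b₁ + b₂` with `F k b₁ b₂` for some `k ≤ n`, after all cuts
before `k` and, for the cut `k`, all `b₁ < b` are examined. -/
structure SearchState (F : ℕ → ℕ → ℕ → Prop) (n P k b best cut front : ℕ) : Prop where
  -- The value `P + 1` means that nothing has been found.
  best_le : best ≤ P + 1
  cut_le : cut ≤ n
  front_le : front ≤ P
  attained : best ≤ P → front ≤ best ∧ F cut front (best - front)
  le : ∀ k' b₁ b₂, b₁ ≤ P → b₂ ≤ P → (k' < k ∨ k' = k ∧ b₁ < b) → F k' b₁ b₂ → best ≤ b₁ + b₂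

namespace SearchState

variable {F : ℕ → ℕ → ℕ → Prop} {n P k b best cut front : ℕ}

theorem improve (H : SearchState F n P k b best cut front) (hk : k ≤ n) (hb : b ≤ P)
    (hlt : b < best) (hF : F k b (best - 1 - b)) : SearchState F n P k b (best - 1) k b where
  best_le := (Nat.sub_le _ _).trans H.best_le
  cut_le := hk
  front_le := hb
  attained _ := ⟨by omega, hF⟩
  le k' b₁ b₂ h₁ h₂ h hF' := (Nat.sub_le _ _).trans (H.le k' b₁ b₂ h₁ h₂ h hF')

/-- If the complement `best - 1 - b` does not suffice, then by monotonicity no `b₂` with `b + b₂ <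
best` does, and `b` is finished. -/
theorem advance (H : SearchState F n P k b best cut front)
    (hmono : ∀ b₂ b₂', b₂ ≤ b₂' → b₂' ≤ P → F k b b₂ → F k b b₂')
    (hF : b < best → ¬ F k b (best - 1 - b)) : SearchState F n P k (b + 1) best cut front where
  best_le := H.best_le
  cut_le := H.cut_le
  front_le := H.front_le
  attained := H.attained
  le k' b₁ b₂ h₁ h₂ h hF' := by
    by_cases hc : k' = k ∧ b₁ = b
    · obtain ⟨rfl, rfl⟩ := hc
      by_contra hcon
      have := H.best_le
      exact hF (by omega) (hmono b₂ _ (by omega) (by omega) hF')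
    · exact H.le k' b₁ b₂ h₁ h₂ (by omega) hF'

theorem next (H : SearchState F n P k (P + 1) best cut front) :
    SearchState F n P (k + 1) 0 best cut front where
  best_le := H.best_le
  cut_le := H.cut_le
  front_le := H.front_le
  attained := H.attained
  le k' b₁ b₂ h₁ h₂ h hF' := H.le k' b₁ b₂ h₁ h₂ (by omega) hF'

end SearchState

/-- The condition that the best length found so far can be improved by one. -/
def improveExp : HExp :=
  .mul (.lt (.var ρQ) (.var ρBest))
    (.lt (.add (.add (.cell (αMin false) (.var ρJ) (.var ρQ) (.const 0))
      (.cell (αMin true) (.sub (.var ρN) (.var ρJ))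
        (.sub (.sub (.var ρBest) (.const 1)) (.var ρQ)) (.const 0))) (.var ρBase)) (.var ρCap))

/-- Improve the best length found so far, or advance. -/
def searchStepCmd : Cmd :=
  .ite improveExp
    (.seq (.assign ρBest (.sub (.var ρBest) (.const 1))) <|
      .seq (.assign ρCut (.var ρJ)) <| .assign ρFront (.var ρQ))
    (.assign ρQ (.add (.var ρQ) (.const 1)))

/-- Search for the shortest renting period. -/
def searchCmd : Cmd :=
  .seq (.seq (.assign ρBest (.add (.var ρP) (.const 1)))
    (.seq (.assign ρCut (.const 0)) (.assign ρFront (.const 0)))) <|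
  .forLoop ρJ (.add (.var ρN) (.const 1)) <| .seq (.assign ρQ (.const 0)) <|
    .while (.lt (.var ρQ) (.add (.var ρP) (.const 1))) searchStepCmd

/-- For each cut a step either lowers `best` or raises `b`, so there are at most `2 * (P + 1)` steps
rather than quadratically many pairs. -/
theorem searchCmd_runs {V n P cap base : ℕ} {h : HState} (hV : 2 ≤ V) (hnV : n + 1 ≤ V)
    (hPV : P + 1 ≤ V) (hn : h.reg ρN = n) (hP : h.reg ρP = P) (hcap : h.reg ρCap = cap)
    (hbase : h.reg ρBase = base)
    (hmono : ∀ k ≤ n, ∀ b b', b ≤ b' → b' ≤ P →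
      h.arr (αMin true) (n - k) b' 0 ≤ h.arr (αMin true) (n - k) b 0) :
    HRuns V searchCmd h (3000 * ((n + 2) * (P + 1))) (fun h' =>
      SearchState (fun k b₁ b₂ =>
        h.arr (αMin false) k b₁ 0 + h.arr (αMin true) (n - k) b₂ 0 + base < cap) n P (n + 1) 0
        (h'.reg ρBest) (h'.reg ρCut) (h'.reg ρFront)) := by
  set F : ℕ → ℕ → ℕ → Prop := fun k b₁ b₂ =>
    h.arr (αMin false) k b₁ 0 + h.arr (αMin true) (n - k) b₂ 0 + base < cap with hF
  have time : ∀ X Y : ℕ, 100 + (2500 + 18) * ((X + 1 + 1) * (Y + 1)) ≤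
      3000 * ((X + 2) * (Y + 1)) := fun X Y => by
    have : 1 ≤ (X + 2) * (Y + 1) := Nat.succ_le_of_lt (by positivity)
    rw [show X + 1 + 1 = X + 2 by rfl]
    generalize (X + 2) * (Y + 1) = Z at *
    omega
  refine HRuns.mono (.seq ((of_wp_le (T := 100) (Q := fun h' => h'.reg ρBest = P + 1 ∧
    h'.reg ρCut = 0 ∧ h'.reg ρFront = 0) hV (by simp [hP]; omega) (by decide)).mono le_rfl
    fun h1 f1 ⟨b1, c1, d1⟩ => (HRuns.forLoop hV (n + 1) (fun k h' => SearchState F n P k 0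
      (h'.reg ρBest) (h'.reg ρCut) (h'.reg ρFront)) (T := 2500 * (P + 1)) (by norm_num) rfl hnV
      ?_ ?_ ?_ fun _ _ h => h).mono (forTime_le_mul (c := 2500) (X := P + 1) (by decide)
        (by omega) le_rfl) fun _ _ h => h)) (time _ _) fun _ _ h => h
  · intro h' e
    refine ⟨⟨trivial, trivial⟩, ?_⟩
    simp only [HExp.eval]
    rw [e ρN (by norm_num) rfl, f1.reg ρN rfl, hn]
  · simp only [HState.reg_setReg, b1, c1, d1, show (25 : ℕ) ≠ 11 by norm_num,
      show (26 : ℕ) ≠ 11 by norm_num, show (27 : ℕ) ≠ 11 by norm_num, if_false]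
    exact ⟨le_rfl, Nat.zero_le _, Nat.zero_le _, fun h => absurd h (by omega),
      fun _ _ _ _ _ h => by omega⟩
  · rintro k hk h2 f2 hk2 s2
    refine HRuns.mono (.seq ((of_wp_le (T := 10) (Q := fun h' => h' = h2.setReg ρQ 0) hV
      (by simp) (by decide)).mono le_rfl fun h3 f3 e3 => HRuns.whileLoop (T := 1000)
        (Q := fun h' => SearchState F n P (k + 1) 0
          (h'.reg ρBest) (h'.reg ρCut) (h'.reg ρFront)) hV
        -- The measure adds the remaining values of `b` and the possible improvements.
        (fun m h' => m = P + 1 - h'.reg ρQ + h'.reg ρBest ∧ h'.reg ρQ ≤ P + 1 ∧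
          SearchState F n P k (h'.reg ρQ) (h'.reg ρBest) (h'.reg ρCut) (h'.reg ρFront))
        (P + 1 + h2.reg ρBest) ?_ (fun _ _ _ _ => by simp) ?_ ?_)) ?_ fun h' _ h => by simpa using h
    · rw [e3]; simpa using s2
    · rintro m h4 f4 ⟨rfl, hq4, s4⟩ hv
      have hP4 : h4.reg ρP = P :=
        (f4.reg ρP rfl).trans ((f3.reg ρP rfl).trans ((f2.reg ρP rfl).trans
          ((f1.reg ρP rfl).trans hP)))
      have hN4 : h4.reg ρN = n :=
        (f4.reg ρN rfl).trans ((f3.reg ρN rfl).trans ((f2.reg ρN rfl).trans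
          ((f1.reg ρN rfl).trans hn)))
      have hC4 : h4.reg ρCap = cap :=
        (f4.reg ρCap rfl).trans ((f3.reg ρCap rfl).trans ((f2.reg ρCap rfl).trans
          ((f1.reg ρCap rfl).trans hcap)))
      have hB4 : h4.reg ρBase = base :=
        (f4.reg ρBase rfl).trans ((f3.reg ρBase rfl).trans ((f2.reg ρBase rfl).trans
          ((f1.reg ρBase rfl).trans hbase)))
      have hJ4 : h4.reg ρJ = k :=
        (f4.reg ρJ rfl).trans ((f3.reg ρJ rfl).trans hk2)
      have ha : h4.arr = h.arr := funext fun t => (f4.arr t rfl).trans ((f3.arr t rfl).trans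
        ((f2.arr t rfl).trans (f1.arr t rfl)))
      have hq : h4.reg ρQ ≤ P := by
        simp only [HExp.eval, hP4] at hv
        by_contra hcon
        exact hv (if_neg (by omega))
      have g1 := s4.best_le
      have hif : improveExp.eval h4 =
          (if h4.reg ρQ < h4.reg ρBest then 1 else 0) *
          (if F k (h4.reg ρQ) (h4.reg ρBest - 1 - h4.reg ρQ) then 1 else 0) := by
        simp only [improveExp, HExp.eval, hJ4, hN4, hB4, hC4, ha, hF]
        rfl
      refine of_wp_le hV ?_ (by decide)
      simp only [searchStepCmd, Cmd.wp, HExp.eval, HExp.Safe]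
      refine ⟨by simp [improveExp], fun hne => ?_, fun heq => ?_⟩
      · rw [hif] at hne
        have hlt : h4.reg ρQ < h4.reg ρBest := by
          by_contra hcon
          simp [hcon] at hne
        have hFk : F k (h4.reg ρQ) (h4.reg ρBest - 1 - h4.reg ρQ) := by
          by_contra hcon
          rw [if_neg hcon] at hne
          simp at hne
        refine ⟨by norm_num, ⟨trivial, trivial⟩, by omega, by norm_num, trivial, ?_, by norm_num,
          trivial, ?_, P + 1 - h4.reg ρQ + (h4.reg ρBest - 1), by omega, ?_⟩
        · simp [hJ4]; omega
        · simp; omega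
        · simpa [hq4, hJ4] using s4.improve (by omega) hq hlt hFk
      · rw [hif] at heq
        refine ⟨by norm_num, ⟨trivial, trivial⟩, by omega,
          P + 1 - (h4.reg ρQ + 1) + h4.reg ρBest, by omega, ?_⟩
        have := s4.advance (fun b₂ b₂' h1 h2 h3 => (Nat.add_le_add_right (Nat.add_le_add_left
          (hmono k (by omega) b₂ b₂' h1 h2) _) _).trans_lt h3) fun hlt hFk => by
            rw [if_pos hlt, if_pos hFk] at heq
            omega
        simpa [hq] using this
    · rintro m h4 f4 ⟨-, hq4, s4⟩ hv
      have hP4 : h4.reg ρP = P :=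
        (f4.reg ρP rfl).trans ((f3.reg ρP rfl).trans ((f2.reg ρP rfl).trans
          ((f1.reg ρP rfl).trans hP)))
      have hq : h4.reg ρQ = P + 1 := by
        simp only [HExp.eval, hP4] at hv
        by_contra hcon
        rw [if_pos (by omega)] at hv
        exact absurd hv (by norm_num)
      rw [hq] at s4
      exact s4.next
    · have := s2.best_le
      simp only [HExp.compile, Exp.cost]
      omega

end RentSchedule

/-! ### Traceback and output -/

namespace RentSchedule

open Finset WordRAM

/-- The index of the `i`-th job that the dynamic program considers. -/
def jobIndex (n : ℕ) (dir : Bool) (i : ℕ) : ℕ := if dir then n - 1 - i else i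

/-- The class of a job with selection indicator `d`. -/
def classOf (dir : Bool) (d : ℕ) : ℕ := if dir then 2 - d else d

/-- One step of the traceback. -/
def traceStepCmd (dir : Bool) : Cmd :=
  .seq (.assign ρDec (.cell (αDec dir) (.var ρJ) (.var ρX) (.var ρQ))) <|
  .seq (.assign ρJ (.sub (.var ρJ) (.const 1))) <|
  .seq (.assign ρI (if dir then .sub (.sub (.var ρN) (.const 1)) (.var ρJ) else .var ρJ)) <|
  .seq (.put αCls (.var ρI) (.const 0) (.const 0)
    (if dir then .sub (.const 2) (.var ρDec) else .var ρDec)) <|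
  .seq (.assign ρX (.sub (.var ρX) (.mul (.var ρDec) (.mul (.var ρMu) (entry αW ρI))))) <|
  .assign ρQ (.sub (.var ρQ) (.mul (.var ρDec) (entry αP ρI)))

/-- Trace a selection back. -/
def traceCmd (dir : Bool) : Cmd := .while (.var ρJ) (traceStepCmd dir)

/-- The second conclusion is needed because the front and the back traceback write disjoint parts of
the same array. -/
theorem traceCmd_runs {V n K M j x q : ℕ} {p w r : ℕ → ℕ} {dir : Bool} {h : HState} (hV : 2 ≤ V)
    (hnV : n ≤ V) (hMV : M ≤ V) (hPV : (blockDP n K p w r dir).P ≤ V)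
    (hD : HasDP (blockDP n K p w r dir) n M h) (hp : Lists h αP n p) (hw : Lists h αW n w)
    (hF : Filled (blockDP n K p w r dir) M (n + 1) 0 0 h) (hJ : h.reg ρJ = j) (hX : h.reg ρX = x)
    (hQ : h.reg ρQ = q) (hj : j ≤ n) (hx : x ≤ M) (hq : q ≤ (blockDP n K p w r dir).P) :
    HRuns V (traceCmd dir) h (2000 * (n + 1)) (fun h' =>
      (∀ i < j, h'.arr αCls (jobIndex n dir i) 0 0 =
        classOf dir ((blockDP n K p w r dir).trace j x q i)) ∧
      ∀ i, (∀ i' < j, jobIndex n dir i' ≠ i) → h'.arr αCls i 0 0 = h.arr αCls i 0 0) := by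
  set D := blockDP n K p w r dir with hDdef
  refine (HRuns.whileLoop (T := 1900) hV (fun m h' => h'.reg ρJ = m ∧ m ≤ j ∧ h'.reg ρX ≤ M ∧
      -- The trace from the current state agrees with the full trace on the jobs that are still to
      -- be classified.
      h'.reg ρQ ≤ D.P ∧ (∀ i < m, D.trace m (h'.reg ρX) (h'.reg ρQ) i = D.trace j x q i) ∧
      (∀ i < j, m ≤ i → h'.arr αCls (jobIndex n dir i) 0 0 = classOf dir (D.trace j x q i)) ∧
      ∀ i, (∀ i' < j, jobIndex n dir i' ≠ i) → h'.arr αCls i 0 0 = h.arr αCls i 0 0) j ?_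
      ?_ ?_ ?_).mono ?_ fun _ _ h => h
  · exact ⟨hJ, le_rfl, hX ▸ hx, hQ ▸ hq, fun i _ => by rw [hX, hQ],
      fun i h1 h2 => absurd h1 (by omega), fun _ _ => rfl⟩
  · exact fun _ _ _ _ => trivial
  · rintro m h1 f1 ⟨e1, e2, e3, e4, e5, e6, e7⟩ hv
    obtain ⟨m, rfl⟩ : ∃ i, m = i + 1 := Nat.exists_eq_succ_of_ne_zero (by rw [← e1]; exact hv)
    have hN1 : h1.reg ρN = n := (f1.reg ρN rfl).trans hD.n
    have hmu1 : h1.reg ρMu = D.μ := (f1.reg ρMu rfl).trans hD.mu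
    have hd : h1.arr (αDec dir) (m + 1) (h1.reg ρX) (h1.reg ρQ) =
        D.decision (m + 1) (h1.reg ρX) (h1.reg ρQ) := by
      rw [f1.arr _ (by cases dir <;> rfl)]
      exact (hF (m + 1) _ _ e3 e4 (by omega)).2
    have hdle := D.decision_le_one (m + 1) (h1.reg ρX) (h1.reg ρQ)
    set d := D.decision (m + 1) (h1.reg ρX) (h1.reg ρQ) with hddef
    have hi : jobIndex n dir m < n := by unfold jobIndex; split <;> omega
    have hpi : h1.arr αP (jobIndex n dir m) 0 0 = D.p m := by
      rw [f1.arr _ rfl, hp _ hi]; cases dir <;> rfl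
    have hwi : h1.arr αW (jobIndex n dir m) 0 0 = D.w m := by
      rw [f1.arr _ rfl, hw _ hi]; cases dir <;> rfl
    have hinj : ∀ i < n, jobIndex n dir i = jobIndex n dir m → i = m := by
      intro i hi h
      unfold jobIndex at h
      split at h <;> omega
    have ex : ∀ h' : HState, h'.reg ρN = n → h'.reg ρJ = m →
        (if dir then HExp.sub (.sub (.var ρN) (.const 1)) (.var ρJ) else .var ρJ).eval h' =
          jobIndex n dir m := by
      intro h' g1 g2
      cases dir <;> simp [g1, g2, jobIndex]
    have ey : ∀ h' : HState, h'.reg ρDec = d →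
        (if dir then HExp.sub (.const 2) (.var ρDec) else .var ρDec).eval h' = classOf dir d := by
      intro h' g1
      cases dir <;> simp [g1, classOf]
    have sx : ∀ h' : HState,
        (if dir then HExp.sub (.sub (.var ρN) (.const 1)) (.var ρJ) else .var ρJ).Safe h' := by
      intro h'; cases dir <;> simp
    have sy : ∀ h' : HState,
        (if dir then HExp.sub (.const 2) (.var ρDec) else .var ρDec).Safe h' := by
      intro h'; cases dir <;> simp
    have hcl : classOf dir d ≤ V := by unfold classOf; split <;> omega
    refine of_wp_le hV ?_ (by cases dir <;> decide)
    simp only [traceStepCmd, Cmd.wp, sx, sy]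
    rw [ex _ (by simp [hN1]) (by simp [e1]), ey _ (by simp [e1, hd])]
    simp only [entry, HExp.Safe, HExp.eval, HState.reg_setReg, HState.reg_setArr,
      HState.arr_setReg, HState.arr_setArr, e1, hd, hmu1]
    simp only [if_true, if_false, Nat.reduceEqDiff, Nat.add_sub_cancel, false_and, hpi, hwi]
    have tr : ∀ i, D.trace (m + 1) (h1.reg ρX) (h1.reg ρQ) i = if i = m then d else
        D.trace m (h1.reg ρX - d * (D.μ * D.w m)) (h1.reg ρQ - d * D.p m) i := fun i => rfl
    refine ⟨by norm_num, ⟨trivial, trivial, trivial⟩, by omega, by norm_num, ⟨trivial, trivial⟩,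
      by omega, by norm_num, trivial, by omega, trivial, trivial, trivial, trivial, hcl,
      by norm_num, ⟨trivial, trivial, trivial, trivial, trivial, trivial⟩, by omega, by norm_num,
      ⟨trivial, trivial, trivial, trivial, trivial⟩, by omega, m, by omega, rfl, by omega,
      by omega, by omega, fun i hi => ?_, fun i hi hmi => ?_, fun i hi => ?_⟩
    · rw [← e5 i (by omega), tr, if_neg (by omega)]
    · by_cases him : i = m
      · subst him
        have := e5 i (by omega)
        rw [tr, if_pos rfl] at this
        simp [this]
      · rw [if_neg fun hc => him (hinj i (by omega) hc.2.1)]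
        exact e6 i hi (by omega)
    · rw [if_neg fun hc => hi m (by omega) hc.2.1.symm]
      exact e7 i hi
  · rintro m h1 f1 ⟨e1, e2, e3, e4, e5, e6, e7⟩ hv
    have : m = 0 := by rw [← e1]; exact hv
    subst this
    exact ⟨fun i hi => e6 i hi (Nat.zero_le _), e7⟩
  · simp only [HExp.compile, Exp.cost]
    omega

/-- Load the end of the traceback and trace the selection back. -/
def traceBackCmd (dir : Bool) : Cmd :=
  .seq (.seq (.assign ρJ (if dir then .sub (.var ρN) (.var ρCut) else .var ρCut)) <|
    .seq (.assign ρI (if dir then .sub (.var ρBest) (.var ρFront) else .var ρFront)) <|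
    .seq (.assign ρX (.cell (αMinX dir) (.var ρJ) (.var ρI) (.const 0)))
      (.assign ρQ (.cell (αMinQ dir) (.var ρJ) (.var ρI) (.const 0)))) <|
  traceCmd dir

theorem traceBackCmd_runs {V n K M j b m x q : ℕ} {p w r : ℕ → ℕ} {dir : Bool} {h : HState}
    (hV : 2 ≤ V) (hnV : n ≤ V) (hMV : M ≤ V) (hPV : (blockDP n K p w r dir).P ≤ V)
    (hD : HasDP (blockDP n K p w r dir) n M h) (hp : Lists h αP n p) (hw : Lists h αW n w)
    (hF : Filled (blockDP n K p w r dir) M (n + 1) 0 0 h)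
    (hJ : (if dir then h.reg ρN - h.reg ρCut else h.reg ρCut) = j)
    (hB : (if dir then h.reg ρBest - h.reg ρFront else h.reg ρFront) = b)
    (hX : h.arr (αMinX dir) j b 0 = x) (hQ : h.arr (αMinQ dir) j b 0 = q)
    (hm : (blockDP n K p w r dir).IsMin M j b m x q) (hlt : m < (blockDP n K p w r dir).cap)
    (hj : j ≤ n) (hb : b ≤ (blockDP n K p w r dir).P) :
    HRuns V (traceBackCmd dir) h (3000 * (n + 1)) (fun h' =>
      (∀ i < j, h'.arr αCls (jobIndex n dir i) 0 0 =
        classOf dir ((blockDP n K p w r dir).trace j x q i)) ∧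
      ∀ i, (∀ i' < j, jobIndex n dir i' ≠ i) → h'.arr αCls i 0 0 = h.arr αCls i 0 0) := by
  obtain ⟨hx, hqb, -⟩ := hm.attained hlt
  have hq := hqb.trans hb
  refine HRuns.mono (.seq ((of_wp_le (T := 900) (Q := fun h' => h'.reg ρJ = j ∧ h'.reg ρX = x ∧
    h'.reg ρQ = q) hV ?_ (by cases dir <;> decide)).mono le_rfl fun h1 f1 ⟨j1, x1, q1⟩ =>
      (traceCmd_runs hV hnV hMV hPV (hD.congr fun r h1 h2 => f1.reg r (by
        interval_cases r <;> rfl)) (hp.congr (f1.arr _ rfl)) (hw.congr (f1.arr _ rfl))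
        (hF.congr (f1.arr _ rfl) (f1.arr _ rfl)) j1 x1 q1 hj hx hq).mono le_rfl
        fun h2 _ ⟨a, b⟩ => ⟨a, fun i hi => (b i hi).trans (by rw [f1.arr _ rfl])⟩)) (by omega)
    fun _ _ h => h
  cases dir
  all_goals
    simp only [if_true, if_false, Bool.false_eq_true] at hJ hB
    simp [hJ, hB, hX, hQ]
    omega

/-- The comparison of two jobs by their classes and their positions in the order. -/
def classExp : HExp :=
  .add (.lt (entry αCls ρI) (entry αCls ρJ))
    (.mul (.sub (.const 1) (.lt (entry αCls ρJ) (entry αCls ρI))) (.lt (.var ρI) (.var ρJ)))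

/-- Write the jobs to the low memory, sorted by classes. -/
def outputCmd : Cmd :=
  .seq (.forLoop ρJ (.var ρN) <| .seq (rankCmd classExp) (.out (.var ρRank) (entry αOrd ρJ)))
    (.assign 0 (.const 1))

/-- The output overwrites the input, which is no longer needed: the order and the classes are in
arrays beyond the low memory. -/
theorem outputCmd_runs {n V : ℕ} {ord cls : ℕ → ℕ} {h : HState} (hV : 2 ≤ V) (hnV : n ≤ V)
    (hn : h.reg ρN = n) (hoff : n ≤ h.reg ρOff) (hord : Lists h αOrd n ord)
    (hcls : Lists h αCls n cls) (hoV : ∀ i < n, ord i ≤ V) :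
    HRuns V outputCmd h (12000 * ((n + 1) * (n + 1))) (fun h' => h'.reg 0 = 1 ∧
      ∀ j : Fin n, h'.low (rank (classKey cls) j) = ord j) := by
  refine HRuns.mono (.seq ((HRuns.forLoop hV n (fun k h' => ∀ j : Fin n, (j : ℕ) < k →
    h'.low (rank (classKey cls) j) = ord j) (T := 2000 * (n + 1) + 8000)
    (Q := fun h' => ∀ j : Fin n, h'.low (rank (classKey cls) j) = ord j) (by norm_num) rfl hnV ?_
    (by simp) ?_ fun h' _ H j => H j j.2).mono
    (forTime_le_mul (c := 10000) (X := n + 1) (by decide) (by omega) (by omega)) fun h1 f1 H1 =>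
      of_wp_le (T := 10) hV (by simpa using ⟨by omega, H1⟩) (by decide))) ?_ fun _ _ h => h
  · intro h' f
    exact ⟨trivial, by rw [← hn]; exact f ρN (by norm_num) rfl⟩
  · intro k hk h' f hj hinv
    have eo : h'.reg ρOff = h.reg ρOff := f.reg ρOff rfl
    have o1 := hord.congr (f.arr _ rfl)
    have c1 := hcls.congr (f.arr _ rfl)
    refine .seq ((rankCmd_runs (classKey cls) ⟨k, hk⟩ hV hnV ((f.reg ρN rfl).trans hn)
      (by decide) ?_).mono le_rfl fun h1 f1 e1 => of_wp_le hV ?_ (by decide))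
    · intro h1 e1 e2 e3 i hi
      have hj1 : h1.reg ρJ = k := (e1 11 (by norm_num) (by norm_num)).trans hj
      have d1 := c1 i i.2
      have d2 := c1 k hk
      rw [classKey_lt_iff]
      constructor
      · simp [classExp, entry]
      · simp only [classExp, entry, HExp.eval, hj1, hi, e2, d1, d2]
        rw [Fin.lt_def]
        simp only
        split_ifs <;> simp <;> omega
    · have hj1 : h1.reg ρJ = k := (f1.reg ρJ rfl).trans hj
      have hr := rank_lt (classKey cls) ⟨k, hk⟩
      have o2 : h1.arr αOrd k 0 0 = ord k := o1.congr (f1.arr _ rfl) k hk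
      have hl := f1.low rfl
      have g1 : h1.reg ρOff = h.reg ρOff := (f1.reg ρOff rfl).trans eo
      have hk' := hoV k hk
      simp only [entry, Cmd.wp, HExp.eval, HExp.Safe, hj1, g1, e1, o2, HState.low_setReg,
        HState.low_setLow]
      refine ⟨trivial, ⟨trivial, trivial, trivial⟩, by omega, hk', fun j hjk => ?_⟩
      by_cases hjk' : (j : ℕ) = k
      · subst hjk'
        simp
      · have hne : rank (classKey cls) j ≠ rank (classKey cls) ⟨k, hk⟩ := by
          obtain ⟨e, he⟩ := exists_perm_rank _ (classKey_injective (n := n) cls)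
          rw [← he, ← he]
          intro hc
          exact hjk' (congrArg Fin.val (e.injective (Fin.ext hc)))
        rw [if_neg hne, hl]
        exact hinv j (by omega)
  · have : 1 ≤ (n + 1) * (n + 1) := Nat.succ_le_of_lt (by positivity)
    omega

end RentSchedule

/-! ### Correctness and running time of the whole algorithm -/

namespace RentSchedule

open Finset WordRAM

section

variable {I : RentInstance} {π : Equiv.Perm (Fin I.n)} {V : ℕ} {h : HState}

/-- The dynamic program for the jobs of `I` in the order `π`. -/
def instanceDP (I : RentInstance) (π : Equiv.Perm (Fin I.n)) (dir : Bool) : SelectDP :=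
  blockDP I.n I.K (sortedP I π) (sortedW I π) (sortedR I π) dir

theorem instanceDP_P (dir : Bool) : (instanceDP I π dir).P = I.P := sum_sortedP I π

theorem instanceDP_cap (dir : Bool) : (instanceDP I π dir).cap = I.K + I.P * I.W + 1 := by
  rw [← sum_sortedP I π, ← sum_sortedW I π]; rfl

theorem instanceDP_mu (dir : Bool) :
    (instanceDP I π dir).μ = if I.W < I.P then 1 else 0 := by
  rw [← sum_sortedP I π, ← sum_sortedW I π]; rfl

theorem HasParams.hasDP (H : HasParams I h) (dir : Bool) :
    HasDP (instanceDP I π dir) I.n (min I.W I.P) h where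
  n := H.n
  P := by rw [H.P, instanceDP_P]
  M := H.M
  mu := by rw [H.mu, instanceDP_mu]
  cap := by rw [H.cap, instanceDP_cap]

/-- The total weighted completion time of the order `π`. -/
def sortedCost (I : RentInstance) (π : Equiv.Perm (Fin I.n)) : ℕ :=
  seqCost I.n (sortedP I π) (sortedW I π) id

/-- The dynamic programs for both directions are solved. -/
structure IsSolved (I : RentInstance) (π : Equiv.Perm (Fin I.n)) (h : HState) : Prop where
  params : HasParams I h
  sorted : HasSorted I π h
  base : h.reg ρBase = sortedCost I π
  filled : ∀ dir, Filled (instanceDP I π dir) (min I.W I.P) (I.n + 1) 0 0 h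
  minFilled : ∀ dir, MinFilled (instanceDP I π dir) (min I.W I.P) (I.n + 1) 0 h

theorem IsSolved.isMin (H : IsSolved I π h) (dir : Bool) {k b : ℕ} (hk : k ≤ I.n) (hb : b ≤ I.P) :
    (instanceDP I π dir).IsMin (min (∑ i ∈ range I.n, sortedW I π i) (∑ i ∈ range I.n, sortedP I π i))
      k b (h.arr (αMin dir) k b 0) (h.arr (αMinX dir) k b 0) (h.arr (αMinQ dir) k b 0) := by
  rw [sum_sortedP, sum_sortedW]
  exact H.minFilled dir k b (by rw [instanceDP_P]; exact hb) (.inl (Nat.lt_succ_of_le hk))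

theorem dpCmd_writes (dir : Bool) {r : ℕ} (hr : r < ρPre) (hr' : r ≠ ρJ) :
    (dpCmd dir).writes r = false := by
  simp [dpCmd, Cmd.forLoop, Cmd.writes, stageCmd_writes dir hr]
  omega

/-- Solve the dynamic programs for both directions. -/
def solveCmd : Cmd :=
  .seq readCmd <| .seq sortCmd <| .seq baseCmd <| .seq (dpCmd false) (dpCmd true)

theorem solveCmd_runs (hp : ∀ j, 0 < I.p j) (hπ : IsSorted I π) (hV : FitsIn I V)
    (hI : HasInput I h) :
    HRuns V solveCmd h (1000 * (I.n + 1) + (10018 * ((I.n + 1) * (I.n + 1)) + (3000 * (I.n + 1) +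
      (70000 * ((I.n + 2) * ((I.P + 2) * (min I.W I.P + 2))) +
        70000 * ((I.n + 2) * ((I.P + 2) * (min I.W I.P + 2)))))))
      (IsSolved I π) := by
  have ⟨v1, v2, v3, v4, v5, v6⟩ := hV
  have hsort := hπ.mul_le_mul hp
  have hpV : ∀ i < I.n, sortedP I π i ≤ V := fun i hi => by
    rw [sortedP, extend_of_lt _ hi]; have := p_le_P I (π ⟨i, hi⟩); omega
  have hwV : ∀ i < I.n, sortedW I π i ≤ V := fun i hi => by
    rw [sortedW, extend_of_lt _ hi]; have := w_le_W I (π ⟨i, hi⟩); omega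
  have hrV : ∀ i < I.n, sortedR I π i ≤ V := fun i hi => by
    rw [sortedR, extend_of_lt _ hi]; split <;> omega
  have hdp : ∀ dir h', HasParams I h' → HasSorted I π h' → HRuns V (dpCmd dir) h'
      (70000 * ((I.n + 2) * ((I.P + 2) * (min I.W I.P + 2)))) (fun h'' =>
        Filled (instanceDP I π dir) (min I.W I.P) (I.n + 1) 0 0 h'' ∧
        MinFilled (instanceDP I π dir) (min I.W I.P) (I.n + 1) 0 h'') := fun dir h' H S => by
    have := dpCmd_runs (h := h') (M := min I.W I.P) v1
      (blockDP_valid I.n I.K (sortedR I π) dir hsort)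
      ((instanceDP_cap (π := π) dir).le.trans v6) (by omega)
      (by have := instanceDP_P (π := π) dir; unfold instanceDP at this; omega) v2 hpV hwV hrV
      (H.hasDP (π := π) dir) S.p S.w S.r
    rwa [show (blockDP I.n I.K (sortedP I π) (sortedW I π) (sortedR I π) dir).P = I.P from
      instanceDP_P (π := π) dir] at this
  refine .seq ((readCmd_runs hV hI).mono le_rfl fun h1 f1 P1 => .seq
    ((sortCmd_runs hp hπ hV ?_ P1.n).mono le_rfl fun h2 f2 S2 => .seq
    ((baseCmd_runs v1 (by omega) (by rw [sum_sortedP]; omega)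
      (by rw [sum_sortedP, sum_sortedW]; omega)
      ((f2.reg ρN rfl).trans P1.n) S2.p S2.w).mono le_rfl fun h3 f3 b3 => .seq
    ((hdp false h3 ?_ ?_).mono le_rfl fun h4 f4 ⟨F4, M4⟩ =>
    (hdp true h4 ?_ ?_).mono le_rfl fun h5 f5 ⟨F5, M5⟩ => ?_))))
  · have hl : h1.low = h.low := f1.low rfl
    exact ⟨P1.off, by rw [hl, hI.n], by rw [hl, hI.K], by rw [hl]; exact hI.p,
      by rw [hl]; exact hI.w, by rw [hl]; exact hI.r⟩
  · exact P1.congr fun r h1 h2 => (f3.reg r (by interval_cases r <;> rfl)).trans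
      (f2.reg r (by interval_cases r <;> rfl))
  · exact S2.congr fun t _ => f3.arr t rfl
  · exact P1.congr fun r h1 h2 => (f4.reg r (dpCmd_writes _ (by omega) (by omega))).trans
      ((f3.reg r (by interval_cases r <;> rfl)).trans (f2.reg r (by interval_cases r <;> rfl)))
  · exact S2.congr fun t _ => (f4.arr t (by interval_cases t <;> rfl)).trans (f3.arr t rfl)
  · refine ⟨P1.congr fun r h1 h2 => (f5.reg r (dpCmd_writes _ (by omega) (by omega))).trans
      ((f4.reg r (dpCmd_writes _ (by omega) (by omega))).trans
      ((f3.reg r (by interval_cases r <;> rfl)).trans (f2.reg r (by interval_cases r <;> rfl)))),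
      S2.congr fun t _ => (f5.arr t (by interval_cases t <;> rfl)).trans
        ((f4.arr t (by interval_cases t <;> rfl)).trans (f3.arr t rfl)),
      (f5.reg ρBase (dpCmd_writes _ (by omega) (by omega))).trans
        ((f4.reg ρBase (dpCmd_writes _ (by omega) (by omega))).trans b3), ?_, ?_⟩
    · rintro (_ | _)
      · exact F4.congr (f5.arr _ rfl) (f5.arr _ rfl)
      · exact F5
    · rintro (_ | _)
      · exact M4.congr (f5.arr _ rfl) (f5.arr _ rfl) (f5.arr _ rfl)
      · exact M5

/-- Some selection whose jobs before and after the cut `k` have total processing times at most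
`b₁` and `b₂` respects the budget. -/
def IsWithinBudget (I : RentInstance) (π : Equiv.Perm (Fin I.n)) (h : HState) (k b₁ b₂ : ℕ) : Prop :=
  h.arr (αMin false) k b₁ 0 + h.arr (αMin true) (I.n - k) b₂ 0 + sortedCost I π <
    I.K + I.P * I.W + 1

/-- The block of `τ` and its cut form a pair of bounds that the search has examined. The second
bound shows that a search without success proves infeasibility. -/
theorem best_le_of_twc_le {best cut front : ℕ} (hp : ∀ j, 0 < I.p j) (hπ : IsSorted I π)
    (H : IsSolved I π h)
    (hs : SearchState (IsWithinBudget I π h) I.n I.P (I.n + 1) 0 best cut front)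
    {τ : Equiv.Perm (Fin I.n)} (hτ : I.twc τ ≤ I.K) : best ≤ I.er τ ∧ best ≤ I.P := by
  obtain ⟨S, k, hk, h1, h2, h3, h4⟩ := exists_selection_of_twc_le hp hπ hτ
  have hsum := selSum_add_selSum_revSeq hk S (sortedP I π)
  have hle : selSum S (sortedP I π) I.n ≤ I.P :=
    (selSum_le h1).trans (sum_sortedP I π).le
  have hb₁ : selSum S (sortedP I π) k ≤ I.P := by omega
  have hb₂ : selSum (revSeq I.n S) (revSeq I.n (sortedP I π)) (I.n - k) ≤ I.P := by omega
  have hlt := lt_cap_of_blockCost_le (hπ.mul_le_mul hp) hk (H.isMin false hk hb₁)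
    (H.isMin true (Nat.sub_le _ k) hb₂) h1 h2 le_rfl le_rfl h4
  rw [sum_sortedP, sum_sortedW] at hlt
  have := hs.le k _ _ hb₁ hb₂ (.inl (by omega)) hlt
  omega

/-- All additive constants are absorbed, because `n`, `P` and `M` are positive; the quadratic
sorting time is absorbed by `n ≤ P`. -/
theorem rent_time_le {n P M : ℕ} (hn : 0 < n) (hnP : n ≤ P) (hM : 0 < M) :
    1000 * (n + 1) + (10018 * ((n + 1) * (n + 1)) + (3000 * (n + 1) +
      (70000 * ((n + 2) * ((P + 2) * (M + 2))) + 70000 * ((n + 2) * ((P + 2) * (M + 2)))))) +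
      (3000 * ((n + 2) * (P + 1)) + (5 + 1 + (3000 * (n + 1) + (3000 * (n + 1) +
        12000 * ((n + 1) * (n + 1)))))) ≤ 10000000 * (n * P * M) := by
  have e1 : (n + 2) * ((P + 2) * (M + 2)) ≤ 27 * (n * P * M) :=
    (Nat.mul_le_mul (show n + 2 ≤ 3 * n by omega) (Nat.mul_le_mul (show P + 2 ≤ 3 * P by omega)
      (show M + 2 ≤ 3 * M by omega))).trans (by ring_nf; rfl)
  have e2 : (n + 1) * (n + 1) ≤ 4 * (n * P * M) :=
    (Nat.mul_le_mul (show n + 1 ≤ 2 * n by omega) (show n + 1 ≤ 2 * P by omega)).trans (by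
      have := Nat.le_mul_of_pos_right (n * P) hM
      linarith)
  have e3 : (n + 2) * (P + 1) ≤ 6 * (n * P * M) :=
    (Nat.mul_le_mul (show n + 2 ≤ 3 * n by omega) (show P + 1 ≤ 2 * P by omega)).trans (by
      have := Nat.le_mul_of_pos_right (n * P) hM
      linarith)
  have e4 : n + 1 ≤ (n + 1) * (n + 1) := Nat.le_mul_of_pos_right _ (by omega)
  omega

/-- The whole algorithm on the structured layer. -/
def rentCmd : Cmd :=
  .seq solveCmd <| .seq searchCmd <|
    .ite (.lt (.var ρBest) (.add (.var ρP) (.const 1)))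
      (.seq (traceBackCmd false) (.seq (traceBackCmd true) outputCmd)) .skip

theorem rentCmd_runs (hp : ∀ j, 0 < I.p j) (hV : FitsIn I V) (hI : HasInput I h)
    (h0 : h.reg 0 = 0) (hn : 0 < I.n) (hW : 0 < I.W) :
    HRuns V rentCmd h (10000000 * (I.n * I.P * min I.W I.P)) (fun h' =>
      (h'.reg 0 = 1 ∧ ∃ σ : Equiv.Perm (Fin I.n), I.IsOptimal σ ∧
        ∀ i : Fin I.n, h'.low i = (σ i : ℕ)) ∨
      (h'.reg 0 = 0 ∧ ∀ σ : Equiv.Perm (Fin I.n), I.K < I.twc σ)) := by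
  obtain ⟨π, hπ⟩ := exists_isSorted I
  have ⟨v1, v2, v3, v4, v5, v6⟩ := hV
  have hsort := hπ.mul_le_mul hp
  refine HRuns.mono (.seq ((solveCmd_runs hp hπ hV hI).mono le_rfl fun h1 f1 H1 => .seq
    ((searchCmd_runs v1 v2 v4 H1.params.n H1.params.P H1.params.cap H1.base ?_).mono le_rfl
      fun h2 f2 S2 => .ite v1 (T := 3000 * (I.n + 1) + (3000 * (I.n + 1) +
        12000 * ((I.n + 1) * (I.n + 1)))) ⟨trivial, trivial, trivial⟩ ?_ ?_))) ?_ fun _ _ h => h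
  · intro k hk b b' hb hb'
    exact (H1.isMin true (Nat.sub_le _ k) (hb.trans hb')).mono
      (H1.isMin true (Nat.sub_le _ k) hb') hb
  · intro hv
    change SearchState (IsWithinBudget I π h1) I.n I.P (I.n + 1) 0 (h2.reg ρBest) (h2.reg ρCut)
      (h2.reg ρFront) at S2
    have P2 : HasParams I h2 := H1.params.congr fun r a b => f2.reg r (by
      interval_cases r <;> rfl)
    have hbest : h2.reg ρBest ≤ I.P := by
      simp only [HExp.eval, P2.P] at hv
      by_contra hcon
      exact hv (if_neg (by omega))
    obtain ⟨hfb, hF⟩ := S2.attained hbest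
    have hcut := S2.cut_le
    have ha : ∀ t, h2.arr t = h1.arr t := fun t => f2.arr t rfl
    have m₁ := H1.isMin false hcut S2.front_le
    have m₂ := H1.isMin true (b := h2.reg ρBest - h2.reg ρFront) (Nat.sub_le _ (h2.reg ρCut))
      (by omega)
    set x₁ := h1.arr (αMinX false) (h2.reg ρCut) (h2.reg ρFront) 0 with hx₁
    set q₁ := h1.arr (αMinQ false) (h2.reg ρCut) (h2.reg ρFront) 0 with hq₁
    set x₂ := h1.arr (αMinX true) (I.n - h2.reg ρCut) (h2.reg ρBest - h2.reg ρFront) 0 with hx₂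
    set q₂ := h1.arr (αMinQ true) (I.n - h2.reg ρCut) (h2.reg ρBest - h2.reg ρFront) 0 with hq₂
    unfold IsWithinBudget at hF
    have l₁ : h1.arr (αMin false) (h2.reg ρCut) (h2.reg ρFront) 0 < (instanceDP I π false).cap := by
      rw [instanceDP_cap]; omega
    have l₂ : h1.arr (αMin true) (I.n - h2.reg ρCut) (h2.reg ρBest - h2.reg ρFront) 0 <
        (instanceDP I π true).cap := by
      rw [instanceDP_cap]; omega
    rw [← sum_sortedP I π, ← sum_sortedW I π] at hF
    obtain ⟨s1, s2, s3, s4⟩ := tracedSelection_spec hsort hcut m₁ m₂ hF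
    set S := tracedSelection I.n I.K (sortedP I π) (sortedW I π) (sortedR I π) (h2.reg ρCut)
      x₁ q₁ x₂ q₂ with hS
    rw [sum_sortedP, sum_sortedW] at m₁ m₂
    refine .seq ((traceBackCmd_runs (dir := false) (b := h2.reg ρFront) v1 (by omega)
      (by omega) ((instanceDP_P (π := π) false).le.trans (by omega)) (P2.hasDP (π := π) false)
      (H1.sorted.p.congr (ha _)) (H1.sorted.w.congr (ha _))
      ((H1.filled false).congr (ha _) (ha _)) rfl rfl (congrFun (congrFun (congrFun (ha _) _) _) _)
      (congrFun (congrFun (congrFun (ha _) _) _) _) m₁ l₁ hcut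
      (S2.front_le.trans (instanceDP_P (π := π) false).ge)).mono le_rfl fun h3 f3 ⟨c3, d3⟩ => .seq
      ((traceBackCmd_runs (dir := true) (j := I.n - h2.reg ρCut)
      (b := h2.reg ρBest - h2.reg ρFront) v1 (by omega)
      (by omega) ((instanceDP_P (π := π) true).le.trans (by omega))
      ((P2.congr fun r a b => f3.reg r (by interval_cases r <;> rfl)).hasDP (π := π) true)
      (H1.sorted.p.congr ((f3.arr _ rfl).trans (ha _)))
      (H1.sorted.w.congr ((f3.arr _ rfl).trans (ha _)))
      ((H1.filled true).congr ((f3.arr _ rfl).trans (ha _)) ((f3.arr _ rfl).trans (ha _)))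
      (by rw [if_pos rfl, f3.reg ρN rfl, f3.reg ρCut rfl, P2.n])
      (by rw [if_pos rfl, f3.reg ρBest rfl, f3.reg ρFront rfl])
      (by rw [f3.arr _ rfl, ha]) (by rw [f3.arr _ rfl, ha]) m₂ l₂ (Nat.sub_le _ _)
      (le_trans (by omega) (instanceDP_P (π := π) true).ge)).mono le_rfl fun h4 f4 ⟨c4, d4⟩ => ?_))
    have hcls : Lists h4 αCls I.n (blockClass S (h2.reg ρCut)) := by
      intro i hi
      by_cases hic : i < h2.reg ρCut
      -- Entries before the cut come from the first traceback and survive the second.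
      · rw [d4 i fun i' hi' => by unfold jobIndex; rw [if_pos rfl]; omega]
        have := c3 i hic
        simpa [blockClass, hic, hS, tracedSelection, jobIndex, classOf] using this
      · have := c4 (I.n - 1 - i) (by omega)
        simp only [jobIndex, classOf, if_true] at this
        rw [show I.n - 1 - (I.n - 1 - i) = i by omega] at this
        simpa [blockClass, hic, hS, tracedSelection] using this
    refine (outputCmd_runs v1 (by omega) ((f4.reg ρN rfl).trans ((f3.reg ρN rfl).trans P2.n)) ?_
      (H1.sorted.ord.congr ((f4.arr _ rfl).trans ((f3.arr _ rfl).trans (ha _)))) hcls ?_).mono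
        le_rfl fun h5 _ ⟨o1, o2⟩ => .inl ⟨o1, ?_⟩
    · rw [f4.reg ρOff rfl, f3.reg ρOff rfl, P2.off]; omega
    · intro i hi
      rw [extend_of_lt _ hi]
      have := (π ⟨i, hi⟩).2
      omega
    · obtain ⟨e, he⟩ := exists_perm_rank _ (classKey_injective (n := I.n) (blockClass S (h2.reg ρCut)))
      obtain ⟨t1, t2⟩ := twc_le_and_er_le hcut s1 s2 s4 (fun _ _ => rfl) he
      refine ⟨e.symm.trans π, ⟨t1, fun τ hτ => ?_⟩, fun i => ?_⟩
      -- The renting period is at most the selected time, hence at most `front + (best - front) =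
      -- best`.
      · have := (best_le_of_twc_le hp hπ H1 S2 hτ).1
        omega
      · obtain ⟨j, rfl⟩ := e.surjective i
        rw [he, o2]
        simp
  · intro hv
    have hP : h2.reg ρP = I.P := (f2.reg ρP rfl).trans H1.params.P
    refine (HRuns.skip (.inr ⟨?_, fun σ => ?_⟩)).mono (by omega) fun _ _ h => h
    -- Register `0` is written only by the output, so it still has its initial value.
    · rw [f2.reg 0 rfl, f1.reg 0 ?_, h0]
      simp [solveCmd, Cmd.writes, dpCmd_writes]
      exact ⟨rfl, rfl, rfl⟩
    · by_contra hcon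
      have := (best_le_of_twc_le hp hπ H1 S2 (not_lt.1 hcon)).2
      simp only [HExp.eval, hP] at hv
      rw [if_pos (by omega)] at hv
      exact absurd hv (by norm_num)
  · have hnP : I.n ≤ I.P := by
      have : ∑ _j : Fin I.n, 1 ≤ I.P := sum_le_sum fun j _ => hp j
      simpa using this
    have hM : 0 < min I.W I.P := by omega
    exact rent_time_le hn hnP hM

end

end RentSchedule

/-! ### The initial state and the theorem -/

namespace RentSchedule

open Finset WordRAM

theorem getD_flatMap_of_length_eq {α : Type*} {m : ℕ} (f : α → List ℕ) (hf : ∀ a, (f a).length = m)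
    (l : List α) (i k : ℕ) (hi : i < l.length) (hk : k < m) :
    (l.flatMap f).getD (m * i + k) 0 = (f l[i]).getD k 0 := by
  induction l generalizing i with
  | nil => simp at hi
  | cons a l ih =>
    rw [List.flatMap_cons]
    cases i with
    | zero => rw [List.getD_append _ _ _ _ (by rw [hf]; omega)]; simp
    | succ i =>
      rw [List.getD_append_right _ _ _ _ (by rw [hf, Nat.mul_succ]; omega), hf,
        show m * (i + 1) + k - m = m * i + k by rw [Nat.mul_succ]; omega,
        ih i (by simpa using hi)]
      simp

theorem input_getD (I : RentInstance) (j : Fin I.n) {k : ℕ} (hk : k < 3) :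
    I.input.getD (3 * j + k + 2) 0 =
      [I.p j, I.w j, if j ∈ I.Jr then 1 else 0].getD k 0 := by
  have := getD_flatMap_of_length_eq (m := 3)
    (fun j => [I.p j, I.w j, if j ∈ I.Jr then 1 else 0]) (fun _ => rfl) (List.finRange I.n) j k
    (by simp) hk
  simpa [RentInstance.input] using this

theorem input_getD_le (I : RentInstance) (a : ℕ) :
    I.input.getD a 0 ≤ I.n + I.P + I.W + I.K + 2 := by
  rw [List.getD_eq_getElem?_getD]
  rcases h : I.input[a]? with _ | x
  · simp
  · have hx := List.mem_of_getElem? h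
    simp only [RentInstance.input, List.mem_cons, List.mem_flatMap, List.mem_finRange, true_and,
      List.not_mem_nil, or_false] at hx
    simp only [Option.getD_some]
    rcases hx with rfl | rfl | ⟨j, rfl | rfl | rfl⟩
    · omega
    · omega
    · have := p_le_P I j; omega
    · have := w_le_W I j; omega
    · split <;> omega

/-- Store the address where the arrays start. -/
def offsetExp : Exp := .add (.mul (.const 3) (.read (.const 0))) (.const 2)

/-- The initial state of the structured layer. -/
def startState (I : RentInstance) : HState where
  reg := Function.update (fun _ => 0) 1 (3 * I.n + 2)
  low := fun a => I.input.getD a 0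
  arr := fun t a b c => I.input.getD (3 * I.n + 2 + arrayOffset t a b c) 0

theorem startState_hasInput (I : RentInstance) : HasInput I (startState I) where
  off := by simp [startState]
  n := rfl
  K := rfl
  p j := input_getD I j (k := 0) (by norm_num)
  w j := input_getD I j (k := 1) (by norm_num)
  r j := input_getD I j (k := 2) (by norm_num)

theorem startState_rep (I : RentInstance) :
    Rep (startState I) (I.initialState.setReg 1 (3 * I.n + 2)) where
  reg := rfl
  low _ _ := rfl
  arr _ _ _ _ := by simp [startState, State.setReg, RentInstance.initialState]

/-- The largest stored number, the cap, is quadratic in `n + P + W + K + 2`; the third power also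
has room for the offset `3 * n + 2`. -/
theorem fitsIn_cube (I : RentInstance) : FitsIn I ((I.n + I.P + I.W + I.K + 2) ^ 3) ∧
    I.n + I.P + I.W + I.K + 2 ≤ (I.n + I.P + I.W + I.K + 2) ^ 3 ∧
    3 * I.n + 2 ≤ (I.n + I.P + I.W + I.K + 2) ^ 3 := by
  have h2 : I.K + I.P * I.W + 1 ≤ (I.n + I.P + I.W + I.K + 2) ^ 2 := by
    have : (I.P + I.W + (I.K + 2)) ^ 2 ≤ (I.n + I.P + I.W + I.K + 2) ^ 2 :=
      Nat.pow_le_pow_left (by omega) 2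
    refine le_trans ?_ this
    ring_nf
    nlinarith [Nat.zero_le (I.P * I.W), Nat.zero_le (I.P * I.K), Nat.zero_le (I.W * I.K),
      Nat.zero_le (I.P ^ 2), Nat.zero_le (I.W ^ 2), Nat.zero_le (I.K ^ 2)]
  set s := I.n + I.P + I.W + I.K + 2 with hs
  have h3 : s ^ 2 ≤ s ^ 3 := Nat.pow_le_pow_right (by omega) (by norm_num)
  have h4 : 4 * s ≤ s ^ 3 := by
    rw [pow_succ]
    exact Nat.mul_le_mul_right s (Nat.pow_le_pow_left (show 2 ≤ s by omega) 2)
  exact ⟨⟨by omega, by omega, by omega, by omega, by omega, by omega⟩, by omega, by omega⟩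

end RentSchedule

open RentSchedule WordRAM in
theorem mainTheorem7 :
    ∃ (prog : WordRAM.Program) (c d : ℕ), ∀ I : RentInstance,
      (∀ j, 0 < I.p j) → 0 < I.W →
        ∃ (t : ℕ) (s : WordRAM.State),
          WordRAM.Exec ((I.n + I.P + I.W + I.K + 2) ^ d) prog I.initialState t s ∧
          I.IsSolvedBy s ∧
          t ≤ c * (I.n * I.P * min I.W I.P) := by
  -- Storing the offset takes `7` further steps, which the extra `10` covers. The exponent is `3`
  -- for the bound `V` on stored numbers times the degree of the program.
  refine ⟨.seq (.assign 1 offsetExp) rentCmd.compile, 10000010,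
    3 * (offsetExp.deg + rentCmd.compile.deg), fun I hp hW => ?_⟩
  obtain ⟨hV, hS, hoff⟩ := fitsIn_cube I
  -- Without jobs the total weight would be `0`.
  have hn : 0 < I.n := by
    rcases I with ⟨n, p, w, Jr, K⟩
    rcases n with _ | n
    · simp [RentInstance.W] at hW
    · exact Nat.succ_pos n
  have hnP : I.n ≤ I.P := by
    have : ∑ _j : Fin I.n, 1 ≤ I.P := Finset.sum_le_sum fun j _ => hp j
    simpa using this
  rw [pow_mul]
  set V := (I.n + I.P + I.W + I.K + 2) ^ 3 with hVdef
  have hb : I.initialState.Bdd V :=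
    ⟨fun _ => Nat.zero_le _, fun a => (input_getD_le I a).trans hS⟩
  obtain ⟨h', t, ht, hQ, f, hrun⟩ := rentCmd_runs hp hV (startState_hasInput I) rfl hn hW
  obtain ⟨s, hs, hr, -⟩ := hrun (offsetExp.deg + rentCmd.compile.deg) (Nat.le_add_left _ _) _
    (startState_rep I) ⟨fun r => by
      simp only [State.setReg, Function.update_apply]; split
      · exact hoff
      · exact Nat.zero_le _, hb.2⟩
  have ev : offsetExp.eval I.initialState = 3 * I.n + 2 := rfl
  refine ⟨offsetExp.cost + 1 + t, s, .seq (.assign _ _ _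
    (Exp.fits_of_deg_le hV.two_le hb _ (Nat.le_add_right _ _))) (by rw [ev]; exact hs), ?_, ?_⟩
  · unfold RentInstance.IsSolvedBy
    rw [hr.reg]
    have hreg : h'.reg 1 = 3 * I.n + 2 := (f.reg 1 (by
      simp [rentCmd, solveCmd, Cmd.writes, dpCmd_writes]; exact ⟨⟨rfl, rfl, rfl⟩, rfl, rfl, rfl, rfl⟩)).trans rfl
    refine hQ.imp (fun ⟨h0, σ, hσ, hl⟩ => ⟨h0, σ, hσ, fun i => ?_⟩) id
    rw [← hl i]
    exact hr.low _ (by rw [hreg]; omega)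
  · have h1 : 1 ≤ I.n * I.P * min I.W I.P :=
      Nat.succ_le_of_lt (Nat.mul_pos (Nat.mul_pos hn (by omega)) (by omega))
    simp only [offsetExp, Exp.cost]
    omega
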